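/- Let $X$ be a complex manifold with $\dim_{\mathbb C}X=n\ge 2$, let $\omega$ be a Hermitian metric on $X$ (a $C^\infty$ positive definite $(1,1)$-form), and let $\eta:X\to\mathbb R$ be a $C^\infty$ function such that either $\eta>0$ everywhere or $\eta<0$ everywhere. Let $\theta_\eta$ be the operator on $\mathbb C$-valued differential forms that multiplies forms of bidegree $(p,q)$ by $\eta^p$, and put $$D_\eta=\theta_\eta\, d\,\theta_\eta^{-1},\qquad d_\eta=\eta\,\partial+\bar\partial .$$ For an operator $T$ on forms, the conjugate operator $\overline T$ is defined by $\overline T(\bar u)=\overline{T u}$; in particular $\overline D_{-\eta}$, $\overline d_{-\eta}$, $\overline\tau_{-\eta}$ are the conjugates of $D_{-\eta}$, $d_{-\eta}$, $\tau_{-\eta}$. Let $T^\star$ be the formal adjoint of $T$ with respect to the $L^2$ inner product induced by $\omega$ on forms, let $\Lambda=(\omega\wedge\cdot)^\star$, let $[A,B]=AB-BA$ whenever $A$ or $B$ has even degree, and let $$\tau_\eta=[\Lambda,\;D_\eta\omega\wedge\cdot\,].$$ Then the formal adjoints of $\omega\wedge\cdot$, $D_\eta$, $\overline D_{-\eta}$,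 $\tau_\eta$, $\overline\tau_{-\eta}$, $d_\eta\eta\wedge\cdot$ and $\overline d_{-\eta}\eta\wedge\cdot$ exist and are unique as operators on $C^\infty$ forms, and the following identities hold on $C^\infty$ differential forms of any degree on $X$: $$\begin{aligned} (a)\quad & D_\eta^\star+\tau_\eta^\star=-i\,[\Lambda,\overline D_{-\eta}]+\frac n\eta\,[\,i\,\overline d_{-\eta}\eta\wedge\cdot\,,\Lambda];\\ (b)\quad & \overline D_{-\eta}^\star+\overline\tau_{-\eta}^\star=i\,[\Lambda,D_\eta]-\frac n\eta\,[\,i\,d_\eta\eta\wedge\cdot\,,\Lambda];\\ (c)\quad & D_\eta+\tau_\eta=i\,[\overline D_{-\eta}^\star,\omega\wedge\cdot\,]-\frac n\eta\,[\,\omega\wedge\cdot\,,\,i\,(\overline d_{-\eta}\eta\wedge\cdot)^\star];\\ (d)\quad & \overline D_{-\eta}+\overline\tau_{-\eta}=-i\,[D_\eta^\star,\omega\wedge\cdot\,]+\frac n\eta\,[\,\omega\wedge\cdot\,,\,i\,(d_\eta\eta\wedge\cdot)^\star]. \end{aligned}$$ -/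

import Mathlib

open scoped Manifold ContDiff ComplexConjugate

noncomputable section

namespace TwistedForms

/-! Complex-valued differential forms on a complex manifold `X` modelled on a finite-dimensional
complex vector space `E`. As in Mathlib, the tangent space of `X` at `x` is the model space `E`,
through the preferred chart at `x`; since the changes of charts are holomorphic, the complex
structure of the tangent space is the multiplication by `Complex.I` on `E`. -/

section Pointwise

variable {E : Type*} [NormedAddCommGroup E] [NormedSpace ℂ E]

/-- Complex-valued real-multilinear alternating `k`-forms on `E`. -/
abbrev Alt (E : Type*) [NormedAddCommGroup E] [NormedSpace ℂ E] (k : ℕ) : Type _ :=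
  E [⋀^Fin k]→L[ℝ] ℂ

/-- Multiplication by a complex number, as a real-linear map of `E`. -/
def mulCLM (E : Type*) [NormedAddCommGroup E] [NormedSpace ℂ E] (z : ℂ) : E →L[ℝ] E :=
  (z • ContinuousLinearMap.id ℂ E).restrictScalars ℝ

/-- `(v₁, …, v_m) ↦ α (v₁, …, v_p) * β (v_{p+1}, …, v_m)`, where `p + q = m`. -/
def tensorMul {p q m : ℕ} (h : p + q = m) (α : Alt E p) (β : Alt E q) :
    ContinuousMultilinearMap ℝ (fun _ : Fin m => E) ℂ where
  toMultilinearMap :=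
    ((LinearMap.mul' ℝ ℂ).compMultilinearMap
      (MultilinearMap.domCoprod α.toMultilinearMap β.toMultilinearMap)).domDomCongr
        (finSumFinEquiv.trans (finCongr h))
  cont := by
    have h1 : Continuous fun v : Fin m → E =>
        α (fun i => v (finCongr h (finSumFinEquiv (Sum.inl i)))) :=
      α.coe_continuous.comp (continuous_pi fun i => continuous_apply _)
    have h2 : Continuous fun v : Fin m → E =>
        β (fun i => v (finCongr h (finSumFinEquiv (Sum.inr i)))) :=
      β.coe_continuous.comp (continuous_pi fun i => continuous_apply _)
    exact h1.mul h2

theorem tensorMul_apply {p q m : ℕ} (h : p + q = m) (α : Alt E p) (β : Alt E q)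
    (v : Fin m → E) :
    tensorMul h α β v =
      α (fun i => v (Fin.cast h (Fin.castAdd q i))) *
        β (fun j => v (Fin.cast h (Fin.natAdd p j))) :=
  rfl

/-- The exterior product `α ∧ β` of a `p`-form and a `q`-form, seen in degree `m = p + q`:
`(α ∧ β) (v₁, …, v_m) = (1 / (p! q!)) ∑_σ sgn σ α (v_{σ 1}, …, v_{σ p}) β (v_{σ (p+1)}, …)`. -/
def altWedge {p q m : ℕ} (h : p + q = m) (α : Alt E p) (β : Alt E q) : Alt E m :=
  ((p.factorial * q.factorial : ℝ)⁻¹) •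
    ContinuousMultilinearMap.alternatization (tensorMul h α β)

/-- The component of bidegree `(p, k - p)` of a `k`-form. The forms of bidegree `(p, q)` are those
with `α (z v₁, …, z v_k) = z ^ p * conj z ^ q * α (v₁, …, v_k)` for all complex `z`, so that the
pull-back by `exp (i t)` multiplies them by `exp (i (p - q) t)`; the component of bidegree
`(p, k - p)` is the corresponding Fourier coefficient of the pull-backs of `α`, computed with
the `k + 1` angles `t = π j / (k + 1)`. There is no such component if `k < p`. -/
def typePart {k : ℕ} (p : ℕ) (α : Alt E k) : Alt E k :=
  if p ≤ k then
    ((k + 1 : ℂ)⁻¹) • ∑ j ∈ Finset.range (k + 1),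
      Complex.exp (-((2 * p - k : ℂ) * (Real.pi * j / (k + 1)) * Complex.I)) •
        α.compContinuousLinearMap (mulCLM E (Complex.exp ((Real.pi * j / (k + 1)) * Complex.I)))
  else 0

/-- A fixed basis of `E` as a real vector space. -/
def realBasis (E : Type*) [NormedAddCommGroup E] [NormedSpace ℂ E] [FiniteDimensional ℂ E] :
    Module.Basis (Fin (Module.finrank ℝ E)) ℝ E :=
  Module.finBasis ℝ E

variable [FiniteDimensional ℂ E]

/-- The matrix, in the basis `realBasis E`, of the bilinear form `g (v, w) = ω (v, i w)`
attached to a `2`-form `ω`. -/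
def gram (w : Alt E 2) : Matrix (Fin (Module.finrank ℝ E)) (Fin (Module.finrank ℝ E)) ℝ :=
  fun i j => (w ![realBasis E i, Complex.I • realBasis E j]).re

/-- The Hermitian inner product of two `k`-forms induced by the real inner product `g` attached
to `ω`: `⟨α, β⟩ = (1 / k!) ∑ g^{i₁ j₁} ⋯ g^{i_k j_k} α_{i₁ … i_k} conj β_{j₁ … j_k}`,
where `(g^{i j})` is the inverse of the matrix of `g`. -/
def altInner (w : Alt E 2) {k : ℕ} (α β : Alt E k) : ℂ :=
  (k.factorial : ℂ)⁻¹ * ∑ I : Fin k → Fin (Module.finrank ℝ E),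
    ∑ J : Fin k → Fin (Module.finrank ℝ E),
      ((∏ l, (gram w)⁻¹ (I l) (J l) : ℝ) : ℂ) *
        α (fun l => realBasis E (I l)) * conj (β (fun l => realBasis E (J l)))

end Pointwise

variable {E : Type*} [NormedAddCommGroup E] [NormedSpace ℂ E]
  {X : Type*} [TopologicalSpace X] [ChartedSpace E X]

/-- Not necessarily smooth differential forms `u = (u_k)_k` on `X`, with a component `u_k` in
every degree `k`. -/
abbrev Form (E : Type*) [NormedAddCommGroup E] [NormedSpace ℂ E] (X : Type*) : Type _ :=
  X → ∀ k : ℕ, Alt E k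

/-- The component of degree `k` of the form `u` in the chart `e`, that is, the pull-back of `u_k`
by the inverse of `e`, at the point `y` of the target of `e`. -/
def inChart (e : OpenPartialHomeomorph X E) (u : Form E X) (k : ℕ) (y : E) : Alt E k :=
  (u (e.symm y) k).compContinuousLinearMap (mfderiv 𝓘(ℝ, E) 𝓘(ℝ, E) e.symm y)

/-- The form is of class `C^∞`. -/
def IsSmooth (u : Form E X) : Prop :=
  ∀ e ∈ atlas E X, ∀ k : ℕ, ContDiffOn ℝ ∞ (inChart e u k) e.target

/-- The exterior derivative `d`, computed at `x` in the preferred chart at `x`. -/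
def extd (u : Form E X) : Form E X := fun x k =>
  match k with
  | 0 => 0
  | k + 1 => extDeriv (inChart (chartAt E x) u k) (chartAt E x x)

/-- The exterior product of forms: `(u ∧ v)_m = ∑_{p + q = m} u_p ∧ v_q`. -/
def wedge (u v : Form E X) : Form E X := fun x m =>
  ∑ p : Fin (m + 1),
    altWedge (Nat.add_sub_of_le (Nat.lt_succ_iff.mp p.isLt)) (u x p) (v x (m - p))

/-- The complex conjugate of a form. -/
def conjForm (u : Form E X) : Form E X := fun x k =>
  (Complex.conjCLE : ℂ →L[ℝ] ℂ).compContinuousAlternatingMap (u x k)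

/-- The product of a form with a function. -/
def mulForm (f : X → ℂ) (u : Form E X) : Form E X := fun x k => f x • u x k

/-- A real function, seen as a form of degree `0`. -/
def ofFun (E : Type*) [NormedAddCommGroup E] [NormedSpace ℂ E] (f : X → ℝ) : Form E X :=
  fun x => Pi.single 0 (ContinuousAlternatingMap.constOfIsEmpty ℝ E (Fin 0) (f x : ℂ))

/-- The sum of the components of bidegrees `(p, q)` of `u`, over all `q`. -/
def holPart (p : ℕ) (u : Form E X) : Form E X := fun x k => typePart p (u x k)

/-- The operator `∂`: on a form of bidegree `(p, q)`, the `(p + 1, q)`-component of `d`. -/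
def del (u : Form E X) : Form E X := fun x k =>
  ∑ p ∈ Finset.range (k + 1), holPart (p + 1) (extd (holPart p u)) x k

/-- The operator `∂̄`: on a form of bidegree `(p, q)`, the `(p, q + 1)`-component of `d`. -/
def delbar (u : Form E X) : Form E X := fun x k =>
  ∑ p ∈ Finset.range (k + 1), holPart p (extd (holPart p u)) x k

/-- The conjugate operator `T̄`, defined by `T̄ ū = conj (T u)`. -/
def conjOp (T : Form E X → Form E X) : Form E X → Form E X := fun u =>
  conjForm (T (conjForm u))

/-- The commutator `[A, B] = A B - B A`. -/
def comm (A B : Form E X → Form E X) : Form E X → Form E X := fun u => A (B u) - B (A u)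

/-- The operator `θ_η`: multiplication by `η ^ p` on the forms of bidegree `(p, q)`. -/
def theta (η : X → ℝ) (u : Form E X) : Form E X := fun x k =>
  ∑ p ∈ Finset.range (k + 1), ((η x : ℂ) ^ p) • typePart p (u x k)

/-- The operator `D_η = θ_η d θ_η⁻¹`, where `θ_η⁻¹ = θ_{1/η}`. -/
def twistedD (η : X → ℝ) (u : Form E X) : Form E X :=
  theta η (extd (theta (fun x => (η x)⁻¹) u))

/-- The operator `d_η = η ∂ + ∂̄`. -/
def twistedd (η : X → ℝ) (u : Form E X) : Form E X :=
  mulForm (fun x => (η x : ℂ)) (del u) + delbar u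

/-- The operator `D̄_η`, the conjugate of `D_η`. -/
def twistedDbar (η : X → ℝ) : Form E X → Form E X := conjOp (twistedD η)

/-- The operator `d̄_η`, the conjugate of `d_η`. -/
def twisteddbar (η : X → ℝ) : Form E X → Form E X := conjOp (twistedd η)

/-- A Hermitian metric on `X`, given by its fundamental form: a `C^∞` real positive definite
form `ω` of bidegree `(1, 1)`. -/
structure HermitianMetric (E : Type*) [NormedAddCommGroup E] [NormedSpace ℂ E]
    (X : Type*) [TopologicalSpace X] [ChartedSpace E X] where
  /-- The fundamental form at each point. -/
  toAlt : X → Alt E 2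
  /-- The fundamental form is `C^∞`. -/
  smooth : IsSmooth (fun x => Pi.single 2 (toAlt x) : Form E X)
  /-- It is real. -/
  real : ∀ x v, (toAlt x v).im = 0
  /-- It is of bidegree `(1, 1)`. -/
  invariant : ∀ x (v w : E), toAlt x ![Complex.I • v, Complex.I • w] = toAlt x ![v, w]
  /-- It is positive definite. -/
  pos : ∀ x (v : E), v ≠ 0 → 0 < (toAlt x ![v, Complex.I • v]).re

namespace HermitianMetric

/-- The fundamental form `ω`. -/
def form (g : HermitianMetric E X) : Form E X := fun x => Pi.single 2 (g.toAlt x)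

/-- The Lefschetz operator `L = ω ∧ ·`. -/
def lefschetz (g : HermitianMetric E X) : Form E X → Form E X := wedge g.form

variable [FiniteDimensional ℂ E]

/-- The pointwise inner product induced by `ω`; the forms of different degrees are orthogonal. -/
def inner (g : HermitianMetric E X) (u v : Form E X) (x : X) : ℂ :=
  ∑ k ∈ Finset.range (Module.finrank ℝ E + 1), altInner (g.toAlt x) (u x k) (v x k)

variable [MeasurableSpace E] [BorelSpace E] [MeasurableSpace X] [BorelSpace X]

/-- The volume `dV_ω` on the domain of the chart `e`: the measure whose density in the chart is
`√(det (g_{i j}))`. -/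
def chartVolume (g : HermitianMetric E X) (e : OpenPartialHomeomorph X E) :
    MeasureTheory.Measure X :=
  (((realBasis E).addHaar.restrict e.target).withDensity fun y =>
    ENNReal.ofReal (Real.sqrt (gram (inChart e g.form 2 y)).det)).map e.symm

/-- The volume measure `dV_ω = ω ^ n / n!`: the smallest measure on `X` that dominates the volumes
on the domains of all charts. (These agree on the intersections of the domains, so that this
measure induces `chartVolume` on the domain of each chart.) -/
def vol (g : HermitianMetric E X) : MeasureTheory.Measure X :=
  ⨆ e : atlas E X, g.chartVolume e.1

/-- The `L²` inner product induced by `ω`. -/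
def l2Inner (g : HermitianMetric E X) (u v : Form E X) : ℂ := ∫ x, g.inner u v x ∂g.vol

/-- `w` is a value at the smooth form `v` of the formal adjoint of `T`: the form `w` is smooth and
`⟪T u, v⟫ = ⟪u, w⟫` for all smooth `u` such that `u` or `v` has compact support. -/
def IsAdjointAt (g : HermitianMetric E X) (T : Form E X → Form E X) (v w : Form E X) : Prop :=
  IsSmooth w ∧ ∀ u : Form E X, IsSmooth u → HasCompactSupport u ∨ HasCompactSupport v →
    g.l2Inner (T u) v = g.l2Inner u w

/-- The operator `T` has a formal adjoint, and this adjoint is uniquely determined, on the smooth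
forms. -/
def HasFormalAdjoint (g : HermitianMetric E X) (T : Form E X → Form E X) : Prop :=
  ∀ v : Form E X, IsSmooth v → ∃! w : Form E X, g.IsAdjointAt T v w

/-- The formal adjoint `T^⋆` of `T` with respect to the `L²` inner product induced by `ω`. -/
def formalAdjoint (g : HermitianMetric E X) (T : Form E X → Form E X) :
    Form E X → Form E X := fun v =>
  Classical.epsilon fun w => g.IsAdjointAt T v w

/-- The operator `Λ = L^⋆`. -/
def lambda (g : HermitianMetric E X) : Form E X → Form E X := g.formalAdjoint g.lefschetz

/-- The `η`-torsion operator `τ_η = [Λ, D_η ω ∧ ·]`. -/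
def torsion (g : HermitianMetric E X) (η : X → ℝ) : Form E X → Form E X :=
  comm g.lambda (wedge (twistedD η g.form))

/-- The operator `τ̄_η`, the conjugate of `τ_η`. -/
def torsionBar (g : HermitianMetric E X) (η : X → ℝ) : Form E X → Form E X :=
  conjOp (g.torsion η)

end HermitianMetric

end TwistedForms

end

/-! Everything follows from (a). Write ξ = ξ' + ξ'' for the splitting of a one-form into bidegrees
(1,0) and (0,1), L for ω ∧ ·, and let P and Q multiply forms of bidegree (p, q) by p and by q. In
real coordinates, D_η u = ∑_j c_j ∧ (∂_j u - (∂_j η / η) P u) with c_j = η dx_j' + dx_j''. The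
operator D̄_{-η} has the same shape, with Q instead of P and b_j = dx_j' - η dx_j'' instead of c_j.
The formal adjoint of D_η is therefore read off from the divergence of the vector field with
components √det(g) ⟨c_j ∧ u, v⟩, and no coordinates adapted to a point are needed, thanks to two
facts.

First, if ω varies along a path with derivative h, the part of the derivative of √det(g) ⟨u, v⟩ due
to the metric is √det(g) ⟨[Λ, h ∧ ·] u, v⟩ (`hasDerivAt_sqrt_det_mul_ip`). The scalar part of [Λ, h
∧ ·] differentiates the volume and the rest differentiates the inner product
(`IsHerm.ip_commutator`). Since D_η ω = ∑_j c_j ∧ (∂_j ω - (∂_j η / η) ω), the derivatives of the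
metric assemble into τ_η.

Second, the zeroth-order Kähler identities [Λ, c_j] = i b_j^⋆ and [Λ, b_j] = -i c_j^⋆ turn ∑_j c_j^⋆
∂_j v into the principal part of -i [Λ, D̄_{-η}] v. The summand -(∂_j η / η) ω of D_η ω produces,
through [Λ, L] = n - deg, a multiple of n c_j. The terms with n/η in the theorem compensate for it.

For one index j, all this is `IsHerm.pointwise_identity`, a consequence of an identity in an
abstract algebra, `commutation_algebra`. Summing over j, the divergence equals √det(g) (⟨D_η u, v⟩ -
⟨u, S v⟩), where S, called `dAdj`, is the right-hand side of (a) minus the pointwise adjoint of τ_η.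
Integrating in a chart and using a partition of unity shows that S is formally adjoint to D_η
(`l2Inner_twistedD`). Formal adjoints are unique, because a smooth form orthogonal to all test forms
vanishes, and (a) follows. Identity (b) is the conjugate of (a) for -η; (c) and (d) are the adjoints
of (a) and (b). -/

noncomputable section

namespace TwistedForms

/-! ### Exterior products by a one-form, and their associativity with general exterior products -/

section Exterior

variable {E : Type*} [NormedAddCommGroup E] [NormedSpace ℂ E]

/-- The fiber of the bundle of forms of all degrees. -/
abbrev Fib (E : Type*) [NormedAddCommGroup E] [NormedSpace ℂ E] : Type _ := ∀ k : ℕ, Alt E k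

/-- The exterior product of a `1`-form and a `k`-form. -/
def oneWedge {k : ℕ} (ξ : E →L[ℝ] ℂ) (α : Alt E k) : Alt E (k + 1) :=
  ContinuousAlternatingMap.alternatizeUncurryFin (ξ.smulRight α)

theorem oneWedge_apply {k : ℕ} (ξ : E →L[ℝ] ℂ) (α : Alt E k) (v : Fin (k + 1) → E) :
    oneWedge ξ α v = ∑ i : Fin (k + 1), (-1 : ℤ) ^ (i : ℕ) • (ξ (v i) * α (i.removeNth v)) := by
  simp [oneWedge, ContinuousAlternatingMap.alternatizeUncurryFin_apply]

/-- A permutation of `Fin (m + 1)` amounts to the image `i` of `0` together with the permutation `τ`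
that it induces on the remaining indices. This is the Laplace expansion along the first slot. -/
theorem sum_perm_succ {m : ℕ} {M : Type*} [AddCommMonoid M]
    (f : Equiv.Perm (Fin (m + 1)) → M) :
    ∑ σ, f σ = ∑ i : Fin (m + 1), ∑ τ : Equiv.Perm (Fin m),
      f (i.cycleRange.symm * Equiv.Perm.decomposeFin.symm (0, τ)) := by
  rw [← Fintype.sum_prod_type']
  symm
  refine Fintype.sum_bijective _ ?_ _ _ fun _ => rfl
  rw [Fintype.bijective_iff_injective_and_card]
  constructor
  · rintro ⟨i, τ⟩ ⟨j, τ'⟩ h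
    have h0 : i = j := by
      have := congrArg (fun σ : Equiv.Perm (Fin (m + 1)) => σ 0) h
      simpa using this
    subst h0
    have := mul_left_cancel h
    simpa using this
  · simp [Fintype.card_perm, Nat.factorial_succ]

theorem sign_cycleRange_mul {m : ℕ} (i : Fin (m + 1)) (τ : Equiv.Perm (Fin m)) :
    Equiv.Perm.sign (i.cycleRange.symm * Equiv.Perm.decomposeFin.symm (0, τ)) =
      (-1) ^ (i : ℕ) * Equiv.Perm.sign τ := by
  rw [Equiv.Perm.sign_mul, Equiv.Perm.sign_symm, Fin.sign_cycleRange,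
    Equiv.Perm.decomposeFin.symm_sign]
  simp

theorem cycleRange_mul_zero {m : ℕ} (i : Fin (m + 1)) (τ : Equiv.Perm (Fin m)) :
    (i.cycleRange.symm * Equiv.Perm.decomposeFin.symm (0, τ)) 0 = i := by
  simp

theorem cycleRange_mul_succ {m : ℕ} (i : Fin (m + 1)) (τ : Equiv.Perm (Fin m)) (j : Fin m) :
    (i.cycleRange.symm * Equiv.Perm.decomposeFin.symm (0, τ)) j.succ = i.succAbove (τ j) := by
  simp

theorem altWedge_apply {p q m : ℕ} (h : p + q = m) (α : Alt E p) (β : Alt E q) (v : Fin m → E) :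
    altWedge h α β v = ((p.factorial * q.factorial : ℝ)⁻¹) •
      ∑ σ : Equiv.Perm (Fin m), Equiv.Perm.sign σ •
        (α (fun i => v (σ (Fin.cast h (Fin.castAdd q i)))) *
          β (fun j => v (σ (Fin.cast h (Fin.natAdd p j))))) := by
  simp [altWedge, ContinuousMultilinearMap.alternatization_apply_apply, tensorMul_apply]

/-- Permuting the first `p` arguments of the first factor. -/
theorem sum_perm_comp_left {E : Type*} {p q m : ℕ} (h : p + q = m) (F : (Fin p → E) → ℂ) (G : (Fin q → E) → ℂ)
    (π : Equiv.Perm (Fin p)) (v : Fin m → E) :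
    ∑ σ : Equiv.Perm (Fin m), Equiv.Perm.sign σ •
        (F (fun i => v (σ (Fin.cast h (Fin.castAdd q (π i))))) *
          G (fun j => v (σ (Fin.cast h (Fin.natAdd p j))))) =
    Equiv.Perm.sign π • ∑ σ : Equiv.Perm (Fin m), Equiv.Perm.sign σ •
        (F (fun i => v (σ (Fin.cast h (Fin.castAdd q i)))) *
          G (fun j => v (σ (Fin.cast h (Fin.natAdd p j))))) := by
  subst h
  let Q : Equiv.Perm (Fin (p + q)) := finSumFinEquiv.permCongr (Equiv.Perm.sumCongr π 1)
  have hs : Equiv.Perm.sign Q = Equiv.Perm.sign π := by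
    simp [Q]
  have hl : ∀ i, Q (Fin.castAdd q i) = Fin.castAdd q (π i) := by
    intro i; simp [Q, Equiv.permCongr_apply]
  have hr : ∀ j, Q (Fin.natAdd p j) = Fin.natAdd p j := by
    intro i; simp [Q, Equiv.permCongr_apply]
  rw [← Equiv.sum_comp (Equiv.mulRight Q)
    (fun σ => Equiv.Perm.sign σ • (F (fun i => v (σ (Fin.cast rfl (Fin.castAdd q i)))) *
          G (fun j => v (σ (Fin.cast rfl (Fin.natAdd p j))))))]
  rw [Finset.smul_sum]
  refine Finset.sum_congr rfl fun σ _ => ?_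
  simp only [Equiv.coe_mulRight, Fin.cast_eq_self, Equiv.Perm.mul_apply, hl, hr,
    Equiv.Perm.sign_mul, hs]
  rw [smul_smul, mul_comm (Equiv.Perm.sign σ), ← mul_assoc, Int.units_mul_self, one_mul]

/-- Each of the p + 1 slots that ξ can occupy in ξ ∧ α gives the same sum over permutations, since a
cycle brings the slot to position 0 and its sign cancels. The factor p + 1 is (p + 1)! / p!, the
ratio of the normalisations. What remains is expanded along the slot of ξ by `sum_perm_succ`. -/
theorem altWedge_oneWedge {p q m : ℕ} (h : p + q = m) (h' : p + 1 + q = m + 1) (ξ : E →L[ℝ] ℂ)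
    (α : Alt E p) (β : Alt E q) :
    altWedge h' (oneWedge ξ α) β = oneWedge ξ (altWedge h α β) := by
  ext v
  rw [altWedge_apply, oneWedge_apply]
  have hc : ∀ w : Fin (p + 1) → E, oneWedge ξ α w =
      ∑ i : Fin (p + 1), Equiv.Perm.sign (i.cycleRange.symm) •
        (ξ (w (i.cycleRange.symm 0)) * α (fun j => w (i.cycleRange.symm j.succ))) := by
    intro w
    rw [oneWedge_apply]
    refine Finset.sum_congr rfl fun i _ => ?_
    rw [Equiv.Perm.sign_symm, Fin.sign_cycleRange, Units.smul_def]
    simp only [Fin.cycleRange_symm_zero, Fin.cycleRange_symm_succ]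
    push_cast
    rfl
  have h1 : ∑ σ : Equiv.Perm (Fin (m + 1)), Equiv.Perm.sign σ •
        (oneWedge ξ α (fun i => v (σ (Fin.cast h' (Fin.castAdd q i)))) *
          β (fun j => v (σ (Fin.cast h' (Fin.natAdd (p + 1) j))))) =
      ((p : ℝ) + 1) • ∑ σ : Equiv.Perm (Fin (m + 1)), Equiv.Perm.sign σ •
        (ξ (v (σ 0)) * (α (fun i => v (σ (Fin.cast h (Fin.castAdd q i)).succ)) *
          β (fun j => v (σ (Fin.cast h (Fin.natAdd p j)).succ)))) := by
    simp only [hc, Finset.sum_mul, Finset.smul_sum (s := (Finset.univ : Finset (Fin (p + 1))))]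
    rw [Finset.sum_comm]
    have : ∀ i : Fin (p + 1), ∑ σ : Equiv.Perm (Fin (m + 1)), Equiv.Perm.sign σ •
        ((Equiv.Perm.sign (i.cycleRange.symm) •
          (ξ (v (σ (Fin.cast h' (Fin.castAdd q (i.cycleRange.symm 0))))) *
          α fun j => v (σ (Fin.cast h' (Fin.castAdd q (i.cycleRange.symm j.succ)))))) *
          β (fun j => v (σ (Fin.cast h' (Fin.natAdd (p + 1) j))))) =
        ∑ σ : Equiv.Perm (Fin (m + 1)), Equiv.Perm.sign σ •
        (ξ (v (σ 0)) * (α (fun i => v (σ (Fin.cast h (Fin.castAdd q i)).succ)) *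
          β (fun j => v (σ (Fin.cast h (Fin.natAdd p j)).succ)))) := by
      intro i
      simp only [smul_mul_assoc]
      simp only [smul_comm _ (Equiv.Perm.sign (i.cycleRange.symm))]
      rw [← Finset.smul_sum]
      have := sum_perm_comp_left h' (fun u : Fin (p + 1) → E => ξ (u 0) * α (fun j => u j.succ))
        β i.cycleRange.symm v
      rw [this, smul_smul, Int.units_mul_self, one_smul]
      refine Finset.sum_congr rfl fun σ _ => ?_
      rw [mul_assoc]
      have e1 : Fin.cast h' (Fin.castAdd q (0 : Fin (p + 1))) = 0 := by
        ext; simp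
      have e2 : ∀ j : Fin p, Fin.cast h' (Fin.castAdd q j.succ) =
          (Fin.cast h (Fin.castAdd q j)).succ := by
        intro j; ext; simp
      have e3 : ∀ j : Fin q, Fin.cast h' (Fin.natAdd (p + 1) j) =
          (Fin.cast h (Fin.natAdd p j)).succ := by
        intro j; ext; simp; omega
      simp only [e1, e2, e3]
    simp only [this, Finset.sum_const, Finset.card_univ, Fintype.card_fin]
    rw [← Nat.cast_smul_eq_nsmul ℝ]
    push_cast
    rfl
  rw [h1, smul_smul]
  have h2 : ∑ σ : Equiv.Perm (Fin (m + 1)), Equiv.Perm.sign σ •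
        (ξ (v (σ 0)) * (α (fun i => v (σ (Fin.cast h (Fin.castAdd q i)).succ)) *
          β (fun j => v (σ (Fin.cast h (Fin.natAdd p j)).succ)))) =
      ∑ i : Fin (m + 1), (-1 : ℤ) ^ (i : ℕ) • (ξ (v i) *
        ∑ σ : Equiv.Perm (Fin m), Equiv.Perm.sign σ •
        (α (fun j => i.removeNth v (σ (Fin.cast h (Fin.castAdd q j)))) *
          β (fun j => i.removeNth v (σ (Fin.cast h (Fin.natAdd p j)))))) := by
    rw [sum_perm_succ]
    refine Finset.sum_congr rfl fun i _ => ?_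
    rw [Finset.mul_sum, Finset.smul_sum]
    refine Finset.sum_congr rfl fun τ _ => ?_
    rw [sign_cycleRange_mul, cycleRange_mul_zero]
    simp only [cycleRange_mul_succ]
    rw [mul_smul, Units.smul_def]
    simp only [mul_smul_comm, Fin.removeNth]
    push_cast
    rfl
  rw [h2, Finset.smul_sum]
  refine Finset.sum_congr rfl fun i _ => ?_
  rw [altWedge_apply]
  have : ((((p + 1).factorial : ℝ) * (q.factorial : ℝ))⁻¹ * ((p : ℝ) + 1)) =
      (((p.factorial : ℝ) * (q.factorial : ℝ))⁻¹) := by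
    rw [Nat.factorial_succ]
    have := Nat.factorial_ne_zero p
    have := Nat.factorial_ne_zero q
    push_cast
    field_simp
  rw [this, mul_smul_comm, smul_comm]

theorem altWedge_zero_left {k : ℕ} (h : 0 + k = k) (α : Alt E 0) (β : Alt E k) :
    altWedge h α β = α 0 • β := by
  ext v
  rw [altWedge_apply]
  have : ∀ σ : Equiv.Perm (Fin k), Equiv.Perm.sign σ •
        (α (fun i => v (σ (Fin.cast h (Fin.castAdd k i)))) *
          β (fun j => v (σ (Fin.cast h (Fin.natAdd 0 j))))) = α 0 * β v := by
    intro σ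
    have h1 : (fun j => v (σ (Fin.cast h (Fin.natAdd 0 j)))) = v ∘ σ := by
      ext j; simp
    have h2 : β (v ∘ σ) = Equiv.Perm.sign σ • β v := β.toAlternatingMap.map_perm v σ
    rw [h1, h2, Subsingleton.elim (fun i => v (σ (Fin.cast h (Fin.castAdd k i)))) 0,
      mul_smul_comm, smul_smul, Int.units_mul_self, one_smul]
  simp only [this, Finset.sum_const, Finset.card_univ, Fintype.card_perm, Fintype.card_fin]
  rw [← Nat.cast_smul_eq_nsmul ℝ, smul_smul]
  have := Nat.factorial_ne_zero k
  rw [Nat.factorial_zero, Nat.cast_one, one_mul, inv_mul_cancel₀ (by exact_mod_cast this), one_smul]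
  rfl

end Exterior

/-! ### The exterior algebra at a point: products, contractions and their commutation rules -/

section Fiber

variable {E : Type*} [NormedAddCommGroup E] [NormedSpace ℂ E]

theorem alt_smul_zero {k : ℕ} (c : ℂ) : c • (0 : Alt E k) = 0 := by
  ext v
  exact mul_zero c

theorem alt_zero_smul {k : ℕ} (α : Alt E k) : (0 : ℂ) • α = 0 := by
  ext v
  exact zero_mul (α v)

theorem altWedge_add_left {p q m : ℕ} (h : p + q = m) (α α' : Alt E p) (β : Alt E q) :
    altWedge h (α + α') β = altWedge h α β + altWedge h α' β := by
  ext v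
  simp [altWedge_apply, add_mul, Finset.sum_add_distrib]

theorem altWedge_smul_left {p q m : ℕ} (h : p + q = m) (c : ℂ) (α : Alt E p) (β : Alt E q) :
    altWedge h (c • α) β = c • altWedge h α β := by
  ext v
  simp only [altWedge_apply, ContinuousAlternatingMap.smul_apply, smul_eq_mul, mul_assoc]
  simp only [← mul_smul_comm, ← Finset.mul_sum]

theorem altWedge_add_right {p q m : ℕ} (h : p + q = m) (α : Alt E p) (β β' : Alt E q) :
    altWedge h α (β + β') = altWedge h α β + altWedge h α β' := by
  ext v
  simp [altWedge_apply, mul_add, Finset.sum_add_distrib]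

theorem altWedge_smul_right {p q m : ℕ} (h : p + q = m) (c : ℂ) (α : Alt E p) (β : Alt E q) :
    altWedge h α (c • β) = c • altWedge h α β := by
  ext v
  simp only [altWedge_apply, ContinuousAlternatingMap.smul_apply, smul_eq_mul, mul_left_comm _ c]
  simp only [← mul_smul_comm, ← Finset.mul_sum]

theorem altWedge_left_zero {p q m : ℕ} (h : p + q = m) (β : Alt E q) :
    altWedge h (0 : Alt E p) β = 0 := by
  ext v
  simp [altWedge_apply]

theorem oneWedge_add_left {k : ℕ} (ξ ζ : E →L[ℝ] ℂ) (α : Alt E k) :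
    oneWedge (ξ + ζ) α = oneWedge ξ α + oneWedge ζ α := by
  ext v
  simp [oneWedge_apply, add_mul, Finset.sum_add_distrib]

theorem oneWedge_add_right {k : ℕ} (ξ : E →L[ℝ] ℂ) (α β : Alt E k) :
    oneWedge ξ (α + β) = oneWedge ξ α + oneWedge ξ β := by
  ext v
  simp [oneWedge_apply, mul_add, Finset.sum_add_distrib]

theorem oneWedge_smul_left {k : ℕ} (c : ℂ) (ξ : E →L[ℝ] ℂ) (α : Alt E k) :
    oneWedge (c • ξ) α = c • oneWedge ξ α := by
  ext v
  simp only [oneWedge_apply, ContinuousAlternatingMap.smul_apply, smul_eq_mul,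
    smul_apply, mul_assoc, Finset.mul_sum, mul_smul_comm]

theorem oneWedge_smul_right {k : ℕ} (c : ℂ) (ξ : E →L[ℝ] ℂ) (α : Alt E k) :
    oneWedge ξ (c • α) = c • oneWedge ξ α := by
  ext v
  simp only [oneWedge_apply, ContinuousAlternatingMap.smul_apply, smul_eq_mul,
    mul_left_comm _ c, Finset.mul_sum, mul_smul_comm]

/-- The complex-linear operators on the forms of all degrees. -/
def Op (E : Type*) [NormedAddCommGroup E] [NormedSpace ℂ E] : Type _ := Module.End ℂ (Fib E)

instance : Ring (Op E) := inferInstanceAs (Ring (Module.End ℂ (Fib E)))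

instance : Algebra ℂ (Op E) := inferInstanceAs (Algebra ℂ (Module.End ℂ (Fib E)))

instance : FunLike (Op E) (Fib E) (Fib E) :=
  inferInstanceAs (FunLike (Fib E →ₗ[ℂ] Fib E) (Fib E) (Fib E))

instance : LinearMapClass (Op E) ℂ (Fib E) (Fib E) :=
  inferInstanceAs (LinearMapClass (Fib E →ₗ[ℂ] Fib E) ℂ (Fib E) (Fib E))

namespace Op

/-- A linear map, as an operator. -/
def of (T : Fib E →ₗ[ℂ] Fib E) : Op E := T

theorem of_apply (T : Fib E →ₗ[ℂ] Fib E) (α : Fib E) : of T α = T α := rfl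

theorem ext {S T : Op E} (h : ∀ α, S α = T α) : S = T := DFunLike.ext _ _ h

theorem mul_apply (S T : Op E) (α : Fib E) : (S * T) α = S (T α) := rfl

theorem one_apply (α : Fib E) : (1 : Op E) α = α := rfl

theorem zero_apply (α : Fib E) : (0 : Op E) α = 0 := rfl

theorem add_apply (S T : Op E) (α : Fib E) : (S + T) α = S α + T α := rfl

theorem sub_apply (S T : Op E) (α : Fib E) : (S - T) α = S α - T α := rfl

theorem neg_apply (S : Op E) (α : Fib E) : (-S) α = -S α := rfl

theorem smul_apply (c : ℂ) (S : Op E) (α : Fib E) : (c • S) α = c • S α := rfl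

theorem sum_apply {ι : Type*} (s : Finset ι) (S : ι → Op E) (α : Fib E) :
    (∑ i ∈ s, S i) α = ∑ i ∈ s, S i α :=
  LinearMap.sum_apply s S α

theorem eq_zero_of_eq_neg {T : Op E} (h : T = -T) : T = 0 := by
  have h2 : (2 : ℂ) • T = 0 := by
    rw [two_smul]
    nth_rewrite 2 [h]
    exact add_neg_cancel T
  have h3 := congrArg ((2 : ℂ)⁻¹ • ·) h2
  simpa [smul_smul] using h3

end Op

/-- The exterior product by a `1`-form, on the forms of all degrees. -/
def eps : (E →L[ℝ] ℂ) →ₗ[ℂ] Op E where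
  toFun ξ := Op.of
    { toFun := fun α k => match k with
        | 0 => 0
        | k + 1 => oneWedge ξ (α k)
      map_add' := fun α β => by
        funext k; cases k <;> simp [oneWedge_add_right]
      map_smul' := fun c α => by
        funext k
        cases k with
        | zero => exact (alt_smul_zero _).symm
        | succ k => exact oneWedge_smul_right _ _ _ }
  map_add' ξ ζ := by
    refine Op.ext fun α => ?_
    funext k
    cases k with
    | zero => exact (add_zero _).symm
    | succ k => exact oneWedge_add_left _ _ _
  map_smul' c ξ := by
    refine Op.ext fun α => ?_
    funext k
    cases k with
    | zero => exact (alt_smul_zero _).symm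
    | succ k => exact oneWedge_smul_left _ _ _

theorem eps_apply_zero (ξ : E →L[ℝ] ℂ) (α : Fib E) : eps ξ α 0 = 0 := rfl

theorem eps_apply_succ (ξ : E →L[ℝ] ℂ) (α : Fib E) (k : ℕ) :
    eps ξ α (k + 1) = oneWedge ξ (α k) := rfl

/-- The contraction by a vector, on the forms of all degrees. -/
def ins : E →ₗ[ℝ] Op E where
  toFun v := Op.of
    { toFun := fun α k => (α (k + 1)).curryLeft v
      map_add' := fun α β => rfl
      map_smul' := fun c α => rfl }
  map_add' v w := by
    refine Op.ext fun α => ?_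
    funext k
    exact map_add (α (k + 1)).curryLeft v w
  map_smul' c v := by
    refine Op.ext fun α => ?_
    funext k
    exact map_smul (α (k + 1)).curryLeft c v

theorem ins_apply (v : E) (α : Fib E) (k : ℕ) : ins v α k = (α (k + 1)).curryLeft v := rfl

theorem curryLeft_oneWedge_zero (ξ : E →L[ℝ] ℂ) (α : Alt E 0) (v : E) :
    (oneWedge ξ α).curryLeft v = ξ v • α := by
  ext w
  simp [oneWedge_apply, Subsingleton.elim _ w]

theorem curryLeft_oneWedge_succ {k : ℕ} (ξ : E →L[ℝ] ℂ) (α : Alt E (k + 1)) (v : E) :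
    (oneWedge ξ α).curryLeft v = ξ v • α - oneWedge ξ (α.curryLeft v) := by
  ext w
  simp only [ContinuousAlternatingMap.curryLeft_apply_apply, oneWedge_apply,
    ContinuousAlternatingMap.sub_apply, ContinuousAlternatingMap.smul_apply, smul_eq_mul]
  rw [Fin.sum_univ_succ, sub_eq_add_neg, ← Finset.sum_neg_distrib]
  congr 1
  · simp [Matrix.vecCons]
  · refine Finset.sum_congr rfl fun i _ => ?_
    have : (Fin.succ i).removeNth (Matrix.vecCons v w) = Matrix.vecCons v (i.removeNth w) :=
      by
      funext j
      refine Fin.cases ?_ (fun j => ?_) j <;> simp [Fin.removeNth, Matrix.vecCons]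
    rw [this, Matrix.cons_val_succ, Fin.val_succ, pow_succ]
    simp

/-- Contraction is an antiderivation. Together with the anticommutation of contractions and of
exterior products, this rule generates the pointwise algebra below. -/
theorem ins_mul_eps (v : E) (ξ : E →L[ℝ] ℂ) :
    ins v * eps ξ = ξ v • (1 : Op E) - eps ξ * ins v := by
  refine Op.ext fun α => ?_
  funext k
  cases k with
  | zero =>
    change (oneWedge ξ (α 0)).curryLeft v = ξ v • α 0 - 0
    rw [curryLeft_oneWedge_zero, sub_zero]
  | succ k => exact curryLeft_oneWedge_succ ξ (α (k + 1)) v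

theorem ins_mul_ins (v w : E) : ins v * ins w = -((ins w : Op E) * ins v) := by
  refine Op.ext fun α => ?_
  funext k
  ext u
  change α (k + 2) (Matrix.vecCons w (Matrix.vecCons v u)) =
    -α (k + 2) (Matrix.vecCons v (Matrix.vecCons w u))
  have := (α (k + 2)).toAlternatingMap.map_swap (Matrix.vecCons v (Matrix.vecCons w u))
    (i := 0) (j := 1) (by simp)
  have h2 : (Matrix.vecCons v (Matrix.vecCons w u)) ∘ Equiv.swap (0 : Fin (k + 2)) 1 =
      Matrix.vecCons w (Matrix.vecCons v u) := by
    funext i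
    refine Fin.cases ?_ (fun i => ?_) i
    · simp
    · refine Fin.cases ?_ (fun i => ?_) i
      · simp [Fin.succ_zero_eq_one]
      · rw [Function.comp_apply, Equiv.swap_apply_of_ne_of_ne]
        · simp
        · exact Fin.succ_ne_zero _
        · rw [← Fin.succ_zero_eq_one]; intro h
          exact Fin.succ_ne_zero _ (Fin.succ_injective _ h)
  rw [h2] at this
  exact this

/-- A form without component of degree `0` is determined by its contractions. -/
theorem fib_succ_ext {k : ℕ} {α β : Alt E (k + 1)} (h : ∀ v, α.curryLeft v = β.curryLeft v) :
    α = β := by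
  ext u
  have := congrArg (fun γ : Alt E k => γ (Matrix.vecTail u)) (h (u 0))
  simp only [ContinuousAlternatingMap.curryLeft_apply_apply] at this
  have hu : Matrix.vecCons (u 0) (Matrix.vecTail u) = u := Matrix.cons_head_tail u
  rwa [hu] at this

/-- The anticommutator commutes with every contraction and has no component of degree 0. By
induction on the degree of the output it vanishes, as a form of positive degree is determined by its
contractions. -/
theorem eps_mul_eps (ξ ζ : E →L[ℝ] ℂ) :
    eps ξ * eps ζ = -((eps ζ : Op E) * eps ξ) := by
  rw [eq_neg_iff_add_eq_zero]
  have key : ∀ v, ins v * (eps ξ * eps ζ + eps ζ * eps ξ) =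
      (eps ξ * eps ζ + eps ζ * eps ξ) * (ins v : Op E) := by
    intro v
    have h1 : ins v * (eps ξ * eps ζ + eps ζ * eps ξ) =
      (ins v * eps ξ) * eps ζ + (ins v * eps ζ) * eps ξ := by noncomm_ring
    have h2 : (ξ v • (1 : Op E) - eps ξ * ins v) * eps ζ =
      ξ v • eps ζ - eps ξ * (ins v * eps ζ) := by
      rw [sub_mul, smul_mul_assoc, one_mul, mul_assoc]
    have h3 : (ζ v • (1 : Op E) - eps ζ * ins v) * eps ξ =
      ζ v • eps ξ - eps ζ * (ins v * eps ξ) := by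
      rw [sub_mul, smul_mul_assoc, one_mul, mul_assoc]
    rw [h1, ins_mul_eps, ins_mul_eps, h2, h3, ins_mul_eps, ins_mul_eps]
    simp only [mul_sub, mul_smul_comm, mul_one, add_mul, mul_assoc]
    abel
  have h0 : ∀ k : ℕ, ∀ α : Fib E, ((eps ξ * eps ζ + eps ζ * eps ξ) α) k = 0 := by
    intro k
    induction k with
    | zero => intro α; exact add_zero _
    | succ k ih =>
      intro α
      refine fib_succ_ext fun v => ?_
      have h1 := congrArg (fun T : Module.End ℂ (Fib E) => T α k) (key v)
      exact h1.trans (ih _)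
  refine Op.ext fun α => ?_
  funext k
  exact h0 k α

/-- The exterior product by a `p`-form, on the forms of all degrees. -/
def wd (p : ℕ) : Alt E p →ₗ[ℂ] Op E where
  toFun ρ := Op.of
    { toFun := fun α m =>
        if h : p ≤ m then altWedge (Nat.add_sub_of_le h) ρ (α (m - p)) else 0
      map_add' := fun α β => by
        funext k
        by_cases h : p ≤ k <;> simp [h, altWedge_add_right]
      map_smul' := fun c α => by
        funext k
        by_cases h : p ≤ k
        · simp [h, altWedge_smul_right]
        · simp only [dif_neg h, RingHom.id_apply, Pi.smul_apply]
          exact (alt_smul_zero (E := E) c).symm }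
  map_add' ξ ζ := by
    refine Op.ext fun α => ?_
    funext k
    by_cases h : p ≤ k <;> simp [h, altWedge_add_left, Op.of_apply, Op.add_apply]
  map_smul' c ξ := by
    refine Op.ext fun α => ?_
    funext k
    by_cases h : p ≤ k
    · simp [h, altWedge_smul_left, Op.of_apply, Op.smul_apply]
    · have hz : ∀ ρ : Alt E p, (if h : p ≤ k then altWedge (Nat.add_sub_of_le h) ρ (α (k - p))
          else (0 : Alt E k)) = 0 := fun ρ => dif_neg h
      exact (hz (c • ξ)).trans ((congrArg (c • ·) (hz ξ)).trans (alt_smul_zero c)).symm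

theorem wd_apply_of_le {p m : ℕ} (h : p ≤ m) (ρ : Alt E p) (α : Fib E) :
    wd p ρ α m = altWedge (Nat.add_sub_of_le h) ρ (α (m - p)) := dif_pos h

theorem wd_apply_of_lt {p m : ℕ} (h : m < p) (ρ : Alt E p) (α : Fib E) :
    wd p ρ α m = 0 := dif_neg (not_le.mpr h)

theorem wd_apply {p q m : ℕ} (h : p + q = m) (ρ : Alt E p) (α : Fib E) :
    wd p ρ α m = altWedge h ρ (α q) := by
  obtain rfl : q = m - p := by omega
  exact wd_apply_of_le (by omega) ρ α

theorem wd_zero (ρ : Alt E 0) : wd 0 ρ = ρ 0 • (1 : Op E) := by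
  refine Op.ext fun α => ?_
  funext k
  rw [wd_apply (zero_add k), altWedge_zero_left]
  rfl

/-- With `alt_succ_eq`, this makes every product by a form a polynomial in products by one-forms, so
that no sum over permutations is needed any more. -/
theorem wd_oneWedge {p : ℕ} (ξ : E →L[ℝ] ℂ) (ρ : Alt E p) :
    wd (p + 1) (oneWedge ξ ρ) = eps ξ * wd p ρ := by
  refine Op.ext fun α => ?_
  funext m
  cases m with
  | zero => rw [wd_apply_of_lt (Nat.succ_pos p)]; rfl
  | succ m =>
    by_cases h : p ≤ m
    · obtain ⟨q, rfl⟩ := Nat.exists_eq_add_of_le h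
      rw [wd_apply (p := p + 1) (q := q) (by ring)]
      change _ = oneWedge ξ (wd p ρ α (p + q))
      rw [wd_apply (q := q) rfl, altWedge_oneWedge rfl]
    · rw [wd_apply_of_lt (by omega)]
      change _ = oneWedge ξ (wd p ρ α m)
      rw [wd_apply_of_lt (by omega)]
      ext v
      simp [oneWedge_apply]

/-- A form of degree `1`, as a continuous linear map. -/
def slot (ρ : Alt E 1) : E →L[ℝ] ℂ :=
  (ContinuousAlternatingMap.ofSubsingleton ℝ E ℂ (0 : Fin 1)).symm ρ

theorem slot_apply (ρ : Alt E 1) (v : E) : slot ρ v = ρ (fun _ => v) := rfl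

/-- The constant `1`, as a form of degree `0`. -/
def altOne : Alt E 0 := ContinuousAlternatingMap.constOfIsEmpty ℝ E (Fin 0) (1 : ℂ)

theorem oneWedge_slot (ρ : Alt E 1) : oneWedge (slot ρ) altOne = ρ := by
  ext v
  have : v = fun _ => v 0 := by funext i; rw [Fin.fin_one_eq_zero i]
  rw [oneWedge_apply, this, Fintype.sum_eq_single 0]
  · simp [slot_apply, altOne]
  · intro i hi
    exact absurd (Fin.fin_one_eq_zero i) hi

theorem wd_one (ρ : Alt E 1) : wd 1 ρ = eps (slot ρ) := by
  conv_lhs => rw [← oneWedge_slot ρ]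
  rw [wd_oneWedge, wd_zero]
  have : (altOne : Alt E 0) 0 = 1 := rfl
  rw [this, one_smul, mul_one]

theorem slot_curryLeft_apply (h : Alt E 2) (v w : E) : slot (h.curryLeft v) w = h ![v, w] := by
  rw [slot_apply, ContinuousAlternatingMap.curryLeft_apply_apply]
  congr 1
  funext i
  fin_cases i <;> rfl

theorem alt_two_swap (h : Alt E 2) (v w : E) : h ![v, w] = -h ![w, v] := by
  have := h.toAlternatingMap.map_swap ![w, v] (i := 0) (j := 1) (by simp)
  have h2 : ![w, v] ∘ Equiv.swap (0 : Fin 2) 1 = ![v, w] := by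
    funext i; fin_cases i <;> simp
  rw [h2] at this
  exact this

/-- The contraction of a `2`-form by a vector. -/
def slotL (h : Alt E 2) : E →ₗ[ℝ] (E →L[ℝ] ℂ) where
  toFun v := slot (h.curryLeft v)
  map_add' v w := by ext u; simp [slot_apply, map_add]
  map_smul' c v := by ext u; simp [slot_apply]

theorem slotL_apply (h : Alt E 2) (v w : E) : slotL h v w = h ![v, w] :=
  slot_curryLeft_apply h v w

/-- The multiplication of the forms of degree `k` by `k`. -/
def degOp : Op E := Op.of
  { toFun := fun α k => (k : ℂ) • α k
    map_add' := fun α β => by funext k; simp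
    map_smul' := fun c α => by funext k; simp [smul_smul, mul_comm] }

theorem degOp_apply (α : Fib E) (k : ℕ) : degOp α k = (k : ℂ) • α k := rfl

variable [FiniteDimensional ℂ E]

instance finiteDimensional_real : FiniteDimensional ℝ E :=
  FiniteDimensional.complexToReal E

/-- The coordinates in the basis `realBasis E`, as complex-valued `1`-forms. -/
def coord (a : Fin (Module.finrank ℝ E)) : E →L[ℝ] ℂ :=
  Complex.ofRealCLM.comp (LinearMap.toContinuousLinearMap ((realBasis E).coord a))

theorem coord_apply (a : Fin (Module.finrank ℝ E)) (v : E) :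
    coord a v = ((realBasis E).repr v a : ℂ) := by
  simp [coord]

theorem sum_coord_smul (ξ : E →L[ℝ] ℂ) :
    ∑ a, ξ (realBasis E a) • coord a = ξ := by
  ext v
  conv_rhs => rw [← (realBasis E).sum_repr v, map_sum]
  simp [coord_apply, mul_comm]

theorem sum_repr_smul {M : Type*} [AddCommGroup M] [Module ℝ M] (f : E →ₗ[ℝ] M) (v : E) :
    ∑ a, (realBasis E).repr v a • f (realBasis E a) = f v := by
  conv_rhs => rw [← (realBasis E).sum_repr v, map_sum]
  simp

/-- Euler's identity. It writes a form of positive degree as a combination of products with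
one-forms, whence `alt_induction`, and it exhibits `degOp` as ∑ dx_a ∧ ι_a. -/
theorem sum_oneWedge_curryLeft {k : ℕ} (α : Alt E (k + 1)) :
    ∑ a, oneWedge (coord a) (α.curryLeft (realBasis E a)) = ((k : ℂ) + 1) • α := by
  have h := ContinuousAlternatingMap.alternatizeUncurryFin_curryLeft α
  have h2 : ((k : ℂ) + 1) • α = (k + 1) • α := by
    rw [← Nat.cast_smul_eq_nsmul ℂ]; push_cast; rfl
  rw [h2, ← h]
  ext v
  rw [ContinuousAlternatingMap.sum_apply, ContinuousAlternatingMap.alternatizeUncurryFin_apply]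
  simp only [oneWedge_apply]
  rw [Finset.sum_comm]
  refine Finset.sum_congr rfl fun i _ => ?_
  rw [← Finset.smul_sum]
  congr 1
  have hs := sum_repr_smul α.curryLeft.toLinearMap (v i)
  change _ = (α.curryLeft.toLinearMap (v i)) (i.removeNth v)
  rw [← hs, ContinuousAlternatingMap.sum_apply]
  refine Finset.sum_congr rfl fun a _ => ?_
  simp [coord_apply]

theorem alt_succ_eq {k : ℕ} (α : Alt E (k + 1)) :
    α = ((k : ℂ) + 1)⁻¹ • ∑ a, oneWedge (coord a) (α.curryLeft (realBasis E a)) := by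
  rw [sum_oneWedge_curryLeft, smul_smul, inv_mul_cancel₀ (by exact_mod_cast Nat.succ_ne_zero k),
    one_smul]

/-- Induction on the degree of alternating forms. -/
theorem alt_induction {motive : ∀ k : ℕ, Alt E k → Prop}
    (zero : ∀ α, motive 0 α)
    (add : ∀ k α β, motive k α → motive k β → motive k (α + β))
    (smul : ∀ k (c : ℂ) α, motive k α → motive k (c • α))
    (wedge : ∀ k (ξ : E →L[ℝ] ℂ) α, motive k α → motive (k + 1) (oneWedge ξ α)) :
    ∀ k α, motive k α := by
  intro k
  induction k with
  | zero => exact zero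
  | succ k ih =>
    intro α
    rw [alt_succ_eq α]
    refine smul _ _ _ ?_
    have hz : motive (k + 1) 0 := by
      have := smul _ 0 _ (wedge k 0 0 (ih 0))
      rwa [alt_zero_smul] at this
    refine Finset.sum_induction _ (motive (k + 1)) (add _) hz fun a _ => wedge _ _ _ (ih _)

theorem sum_eps_mul_ins :
    ∑ a, eps (coord a) * ins (realBasis E a) = (degOp : Op E) := by
  refine Op.ext fun α => ?_
  funext k
  rw [Op.sum_apply, Finset.sum_apply]
  cases k with
  | zero =>
    rw [degOp_apply]
    simp only [Op.mul_apply, eps_apply_zero, Finset.sum_const_zero, Nat.cast_zero]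
    exact (alt_zero_smul _).symm
  | succ k =>
    rw [degOp_apply]
    push_cast
    exact sum_oneWedge_curryLeft (α (k + 1))

theorem wd_succ {p : ℕ} (ρ : Alt E (p + 1)) :
    wd (p + 1) ρ = ((p : ℂ) + 1)⁻¹ • ∑ a, eps (coord a) * wd p (ρ.curryLeft (realBasis E a)) := by
  conv_lhs => rw [alt_succ_eq ρ]
  rw [map_smul, map_sum]
  simp only [wd_oneWedge]

theorem wd_two (h : Alt E 2) :
    wd 2 h = (2 : ℂ)⁻¹ • ∑ a, eps (coord a) * eps (slot (h.curryLeft (realBasis E a))) := by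
  rw [wd_succ]
  simp only [wd_one]
  norm_num

theorem wd_two_slotL (h : Alt E 2) :
    wd 2 h = (2 : ℂ)⁻¹ • ∑ a, eps (coord a) * eps (slotL h (realBasis E a)) :=
  wd_two h

theorem sum_coord_slotL (h : Alt E 2) (v : E) :
    ∑ a, slotL h (realBasis E a) v • coord a = -slotL h v := by
  rw [← sum_coord_smul (-slotL h v)]
  refine Finset.sum_congr rfl fun a _ => ?_
  congr 1
  rw [slotL_apply, neg_apply, slotL_apply, alt_two_swap]

theorem sum_coord_smul_slotL (h : Alt E 2) (v : E) :
    ∑ a, coord a v • slotL h (realBasis E a) = slotL h v := by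
  rw [← sum_repr_smul (slotL h) v]
  refine Finset.sum_congr rfl fun a _ => ?_
  rw [coord_apply]
  ext w
  simp

/-- In ½ ∑ dx_a ∧ h(e_a, ·) the contraction meets each of the two factors; by skew-symmetry of `h`
both contributions are equal, which absorbs the ½. -/
theorem ins_mul_wd_two (v : E) (h : Alt E 2) :
    ins v * wd 2 h = wd 2 h * ins v + eps (slotL h v) := by
  rw [wd_two_slotL]
  simp only [mul_smul_comm, Finset.mul_sum, smul_mul_assoc, Finset.sum_mul]
  have : ∀ a, ins v * (eps (coord a) * eps (slotL h (realBasis E a))) =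
      coord a v • eps (slotL h (realBasis E a)) - slotL h (realBasis E a) v • eps (coord a) +
      eps (coord a) * eps (slotL h (realBasis E a)) * (ins v : Op E) := by
    intro a
    rw [← mul_assoc, ins_mul_eps, sub_mul, smul_mul_assoc, one_mul, mul_assoc, ins_mul_eps, mul_sub,
      mul_smul_comm, mul_one, mul_assoc]
    abel
  have h1 : ∑ a, coord a v • eps (slotL h (realBasis E a)) = (eps (slotL h v) : Op E) := by
    rw [← sum_coord_smul_slotL h v, map_sum]
    simp only [map_smul]
  have h2 : ∑ a, slotL h (realBasis E a) v • eps (coord a) = -(eps (slotL h v) : Op E) := by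
    rw [← map_neg, ← sum_coord_slotL h v, map_sum]
    simp only [map_smul]
  simp only [this, Finset.sum_add_distrib, Finset.sum_sub_distrib, h1, h2]
  rw [sub_neg_eq_add, ← two_smul ℂ, smul_add, smul_smul, inv_mul_cancel₀ two_ne_zero, one_smul,
    add_comm, Finset.smul_sum]

theorem wd_two_mul_eps (h : Alt E 2) (ξ : E →L[ℝ] ℂ) :
    wd 2 h * eps ξ = eps ξ * wd 2 h := by
  rw [wd_two_slotL]
  simp only [mul_smul_comm, Finset.mul_sum, smul_mul_assoc, Finset.sum_mul]
  congr 1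
  refine Finset.sum_congr rfl fun a _ => ?_
  rw [mul_assoc, eps_mul_eps _ ξ, mul_neg, ← mul_assoc, eps_mul_eps _ ξ, neg_mul, neg_neg,
    mul_assoc]

end Fiber

/-! ### Hermitian metrics on the tangent space: dual frames and the inner product of forms -/

section Metric

variable {E : Type*} [NormedAddCommGroup E] [NormedSpace ℂ E]

/-- A real form of bidegree `(1, 1)`. -/
structure IsRealOneOne (h : Alt E 2) : Prop where
  real : ∀ v, (h v).im = 0
  invariant : ∀ v w : E, h ![Complex.I • v, Complex.I • w] = h ![v, w]

/-- A positive definite real form of bidegree `(1, 1)`. -/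
structure IsHerm (w : Alt E 2) : Prop extends IsRealOneOne w where
  pos : ∀ v : E, v ≠ 0 → 0 < (w ![v, Complex.I • v]).re

/-- The symmetric bilinear form `h (v, i w)` attached to a `2`-form `h`. -/
def metr (h : Alt E 2) : E →ₗ[ℝ] E →ₗ[ℝ] ℝ :=
  LinearMap.mk₂ ℝ (fun v u => (slotL h v (Complex.I • u)).re)
    (fun v v' u => by simp) (fun c v u => by simp)
    (fun v u u' => by simp) (fun c v u => by simp [smul_comm Complex.I c])

theorem metr_apply (h : Alt E 2) (v u : E) : metr h v u = (h ![v, Complex.I • u]).re := by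
  simp [metr, slotL_apply]

namespace IsRealOneOne

variable {h : Alt E 2} (hh : IsRealOneOne h)
include hh

theorem conj_apply (v : Fin 2 → E) : conj (h v) = h v := Complex.conj_eq_iff_im.mpr (hh.real v)

theorem ofReal_metr (v u : E) : (metr h v u : ℂ) = h ![v, Complex.I • u] := by
  rw [metr_apply]
  exact Complex.conj_eq_iff_re.mp (hh.conj_apply _)

theorem apply_I_left (v u : E) : h ![Complex.I • v, u] = -h ![v, Complex.I • u] := by
  rw [← hh.invariant (Complex.I • v) u, smul_smul, Complex.I_mul_I, neg_one_smul]
  have := slotL_apply h (-v) (Complex.I • u)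
  rw [← this, map_neg, neg_apply, slotL_apply]

theorem metr_symm (v u : E) : metr h v u = metr h u v := by
  rw [metr_apply, metr_apply, alt_two_swap, hh.apply_I_left, neg_neg]

theorem metr_I_left (v u : E) : metr h (Complex.I • v) u = -metr h v (Complex.I • u) := by
  rw [metr_apply, metr_apply, hh.apply_I_left, Complex.neg_re]

end IsRealOneOne

theorem curryLeft_add_vec {k : ℕ} (α : Alt E (k + 1)) (v u : E) :
    α.curryLeft (v + u) = α.curryLeft v + α.curryLeft u := map_add α.curryLeft v u

theorem curryLeft_smul_vec {k : ℕ} (α : Alt E (k + 1)) (c : ℝ) (v : E) :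
    α.curryLeft (c • v) = (c : ℂ) • α.curryLeft v := by
  ext u
  simp

variable [FiniteDimensional ℂ E]

theorem gram_apply (w : Alt E 2) (a b : Fin (Module.finrank ℝ E)) :
    gram w a b = metr w (realBasis E a) (realBasis E b) := by
  rw [metr_apply]; rfl

/-- The frame of `E` dual to the basis `realBasis E` with respect to the metric. -/
def fr (w : Alt E 2) (a : Fin (Module.finrank ℝ E)) : E := ∑ b, (gram w)⁻¹ a b • realBasis E b

namespace IsHerm

variable {w : Alt E 2} (hw : IsHerm w)
include hw

theorem gram_isSymm (a b : Fin (Module.finrank ℝ E)) : gram w a b = gram w b a := by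
  rw [gram_apply, gram_apply, hw.metr_symm]

theorem gram_posDef : (gram w).PosDef := by
  refine Matrix.PosDef.of_dotProduct_mulVec_pos ?_ ?_
  · ext a b
    simp [Matrix.conjTranspose_apply, hw.gram_isSymm a b]
  · intro x hx
    have hv : ∑ a, x a • realBasis E a ≠ 0 := by
      intro h
      apply hx
      funext a
      exact Fintype.linearIndependent_iff.mp (realBasis E).linearIndependent x h a
    have := hw.pos _ hv
    rw [← metr_apply] at this
    refine this.trans_eq ?_
    simp only [map_sum, map_smul, LinearMap.sum_apply, LinearMap.smul_apply, smul_eq_mul,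
      dotProduct, Matrix.mulVec, gram_apply, Finset.mul_sum, Pi.star_apply, star_trivial]
    refine Finset.sum_congr rfl fun a _ => Finset.sum_congr rfl fun b _ => ?_
    rw [hw.metr_symm]
    ring

theorem isUnit_det : IsUnit (gram w).det := (hw.gram_posDef.det_pos).ne'.isUnit

theorem gram_inv_symm (a b : Fin (Module.finrank ℝ E)) : (gram w)⁻¹ a b = (gram w)⁻¹ b a := by
  have := hw.gram_posDef.inv.1
  have h := congrFun (congrFun this a) b
  simpa [Matrix.conjTranspose_apply] using h.symm

theorem metr_fr (a : Fin (Module.finrank ℝ E)) (v : E) :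
    metr w (fr w a) v = (realBasis E).repr v a := by
  have : metr w (fr w a) = (realBasis E).coord a := by
    refine (realBasis E).ext fun b => ?_
    have h := congrFun (congrFun (Matrix.nonsing_inv_mul _ hw.isUnit_det) a) b
    rw [Matrix.mul_apply] at h
    simp only [fr, map_sum, map_smul, LinearMap.sum_apply, LinearMap.smul_apply, ← gram_apply,
      smul_eq_mul, h, Module.Basis.coord_apply, Module.Basis.repr_self]
    simp [Matrix.one_apply, Finsupp.single_apply, eq_comm]
  rw [this, Module.Basis.coord_apply]

theorem coord_eq (a : Fin (Module.finrank ℝ E)) (v : E) :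
    coord a v = w ![fr w a, Complex.I • v] := by
  rw [coord_apply, ← hw.metr_fr, hw.ofReal_metr]

theorem sum_metr_fr (v : E) : ∑ a, metr w (fr w a) v • realBasis E a = v := by
  simp only [hw.metr_fr]
  exact (realBasis E).sum_repr v

theorem sum_bilin_swap {M : Type*} [AddCommGroup M] [Module ℝ M] (B : E →ₗ[ℝ] E →ₗ[ℝ] M) :
    ∑ a, B (realBasis E a) (fr w a) = ∑ a, B (fr w a) (realBasis E a) := by
  simp only [fr, map_sum, map_smul, LinearMap.sum_apply, LinearMap.smul_apply]
  rw [Finset.sum_comm]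
  refine Finset.sum_congr rfl fun a _ => Finset.sum_congr rfl fun b _ => ?_
  rw [hw.gram_inv_symm]

theorem sum_metr_basis (v : E) : ∑ a, metr w (realBasis E a) v • fr w a = v := by
  have h := hw.sum_bilin_swap
    ((LinearMap.lsmul ℝ E).comp ((metr w).flip v))
  simp only [LinearMap.comp_apply, LinearMap.flip_apply, LinearMap.lsmul_apply] at h
  rw [h, hw.sum_metr_fr]

/-- The tensor ∑ e_a ⊗ f_a of a dual pair of frames is the inverse metric, hence does not depend on
the pair. -/
theorem sum_bilin_eq_of_dual {M : Type*} [AddCommGroup M] [Module ℝ M]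
    (B : E →ₗ[ℝ] E →ₗ[ℝ] M) {ι : Type*} [Fintype ι] (e f : ι → E)
    (hef : ∀ v, ∑ a, metr w (f a) v • e a = v) :
    ∑ a, B (realBasis E a) (fr w a) = ∑ a, B (e a) (f a) := by
  have h1 : ∀ b, B (realBasis E b) (fr w b) =
      ∑ a, metr w (f a) (realBasis E b) • B (e a) (fr w b) := by
    intro b
    conv_lhs => rw [← hef (realBasis E b)]
    simp [map_sum, LinearMap.sum_apply]
  simp only [h1]
  rw [Finset.sum_comm]
  refine Finset.sum_congr rfl fun a _ => ?_
  conv_rhs => rw [← hw.sum_metr_basis (f a)]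
  simp only [map_sum, map_smul]
  refine Finset.sum_congr rfl fun b _ => ?_
  rw [hw.metr_symm]

/-- The complex structure is an isometry, so (i e_a, i f_a) is again a dual pair. Hence a factor i
passes from one side of the inverse metric to the other with a change of sign. -/
theorem sum_bilin_I {M : Type*} [AddCommGroup M] [Module ℝ M] (B : E →ₗ[ℝ] E →ₗ[ℝ] M) :
    ∑ a, B (Complex.I • realBasis E a) (fr w a) =
      -∑ a, B (realBasis E a) (Complex.I • fr w a) := by
  let J : E →ₗ[ℝ] E := (LinearMap.lsmul ℂ E Complex.I).restrictScalars ℝ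
  have hJ : ∀ v, J v = Complex.I • v := fun v => rfl
  have h := hw.sum_bilin_eq_of_dual (B.compl₂ J)
    (fun a => Complex.I • realBasis E a) (fun a => Complex.I • fr w a) ?_
  · simp only [LinearMap.compl₂_apply, hJ] at h
    rw [h, ← Finset.sum_neg_distrib]
    refine Finset.sum_congr rfl fun a _ => ?_
    rw [smul_smul, Complex.I_mul_I, neg_one_smul, map_neg, neg_neg]
  · intro v
    have h2 := congrArg J (hw.sum_metr_fr (-(Complex.I • v)))
    rw [map_sum] at h2
    simp only [hJ, smul_neg, smul_smul, Complex.I_mul_I, neg_one_smul, neg_neg] at h2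
    refine Eq.trans (Finset.sum_congr rfl fun a _ => ?_) h2
    rw [hw.metr_I_left, map_neg, smul_comm Complex.I]

end IsHerm

/-! ### The inner product -/

theorem altInner_zero_degree (w : Alt E 2) (α β : Alt E 0) :
    altInner w α β = α 0 * conj (β 0) := by
  simp only [altInner, Nat.factorial_zero, Nat.cast_one, inv_one, one_mul, Finset.univ_unique,
    Finset.sum_singleton, Finset.univ_eq_empty, Finset.prod_empty, Complex.ofReal_one]
  congr 2
  · exact Subsingleton.elim _ _
  · congr 2; exact Subsingleton.elim _ _

theorem altInner_add_left (w : Alt E 2) {k : ℕ} (α α' β : Alt E k) :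
    altInner w (α + α') β = altInner w α β + altInner w α' β := by
  simp only [altInner, ContinuousAlternatingMap.add_apply, mul_add, add_mul,
    Finset.sum_add_distrib]

theorem altInner_add_right (w : Alt E 2) {k : ℕ} (α β β' : Alt E k) :
    altInner w α (β + β') = altInner w α β + altInner w α β' := by
  simp only [altInner, ContinuousAlternatingMap.add_apply, mul_add, map_add,
    Finset.sum_add_distrib]

theorem altInner_smul_left (w : Alt E 2) {k : ℕ} (c : ℂ) (α β : Alt E k) :
    altInner w (c • α) β = c * altInner w α β := by
  simp only [altInner, ContinuousAlternatingMap.smul_apply, smul_eq_mul, Finset.mul_sum]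
  refine Finset.sum_congr rfl fun I _ => Finset.sum_congr rfl fun J _ => by ring

theorem altInner_smul_right (w : Alt E 2) {k : ℕ} (c : ℂ) (α β : Alt E k) :
    altInner w α (c • β) = conj c * altInner w α β := by
  simp only [altInner, ContinuousAlternatingMap.smul_apply, smul_eq_mul, Finset.mul_sum, map_mul]
  refine Finset.sum_congr rfl fun I _ => Finset.sum_congr rfl fun J _ => by ring

/-- The inner product, as a sesquilinear map. -/
def altInnerL (w : Alt E 2) (k : ℕ) : Alt E k →ₗ[ℂ] Alt E k →ₗ⋆[ℂ] ℂ :=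
  LinearMap.mk₂'ₛₗ (RingHom.id ℂ) (starRingEnd ℂ) (altInner w) (altInner_add_left w)
    (altInner_smul_left w) (altInner_add_right w) (altInner_smul_right w)

theorem altInnerL_apply (w : Alt E 2) {k : ℕ} (α β : Alt E k) :
    altInnerL w k α β = altInner w α β := rfl

theorem sum_fin_succ_fun {ι : Type*} [Fintype ι] {M : Type*} [AddCommMonoid M] {k : ℕ}
    (f : (Fin (k + 1) → ι) → M) :
    ∑ I, f I = ∑ a : ι, ∑ I : Fin k → ι, f (Fin.cons a I) := by
  rw [← (Fin.consEquiv fun _ : Fin (k + 1) => ι).sum_comp, Fintype.sum_prod_type]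
  rfl

/-- Splitting off the first index of both multi-indices gives a recursion on the degree, from which
positivity, adjoints, variation and naturality of the inner product are proved. -/
theorem altInner_succ_gram (w : Alt E 2) {k : ℕ} (α β : Alt E (k + 1)) :
    altInner w α β = ((k : ℂ) + 1)⁻¹ * ∑ a, ∑ b, ((gram w)⁻¹ a b : ℂ) *
      altInner w (α.curryLeft (realBasis E a)) (β.curryLeft (realBasis E b)) := by
  have hc : ∀ (γ : Alt E (k + 1)) (a) (I : Fin k → _),
      γ (fun l => realBasis E ((Fin.cons a I : Fin (k + 1) → Fin (Module.finrank ℝ E)) l)) =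
      (γ.curryLeft (realBasis E a)) (fun l => realBasis E (I l)) := by
    intro γ a I
    rw [ContinuousAlternatingMap.curryLeft_apply_apply]
    congr 1
    funext l
    refine Fin.cases ?_ (fun l => ?_) l <;> simp
  simp only [altInner, sum_fin_succ_fun, hc, Fin.prod_univ_succ, Fin.cons_zero, Fin.cons_succ]
  rw [Nat.factorial_succ]
  push_cast
  rw [mul_inv, mul_assoc]
  congr 1
  rw [Finset.mul_sum]
  refine Finset.sum_congr rfl fun a _ => ?_
  rw [Finset.sum_comm, Finset.mul_sum]
  refine Finset.sum_congr rfl fun b _ => ?_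
  simp only [Finset.mul_sum]
  refine Finset.sum_congr rfl fun I _ => Finset.sum_congr rfl fun J _ => ?_
  ring

/-- The sesquilinear pairing of the contractions, as a real bilinear map. -/
def pairCurry (w : Alt E 2) {k : ℕ} (α β : Alt E (k + 1)) : E →ₗ[ℝ] E →ₗ[ℝ] ℂ :=
  LinearMap.mk₂ ℝ (fun v u => altInner w (α.curryLeft v) (β.curryLeft u))
    (fun v v' u => by rw [curryLeft_add_vec, altInner_add_left])
    (fun c v u => by rw [curryLeft_smul_vec, altInner_smul_left, Complex.real_smul])
    (fun v u u' => by rw [curryLeft_add_vec, altInner_add_right])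
    (fun c v u => by rw [curryLeft_smul_vec, altInner_smul_right, Complex.real_smul,
      Complex.conj_ofReal])

theorem pairCurry_apply (w : Alt E 2) {k : ℕ} (α β : Alt E (k + 1)) (v u : E) :
    pairCurry w α β v u = altInner w (α.curryLeft v) (β.curryLeft u) := rfl

theorem altInner_succ (w : Alt E 2) {k : ℕ} (α β : Alt E (k + 1)) :
    altInner w α β = ((k : ℂ) + 1)⁻¹ * ∑ a,
      altInner w (α.curryLeft (realBasis E a)) (β.curryLeft (fr w a)) := by
  rw [altInner_succ_gram]
  congr 1
  refine Finset.sum_congr rfl fun a _ => ?_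
  rw [← pairCurry_apply, fr]
  simp [map_sum, pairCurry_apply]

namespace IsHerm

variable {w : Alt E 2} (hw : IsHerm w)
include hw

theorem altInner_conj : ∀ {k : ℕ} (α β : Alt E k), conj (altInner w α β) = altInner w β α := by
  intro k
  induction k with
  | zero =>
    intro α β
    rw [altInner_zero_degree, altInner_zero_degree, map_mul, Complex.conj_conj, mul_comm]
  | succ k ih =>
    intro α β
    rw [altInner_succ, altInner_succ, map_mul, map_sum, map_inv₀, map_add, map_one,
      Complex.conj_natCast]
    simp only [ih]
    have := hw.sum_bilin_swap (pairCurry w β α)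
    simp only [pairCurry_apply] at this
    rw [this]

/-- Factoring the inverse Gram matrix as CᵀC writes the inverse metric as ∑ o_c ⊗ o_c. The recursion
for ⟨α, α⟩ then becomes a sum of squares, and the span condition gives definiteness. -/
theorem exists_orthonormal : ∃ o : Fin (Module.finrank ℝ E) → E,
    (∀ b, fr w b ∈ Submodule.span ℝ (Set.range o)) ∧
    ∀ {M : Type} [AddCommGroup M] [Module ℝ M] (B : E →ₗ[ℝ] E →ₗ[ℝ] M),
      ∑ a, B (realBasis E a) (fr w a) = ∑ c, B (o c) (o c) := by
  obtain ⟨C, hC⟩ : ∃ C : Matrix (Fin (Module.finrank ℝ E)) (Fin (Module.finrank ℝ E)) ℝ,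
      (gram w)⁻¹ = C.conjTranspose * C := by
    open MatrixOrder in
    exact CStarAlgebra.nonneg_iff_eq_star_mul_self.mp hw.gram_posDef.inv.posSemidef.nonneg
  have hC' : ∀ a b, (gram w)⁻¹ a b = ∑ c, C c a * C c b := by
    intro a b
    rw [hC, Matrix.mul_apply]
    simp
  have hfr : ∀ b, fr w b = ∑ c, C c b • ∑ a, C c a • realBasis E a := by
    intro b
    simp only [fr, hC', Finset.smul_sum, Finset.sum_smul, smul_smul]
    rw [Finset.sum_comm]
  refine ⟨fun c => ∑ a, C c a • realBasis E a, ?_, ?_⟩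
  · intro b
    rw [hfr]
    exact Submodule.sum_mem _ fun c _ => Submodule.smul_mem _ _ (Submodule.subset_span ⟨c, rfl⟩)
  · intro M _ _ B
    simp only [hfr, map_sum, map_smul]
    rw [Finset.sum_comm]
    refine Finset.sum_congr rfl fun c _ => ?_
    simp only [LinearMap.sum_apply, LinearMap.smul_apply, Finset.smul_sum]
    rw [Finset.sum_comm]
    refine Finset.sum_congr rfl fun a _ => Finset.sum_congr rfl fun b _ => ?_
    rw [smul_comm]

theorem altInner_self_nonneg : ∀ {k : ℕ} (α : Alt E k), 0 ≤ (altInner w α α).re := by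
  obtain ⟨o, -, ho⟩ := hw.exists_orthonormal
  intro k
  induction k with
  | zero =>
    intro α
    rw [altInner_zero_degree, Complex.mul_conj, Complex.ofReal_re]
    exact Complex.normSq_nonneg _
  | succ k ih =>
    intro α
    have h := ho (pairCurry w α α)
    simp only [pairCurry_apply] at h
    have hk : ((k : ℂ) + 1)⁻¹ = (((k : ℝ) + 1)⁻¹ : ℝ) := by push_cast; rfl
    rw [altInner_succ, h, hk, Complex.re_ofReal_mul, Complex.re_sum]
    exact mul_nonneg (by positivity) (Finset.sum_nonneg fun c _ => ih _)

theorem eq_zero_of_altInner_self : ∀ {k : ℕ} (α : Alt E k), altInner w α α = 0 → α = 0 := by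
  obtain ⟨o, ho1, ho⟩ := hw.exists_orthonormal
  intro k
  induction k with
  | zero =>
    intro α h
    rw [altInner_zero_degree, Complex.mul_conj, Complex.ofReal_eq_zero,
      Complex.normSq_eq_zero] at h
    ext v
    rw [Subsingleton.elim v 0, h]; rfl
  | succ k ih =>
    intro α h0
    have h := ho (pairCurry w α α)
    simp only [pairCurry_apply] at h
    have hk : ((k : ℂ) + 1)⁻¹ ≠ 0 := inv_ne_zero (by exact_mod_cast Nat.succ_ne_zero k)
    rw [altInner_succ, h, mul_eq_zero, or_iff_right hk] at h0
    have h1 := congrArg Complex.re h0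
    rw [Complex.re_sum, Complex.zero_re,
      Finset.sum_eq_zero_iff_of_nonneg fun c _ => hw.altInner_self_nonneg _] at h1
    have h2 : ∀ c, α.curryLeft (o c) = 0 := by
      intro c
      refine ih _ (Complex.ext (h1 c (Finset.mem_univ _)) ?_)
      exact Complex.conj_eq_iff_im.mp (hw.altInner_conj _ _)
    have h3 : Submodule.span ℝ (Set.range o) ≤ LinearMap.ker α.curryLeft.toLinearMap := by
      rw [Submodule.span_le]
      rintro _ ⟨c, rfl⟩
      exact h2 c
    refine fib_succ_ext fun v => ?_
    have h4 : v ∈ LinearMap.ker α.curryLeft.toLinearMap := by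
      rw [← hw.sum_metr_basis v]
      exact Submodule.sum_mem _ fun a _ => Submodule.smul_mem _ _ (h3 (ho1 a))
    exact (LinearMap.mem_ker.mp h4).trans rfl

end IsHerm

/-- More vectors than the real dimension are linearly dependent. Hence the truncation of `ip` at
that dimension loses no component. -/
theorem subsingleton_alt {k : ℕ} (hk : Module.finrank ℝ E < k) (α : Alt E k) : α = 0 := by
  ext v
  refine α.toAlternatingMap.map_linearDependent v fun h => ?_
  have := h.fintype_card_le_finrank
  rw [Fintype.card_fin] at this
  omega

/-- The inner product on the forms of all degrees. -/
def ip (w : Alt E 2) (α β : Fib E) : ℂ :=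
  ∑ k ∈ Finset.range (Module.finrank ℝ E + 1), altInner w (α k) (β k)

theorem ip_add_left (w : Alt E 2) (α α' β : Fib E) :
    ip w (α + α') β = ip w α β + ip w α' β := by
  simp only [ip, Pi.add_apply, altInner_add_left, Finset.sum_add_distrib]

theorem ip_add_right (w : Alt E 2) (α β β' : Fib E) :
    ip w α (β + β') = ip w α β + ip w α β' := by
  simp only [ip, Pi.add_apply, altInner_add_right, Finset.sum_add_distrib]

theorem ip_smul_left (w : Alt E 2) (c : ℂ) (α β : Fib E) :
    ip w (c • α) β = c * ip w α β := by
  simp only [ip, Pi.smul_apply, altInner_smul_left, Finset.mul_sum]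

theorem ip_smul_right (w : Alt E 2) (c : ℂ) (α β : Fib E) :
    ip w α (c • β) = conj c * ip w α β := by
  simp only [ip, Pi.smul_apply, altInner_smul_right, Finset.mul_sum]

/-- The inner product, as a sesquilinear map. -/
def ipL (w : Alt E 2) : Fib E →ₗ[ℂ] Fib E →ₗ⋆[ℂ] ℂ :=
  LinearMap.mk₂'ₛₗ (RingHom.id ℂ) (starRingEnd ℂ) (ip w) (ip_add_left w)
    (ip_smul_left w) (ip_add_right w) (ip_smul_right w)

theorem ipL_apply (w : Alt E 2) (α β : Fib E) : ipL w α β = ip w α β := rfl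

theorem ip_sub_left (w : Alt E 2) (α α' β : Fib E) :
    ip w (α - α') β = ip w α β - ip w α' β := by
  simp only [← ipL_apply, map_sub, LinearMap.sub_apply]

theorem ip_sub_right (w : Alt E 2) (α β β' : Fib E) :
    ip w α (β - β') = ip w α β - ip w α β' := by
  simp only [← ipL_apply, map_sub]

theorem ip_neg_right (w : Alt E 2) (α β : Fib E) : ip w α (-β) = -ip w α β := by
  simp only [← ipL_apply, map_neg]

theorem ip_zero_left (w : Alt E 2) (β : Fib E) : ip w 0 β = 0 := by
  simp only [← ipL_apply, map_zero, LinearMap.zero_apply]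

theorem ip_zero_right (w : Alt E 2) (β : Fib E) : ip w β 0 = 0 := by
  simp only [← ipL_apply, map_zero]

theorem ip_sum_left (w : Alt E 2) {ι : Type*} (s : Finset ι) (α : ι → Fib E) (β : Fib E) :
    ip w (∑ i ∈ s, α i) β = ∑ i ∈ s, ip w (α i) β := by
  simp only [← ipL_apply, map_sum, LinearMap.sum_apply]

theorem ip_sum_right (w : Alt E 2) {ι : Type*} (s : Finset ι) (α : Fib E) (β : ι → Fib E) :
    ip w α (∑ i ∈ s, β i) = ∑ i ∈ s, ip w α (β i) := by
  simp only [← ipL_apply, map_sum]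

theorem IsHerm.ip_conj {w : Alt E 2} (hw : IsHerm w) (α β : Fib E) :
    conj (ip w α β) = ip w β α := by
  simp only [ip, map_sum, hw.altInner_conj]

theorem IsHerm.ip_self_nonneg {w : Alt E 2} (hw : IsHerm w) (α : Fib E) :
    0 ≤ (ip w α α).re := by
  rw [ip, Complex.re_sum]
  exact Finset.sum_nonneg fun k _ => hw.altInner_self_nonneg _

theorem IsHerm.eq_zero_of_ip_self {w : Alt E 2} (hw : IsHerm w) {α : Fib E}
    (h : ip w α α = 0) : α = 0 := by
  have h1 := congrArg Complex.re h
  rw [ip, Complex.re_sum, Complex.zero_re,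
    Finset.sum_eq_zero_iff_of_nonneg fun c _ => hw.altInner_self_nonneg _] at h1
  funext k
  by_cases hk : k < Module.finrank ℝ E + 1
  · refine hw.eq_zero_of_altInner_self _ (Complex.ext (h1 k (Finset.mem_range.mpr hk)) ?_)
    exact Complex.conj_eq_iff_im.mp (hw.altInner_conj _ _)
  · exact subsingleton_alt (by omega) _

theorem IsHerm.eq_of_ip {w : Alt E 2} (hw : IsHerm w) {α β : Fib E}
    (h : ∀ γ, ip w γ α = ip w γ β) : α = β := by
  rw [← sub_eq_zero]
  refine hw.eq_zero_of_ip_self ?_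
  rw [ip_sub_right, h, sub_self]

end Metric

/-! ### The operator Λ, the adjoints of exterior products, and the bidegree operators P and Q -/

section Operators

variable {E : Type*} [NormedAddCommGroup E] [NormedSpace ℂ E]

/-- The complex conjugate of a `1`-form. -/
def conjOne (ξ : E →L[ℝ] ℂ) : E →L[ℝ] ℂ := (Complex.conjCLE : ℂ →L[ℝ] ℂ).comp ξ

theorem conjOne_apply (ξ : E →L[ℝ] ℂ) (v : E) : conjOne ξ v = conj (ξ v) := rfl

/-- The composition of a `1`-form with the complex structure. -/
def compI (ξ : E →L[ℝ] ℂ) : E →L[ℝ] ℂ := ξ.comp (mulCLM E Complex.I)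

theorem compI_apply (ξ : E →L[ℝ] ℂ) (v : E) : compI ξ v = ξ (Complex.I • v) := rfl

/-- The component of bidegree `(1, 0)` of a `1`-form. -/
def holOne (ξ : E →L[ℝ] ℂ) : E →L[ℝ] ℂ := (2 : ℂ)⁻¹ • (ξ - Complex.I • compI ξ)

/-- The component of bidegree `(0, 1)` of a `1`-form. -/
def antiOne (ξ : E →L[ℝ] ℂ) : E →L[ℝ] ℂ := (2 : ℂ)⁻¹ • (ξ + Complex.I • compI ξ)

theorem holOne_apply (ξ : E →L[ℝ] ℂ) (v : E) :
    holOne ξ v = (2 : ℂ)⁻¹ * (ξ v - Complex.I * ξ (Complex.I • v)) := rfl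

theorem antiOne_apply (ξ : E →L[ℝ] ℂ) (v : E) :
    antiOne ξ v = (2 : ℂ)⁻¹ * (ξ v + Complex.I * ξ (Complex.I • v)) := rfl

theorem holOne_add_antiOne (ξ : E →L[ℝ] ℂ) : holOne ξ + antiOne ξ = ξ := by
  ext v
  rw [add_apply, holOne_apply, antiOne_apply]
  ring

theorem antiOne_smul_add (s : ℂ) (ξ : E →L[ℝ] ℂ) :
    antiOne (s • holOne ξ + antiOne ξ) = antiOne ξ := by
  ext v
  simp only [holOne_apply, antiOne_apply, add_apply, smul_apply, smul_eq_mul, smul_smul,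
    Complex.I_mul_I, neg_one_smul, map_neg]
  linear_combination (4⁻¹ * s * ξ v - 4⁻¹ * ξ v) * Complex.I_mul_I

/-- The real bilinear map `(v, u) ↦ ξ v • ins u`. -/
def oneIns (ξ : E →L[ℝ] ℂ) : E →ₗ[ℝ] E →ₗ[ℝ] Op E :=
  LinearMap.mk₂ ℝ (fun v u => ξ v • ins u)
    (fun v v' u => by rw [map_add, add_smul]) (fun c v u => by rw [map_smul, smul_assoc])
    (fun v u u' => by rw [map_add, smul_add]) (fun c v u => by rw [map_smul, smul_comm])

theorem oneIns_apply (ξ : E →L[ℝ] ℂ) (v u : E) : oneIns ξ v u = (ξ v • ins u : Op E) := rfl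

/-- The real bilinear map `(v, u) ↦ eps (h v) * ins u`. -/
def slotIns (h : Alt E 2) : E →ₗ[ℝ] E →ₗ[ℝ] Op E :=
  (LinearMap.mul ℝ (Op E)).compl₁₂ ((eps.restrictScalars ℝ).comp (slotL h)) ins

theorem slotIns_apply (h : Alt E 2) (v u : E) :
    slotIns h v u = (eps (slotL h v) * ins u : Op E) := rfl

variable [FiniteDimensional ℂ E]

/-- The operator `Λ`, the contraction by the metric. -/
def lam (w : Alt E 2) : Op E :=
  (2 : ℂ)⁻¹ • ∑ a, ins (Complex.I • realBasis E a) * ins (fr w a)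

/-- The adjoint of the exterior product by a `1`-form. -/
def sh (w : Alt E 2) (ζ : E →L[ℝ] ℂ) : Op E := ∑ a, conj (ζ (realBasis E a)) • ins (fr w a)

theorem sh_add (w : Alt E 2) (ζ ζ' : E →L[ℝ] ℂ) : sh w (ζ + ζ') = sh w ζ + sh w ζ' := by
  simp [sh, add_smul, Finset.sum_add_distrib]

theorem sh_smul (w : Alt E 2) (c : ℂ) (ζ : E →L[ℝ] ℂ) : sh w (c • ζ) = conj c • sh w ζ := by
  simp [sh, mul_smul, Finset.smul_sum]

/-- The operator that multiplies the forms of bidegree `(p, q)` by `p`. -/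
def holDeg : Op E := ∑ a, eps (holOne (coord a)) * ins (realBasis E a)

/-- The operator that multiplies the forms of bidegree `(p, q)` by `q`. -/
def antiDeg : Op E := ∑ a, eps (antiOne (coord a)) * ins (realBasis E a)

theorem holDeg_add_antiDeg : (holDeg + antiDeg : Op E) = degOp := by
  rw [holDeg, antiDeg, ← Finset.sum_add_distrib, ← sum_eps_mul_ins]
  refine Finset.sum_congr rfl fun a _ => ?_
  rw [← add_mul, ← map_add, holOne_add_antiOne]

theorem sum_coord_holOne (ξ : E →L[ℝ] ℂ) : ∑ a, ξ (realBasis E a) • holOne (coord a) = holOne ξ := by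
  conv_rhs => rw [← sum_coord_smul ξ]
  ext v
  simp only [sum_apply, smul_apply, holOne_apply, smul_eq_mul]
  rw [Finset.mul_sum, ← Finset.sum_sub_distrib, Finset.mul_sum]
  refine Finset.sum_congr rfl fun a _ => by ring

theorem sum_coord_antiOne (ξ : E →L[ℝ] ℂ) :
    ∑ a, ξ (realBasis E a) • antiOne (coord a) = antiOne ξ := by
  conv_rhs => rw [← sum_coord_smul ξ]
  ext v
  simp only [sum_apply, smul_apply, antiOne_apply, smul_eq_mul]
  rw [Finset.mul_sum, ← Finset.sum_add_distrib, Finset.mul_sum]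
  refine Finset.sum_congr rfl fun a _ => by ring

theorem sum_eps_ins_mul_eps (φ : Fin (Module.finrank ℝ E) → E →L[ℝ] ℂ) (ξ : E →L[ℝ] ℂ) :
    (∑ a, eps (φ a) * ins (realBasis E a)) * eps ξ =
      eps ξ * (∑ a, eps (φ a) * ins (realBasis E a)) +
        eps (∑ a, ξ (realBasis E a) • φ a) := by
  rw [Finset.sum_mul, Finset.mul_sum, map_sum, ← Finset.sum_add_distrib]
  refine Finset.sum_congr rfl fun a _ => ?_
  rw [mul_assoc, ins_mul_eps, mul_sub, mul_smul_comm, mul_one, ← mul_assoc, eps_mul_eps, neg_mul,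
    mul_assoc, map_smul, sub_neg_eq_add, add_comm]

theorem holDeg_mul_eps (ξ : E →L[ℝ] ℂ) :
    (holDeg * eps ξ : Op E) = eps ξ * holDeg + eps (holOne ξ) := by
  rw [holDeg, sum_eps_ins_mul_eps, sum_coord_holOne]

theorem antiDeg_mul_eps (ξ : E →L[ℝ] ℂ) :
    (antiDeg * eps ξ : Op E) = eps ξ * antiDeg + eps (antiOne ξ) := by
  rw [antiDeg, sum_eps_ins_mul_eps, sum_coord_antiOne]

namespace IsHerm

variable {w : Alt E 2} (hw : IsHerm w)
include hw

theorem sum_ins_I (ξ : E →L[ℝ] ℂ) :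
    ∑ a, ξ (fr w a) • (ins (Complex.I • realBasis E a) : Op E) =
      -∑ a, ξ (Complex.I • realBasis E a) • ins (fr w a) := by
  have h1 := hw.sum_bilin_I (oneIns ξ).flip
  have h2 := hw.sum_bilin_swap (oneIns (compI ξ))
  simp only [LinearMap.flip_apply, oneIns_apply, compI_apply] at h1 h2
  rw [h2, h1]

/-- Each of the two contractions in Λ meets ξ, and `sum_ins_I` identifies the two results, which
cancels the ½. This is the zeroth-order Kähler identity; the conjugation appears because ζ ↦ ζ^⋆ is
antilinear. -/
theorem lam_mul_eps (ξ : E →L[ℝ] ℂ) :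
    lam w * eps ξ = eps ξ * lam w + sh w (-conjOne (compI ξ)) := by
  have h : ∀ a, ins (Complex.I • realBasis E a) * ins (fr w a) * eps ξ =
      eps ξ * (ins (Complex.I • realBasis E a) * ins (fr w a)) +
      (ξ (fr w a) • ins (Complex.I • realBasis E a) -
        ξ (Complex.I • realBasis E a) • (ins (fr w a) : Op E)) := by
    intro a
    rw [mul_assoc, ins_mul_eps, mul_sub, mul_smul_comm, mul_one, ← mul_assoc, ins_mul_eps, sub_mul,
      smul_mul_assoc, one_mul, mul_assoc]
    abel
  rw [lam, smul_mul_assoc, Finset.sum_mul, mul_smul_comm, Finset.mul_sum]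
  simp only [h]
  rw [Finset.sum_add_distrib, smul_add, Finset.sum_sub_distrib, hw.sum_ins_I]
  congr 1
  rw [← neg_add', ← two_smul ℂ (∑ _, _), smul_neg, smul_smul, inv_mul_cancel₀ two_ne_zero, one_smul,
    sh, ← Finset.sum_neg_distrib]
  refine Finset.sum_congr rfl fun a _ => ?_
  simp [conjOne_apply, compI_apply]

theorem sh_mul_wd_two (ζ : E →L[ℝ] ℂ) :
    sh w ζ * wd 2 w = wd 2 w * sh w ζ - eps (conjOne (compI (ζ))) := by
  simp only [sh, Finset.sum_mul, Finset.mul_sum, smul_mul_assoc, mul_smul_comm, ins_mul_wd_two,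
    smul_add, Finset.sum_add_distrib]
  rw [sub_eq_add_neg]
  congr 1
  rw [← map_neg]
  have : -conjOne (compI ζ) = ∑ a, conj (ζ (realBasis E a)) • slotL w (fr w a) := by
    have h1 : ∀ a, slotL w (fr w a) = -compI (coord a) := by
      intro a
      ext v
      rw [neg_apply, compI_apply, hw.coord_eq, slotL_apply, smul_smul, Complex.I_mul_I,
        neg_one_smul, ← slotL_apply w _ (-v), map_neg, neg_neg, slotL_apply]
    simp only [h1]
    ext v
    have h2 := congrArg (fun ξ : E →L[ℝ] ℂ => conj (ξ (Complex.I • v))) (sum_coord_smul ζ)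
    simp only [sum_apply, smul_apply, smul_eq_mul, map_sum, map_mul] at h2
    rw [neg_apply, conjOne_apply, compI_apply, ← h2, sum_apply, ← Finset.sum_neg_distrib]
    refine Finset.sum_congr rfl fun a _ => ?_
    rw [smul_apply, neg_apply, compI_apply, smul_neg, smul_eq_mul, coord_apply,
      Complex.conj_ofReal]
  rw [this, map_sum]
  simp only [map_smul]

/-- The commutator is half a trace plus a derivation of the exterior algebra. For `h` a variation of
ω these are the logarithmic derivative of the volume density and the derivative of the inner
product, as `ip_commutator` makes precise. -/
theorem lam_mul_wd_two (h : Alt E 2) :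
    lam w * wd 2 h = wd 2 h * lam w +
      ((2 : ℂ)⁻¹ * ∑ a, h ![fr w a, Complex.I • realBasis E a]) • (1 : Op E) +
        ∑ a, eps (slotL h (Complex.I • fr w a)) * ins (realBasis E a) := by
  have h0 : ∀ a, ins (Complex.I • realBasis E a) * ins (fr w a) * wd 2 h =
      wd 2 h * (ins (Complex.I • realBasis E a) * ins (fr w a)) +
      h ![fr w a, Complex.I • realBasis E a] • (1 : Op E) +
      (eps (slotL h (Complex.I • realBasis E a)) * ins (fr w a) -
        eps (slotL h (fr w a)) * ins (Complex.I • realBasis E a)) := by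
    intro a
    rw [mul_assoc, ins_mul_wd_two, mul_add, ← mul_assoc, ins_mul_wd_two, ins_mul_eps, slotL_apply,
      add_mul, mul_assoc]
    abel
  let J : E →ₗ[ℝ] E := (LinearMap.lsmul ℂ E Complex.I).restrictScalars ℝ
  have hJ : ∀ v, J v = Complex.I • v := fun v => rfl
  have h1 := hw.sum_bilin_swap ((slotIns h).compl₁₂ J LinearMap.id)
  have h2 := hw.sum_bilin_I (slotIns h).flip
  simp only [LinearMap.compl₁₂_apply, LinearMap.flip_apply, slotIns_apply, LinearMap.id_apply,
    hJ] at h1 h2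
  rw [lam, smul_mul_assoc, Finset.sum_mul]
  simp only [h0]
  rw [Finset.sum_add_distrib, Finset.sum_add_distrib, Finset.sum_sub_distrib, h1, h2,
    sub_neg_eq_add, ← two_smul ℂ (∑ _, _ * _), smul_add, smul_add, smul_smul,
    inv_mul_cancel₀ two_ne_zero, one_smul,
    ← Finset.sum_smul, smul_smul, mul_smul_comm, ← Finset.mul_sum]

/-- For `h` = ω the trace is the real dimension, half of which is the complex one, and the
derivation is the opposite of the degree. -/
theorem lam_mul_wd_self :
    lam w * wd 2 w = wd 2 w * lam w + (Module.finrank ℂ E : ℂ) • (1 : Op E) - degOp := by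
  rw [hw.lam_mul_wd_two w, sub_eq_add_neg]
  congr 1
  · congr 2
    simp only [← hw.coord_eq, coord_apply, Module.Basis.repr_self, Finsupp.single_eq_same]
    rw [Finset.sum_const, Finset.card_univ, Fintype.card_fin, ← Module.finrank_mul_finrank ℝ ℂ E,
      Complex.finrank_real_complex]
    simp
  · rw [← sum_eps_mul_ins, ← Finset.sum_neg_distrib]
    refine Finset.sum_congr rfl fun a _ => ?_
    rw [← neg_mul, ← map_neg]
    congr 2
    ext v
    rw [slotL_apply, hw.apply_I_left, neg_apply, hw.coord_eq]

end IsHerm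

/-! ### Adjoints -/

/-- `S` is the adjoint of `T`. -/
def IsAdj (w : Alt E 2) (T S : Op E) : Prop := ∀ α β : Fib E, ip w (T α) β = ip w α (S β)

namespace IsAdj

variable {w : Alt E 2} {T T' S S' : Op E}

theorem add (h : IsAdj w T S) (h' : IsAdj w T' S') : IsAdj w (T + T') (S + S') := fun α β => by
  rw [Op.add_apply, Op.add_apply, ip_add_left, ip_add_right, h, h']

theorem sub (h : IsAdj w T S) (h' : IsAdj w T' S') : IsAdj w (T - T') (S - S') := fun α β => by
  rw [Op.sub_apply, Op.sub_apply, ip_sub_left, ip_sub_right, h, h']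

theorem smul (c : ℂ) (h : IsAdj w T S) : IsAdj w (c • T) (conj c • S) := fun α β => by
  rw [Op.smul_apply, Op.smul_apply, ip_smul_left, ip_smul_right, h, Complex.conj_conj]

theorem mul (h : IsAdj w T S) (h' : IsAdj w T' S') : IsAdj w (T * T') (S' * S) := fun α β => by
  rw [Op.mul_apply, Op.mul_apply, h, h']

theorem sum {ι : Type*} {s : Finset ι} {T S : ι → Op E} (h : ∀ i, IsAdj w (T i) (S i)) :
    IsAdj w (∑ i ∈ s, T i) (∑ i ∈ s, S i) := fun α β => by
  rw [Op.sum_apply, Op.sum_apply, ip_sum_left, ip_sum_right]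
  exact Finset.sum_congr rfl fun i _ => h i α β

theorem symm (hw : IsHerm w) (h : IsAdj w T S) : IsAdj w S T := fun α β => by
  rw [← hw.ip_conj, ← h, hw.ip_conj]

theorem eq (hw : IsHerm w) (h : IsAdj w T S) (h' : IsAdj w T S') : S = S' :=
  Op.ext fun β => hw.eq_of_ip fun γ => by rw [← h, ← h']

end IsAdj

/-- Contracting ζ ∧ α by e_a gives a term that is already of the desired form and a term to which
the induction hypothesis applies. Together they are 1 + (k + 1) copies of the same sum, which
cancels the factor (k + 2)⁻¹ of the recursion. -/
theorem altInner_oneWedge (w : Alt E 2) (ζ : E →L[ℝ] ℂ) : ∀ {k : ℕ} (α : Alt E k)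
    (β : Alt E (k + 1)), altInner w (oneWedge ζ α) β =
      altInner w α (∑ a, conj (ζ (realBasis E a)) • β.curryLeft (fr w a)) := by
  have hsum : ∀ {k : ℕ} (α : Alt E k) (β : Alt E (k + 1)),
      altInner w α (∑ a, conj (ζ (realBasis E a)) • β.curryLeft (fr w a)) =
      ∑ a, ζ (realBasis E a) * altInner w α (β.curryLeft (fr w a)) := by
    intro k α β
    simp only [← altInnerL_apply, map_sum, LinearMap.map_smulₛₗ, Complex.conj_conj, smul_eq_mul]
  intro k
  induction k with
  | zero =>
    intro α β
    rw [altInner_succ, hsum]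
    simp only [curryLeft_oneWedge_zero, altInner_smul_left, Nat.cast_zero, zero_add, inv_one,
      one_mul]
  | succ k ih =>
    intro α β
    rw [altInner_succ, hsum]
    have hswap : ∀ (β : Alt E (k + 2)) (v u : E),
        (β.curryLeft u).curryLeft v = -(β.curryLeft v).curryLeft u := by
      intro β v u
      have h := congrArg (fun T : Op E => T (Pi.single (k + 2) β) k) (ins_mul_ins v u)
      simp only [Op.neg_apply, Op.mul_apply, ins_apply, Pi.neg_apply] at h
      rwa [Pi.single_eq_same] at h
    have h1 : ∀ a, altInner w ((oneWedge ζ α).curryLeft (realBasis E a)) (β.curryLeft (fr w a)) =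
        ζ (realBasis E a) * altInner w α (β.curryLeft (fr w a)) +
        ∑ b, ζ (realBasis E b) * altInner w (α.curryLeft (realBasis E a))
          ((β.curryLeft (fr w b)).curryLeft (fr w a)) := by
      intro a
      rw [curryLeft_oneWedge_succ, ← altInnerL_apply, map_sub, LinearMap.sub_apply, map_smul,
        LinearMap.smul_apply, altInnerL_apply, altInnerL_apply, ih, hsum, sub_eq_add_neg,
        ← Finset.sum_neg_distrib, smul_eq_mul]
      congr 1
      refine Finset.sum_congr rfl fun b _ => ?_
      rw [hswap β (fr w a) (fr w b), ← altInnerL_apply, ← altInnerL_apply, map_neg, mul_neg]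
    simp only [h1]
    rw [Finset.sum_add_distrib, Finset.sum_comm]
    have h2 : ∀ b, altInner w α (β.curryLeft (fr w b)) = ((k : ℂ) + 1)⁻¹ * ∑ a,
        altInner w (α.curryLeft (realBasis E a)) ((β.curryLeft (fr w b)).curryLeft (fr w a)) :=
      fun b => altInner_succ w α _
    have hk : ((k : ℂ) + 1) ≠ 0 := by exact_mod_cast Nat.succ_ne_zero k
    have h3 : ∀ b, ∑ a, ζ (realBasis E b) * altInner w (α.curryLeft (realBasis E a))
          ((β.curryLeft (fr w b)).curryLeft (fr w a)) =
        ((k : ℂ) + 1) * (ζ (realBasis E b) * altInner w α (β.curryLeft (fr w b))) := by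
      intro b
      rw [h2 b, ← Finset.mul_sum]
      field_simp
    simp only [h3]
    rw [← Finset.mul_sum]
    have hk2 : ((k : ℂ) + 1 + 1) ≠ 0 := by exact_mod_cast Nat.succ_ne_zero (k + 1)
    push_cast
    field_simp
    ring

theorem isAdj_eps (w : Alt E 2) (ζ : E →L[ℝ] ℂ) : IsAdj w (eps ζ) (sh w ζ) := by
  intro α β
  rw [ip, ip, Finset.sum_range_succ', Finset.sum_range_succ]
  have h1 : ∀ k, (sh w ζ β) k =
      ∑ a, conj (ζ (realBasis E a)) • (β (k + 1)).curryLeft (fr w a) := by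
    intro k
    rw [sh, Op.sum_apply, Finset.sum_apply]
    rfl
  congr 1
  · refine Finset.sum_congr rfl fun k _ => ?_
    rw [h1, eps_apply_succ, altInner_oneWedge]
  -- The shift of degrees leaves two boundary terms: the product by ζ has no component of degree 0,
  -- and in the top degree the contraction acts on a form of degree above the real dimension.
  · rw [h1, eps_apply_zero, ← altInnerL_apply, ← altInner_oneWedge,
      subsingleton_alt (Nat.lt_succ_self _) (β _), map_zero, ← altInnerL_apply, map_zero,
      LinearMap.zero_apply]

theorem sh_coord (w : Alt E 2) (a : Fin (Module.finrank ℝ E)) : sh w (coord a) = ins (fr w a) := by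
  rw [sh, Finset.sum_eq_single a]
  · simp [coord_apply]
  · intro b _ hb
    simp [coord_apply, hb]
  · simp

theorem isAdj_one (w : Alt E 2) : IsAdj w (1 : Op E) 1 := fun _ _ => rfl

/-- The adjoint of the exterior product by a `p`-form. -/
def contr (w : Alt E 2) : (p : ℕ) → Alt E p → Op E
  | 0, ρ => conj (ρ 0) • 1
  | p + 1, ρ => ((p : ℂ) + 1)⁻¹ • ∑ a, contr w p (ρ.curryLeft (realBasis E a)) * ins (fr w a)

theorem isAdj_wd (w : Alt E 2) : ∀ (p : ℕ) (ρ : Alt E p), IsAdj w (wd p ρ) (contr w p ρ) := by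
  intro p
  induction p with
  | zero =>
    intro ρ
    rw [wd_zero]
    exact (isAdj_one w).smul _
  | succ p ih =>
    intro ρ
    rw [wd_succ, contr]
    have : ((p : ℂ) + 1)⁻¹ = conj ((p : ℂ) + 1)⁻¹ := by
      rw [map_inv₀, map_add, map_one, Complex.conj_natCast]
    nth_rewrite 2 [this]
    refine IsAdj.smul _ (IsAdj.sum fun a => ?_)
    rw [← sh_coord]
    exact (isAdj_eps w _).mul (ih _)

namespace IsHerm

variable {w : Alt E 2} (hw : IsHerm w)
include hw

/-- Invariance of `h` under the complex structure lets the factor i be placed as in the definition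
of Λ. In this shape (h ∧ ·)^⋆ is the contraction by g⁻¹ h g⁻¹, that is, minus the derivative of Λ in
the direction `h`. -/
theorem contr_two {h : Alt E 2} (hh : IsRealOneOne h) :
    contr w 2 h = (2 : ℂ)⁻¹ • ∑ a, ∑ b, h ![fr w a, Complex.I • fr w b] •
      (ins (Complex.I • realBasis E a) * ins (realBasis E b)) := by
  have h1 : IsAdj w (wd 2 h) ((2 : ℂ)⁻¹ • ∑ a, ∑ b,
      h ![realBasis E a, realBasis E b] • (ins (fr w b) * ins (fr w a))) := by
    rw [wd_two_slotL]
    have : (2 : ℂ)⁻¹ = conj (2 : ℂ)⁻¹ := by rw [map_inv₀, map_ofNat]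
    nth_rewrite 2 [this]
    refine IsAdj.smul _ (IsAdj.sum fun a => ?_)
    have h2 := (isAdj_eps w (coord a)).mul (isAdj_eps w (slotL h (realBasis E a)))
    convert h2 using 1
    rw [sh_coord, sh, Finset.sum_mul]
    refine Finset.sum_congr rfl fun b _ => ?_
    rw [slotL_apply, hh.conj_apply, smul_mul_assoc]
  rw [IsAdj.eq hw (isAdj_wd w 2 h) h1]
  congr 1
  have hre : ∀ v u, h ![v, u] = slotL h v u := fun v u => (slotL_apply h v u).symm
  -- real bilinear maps used to move the frames
  let B : E → E → E →ₗ[ℝ] E →ₗ[ℝ] Op E := fun v u => LinearMap.mk₂ ℝ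
    (fun x y => slotL h v x • (ins y * ins u : Op E))
    (fun x x' y => by rw [map_add, add_smul]) (fun c x y => by rw [map_smul, smul_assoc])
    (fun x y y' => by rw [map_add, add_mul, smul_add])
    (fun c x y => by rw [map_smul, smul_mul_assoc, smul_comm])
  let C : E →ₗ[ℝ] E →ₗ[ℝ] Op E := ∑ b, LinearMap.mk₂ ℝ
    (fun x y => slotL h x (fr w b) • (ins (realBasis E b) * ins y : Op E))
    (fun x x' y => by rw [map_add, add_apply, add_smul])
    (fun c x y => by rw [map_smul, smul_apply, smul_assoc])
    (fun x y y' => by rw [map_add, mul_add, smul_add])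
    (fun c x y => by rw [map_smul, mul_smul_comm, smul_comm])
  have hC : ∀ x y, C x y = ∑ b, slotL h x (fr w b) • (ins (realBasis E b) * ins y : Op E) := by
    intro x y
    simp [C, LinearMap.sum_apply]
  have hB : ∀ v u x y, B v u x y = slotL h v x • (ins y * ins u : Op E) := fun _ _ _ _ => rfl
  have h2 : ∀ a, ∑ b, h ![realBasis E a, realBasis E b] • (ins (fr w b) * ins (fr w a) : Op E) =
      C (realBasis E a) (fr w a) := by
    intro a
    have := hw.sum_bilin_swap (B (realBasis E a) (fr w a))
    simp only [hB] at this
    simp only [hre, this, hC]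
  simp only [h2]
  rw [hw.sum_bilin_swap]
  have h3 := hw.sum_bilin_I (C.flip)
  have h4 : ∀ v u, C (Complex.I • v) (Complex.I • u) =
      ∑ b, slotL h v (Complex.I • fr w b) • (ins (Complex.I • u) * ins (realBasis E b) : Op E) := by
    intro v u
    rw [hC]
    refine Finset.sum_congr rfl fun b _ => ?_
    rw [slotL_apply, hh.apply_I_left, ← slotL_apply, ins_mul_ins, neg_smul, smul_neg, neg_neg]
  let J : E →ₗ[ℝ] E := (LinearMap.lsmul ℂ E Complex.I).restrictScalars ℝ
  have hJ : ∀ v, J v = Complex.I • v := fun v => rfl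
  have h5 := hw.sum_bilin_I (C.compl₂ J).flip
  simp only [LinearMap.flip_apply, LinearMap.compl₂_apply, hJ, smul_smul, Complex.I_mul_I,
    neg_one_smul, map_neg, Finset.sum_neg_distrib, neg_inj] at h5
  rw [h5]
  simp only [h4, hre]

theorem contr_self : contr w 2 w = lam w := by
  rw [hw.contr_two hw.toIsRealOneOne, lam]
  congr 1
  refine Finset.sum_congr rfl fun a _ => ?_
  conv_rhs => rw [← hw.sum_metr_fr (fr w a)]
  rw [map_sum, Finset.mul_sum]
  refine Finset.sum_congr rfl fun b _ => ?_
  rw [LinearMap.map_smul ins (metr w (fr w b) (fr w a)), mul_smul_comm, hw.metr_symm,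
    ← hw.ofReal_metr, Complex.coe_smul]

theorem isAdj_lam : IsAdj w (wd 2 w) (lam w) := by
  rw [← hw.contr_self]
  exact isAdj_wd w 2 w

end IsHerm

end Operators

/-! ### The pointwise identity for one coordinate direction -/

section Identity

variable {E : Type*} [NormedAddCommGroup E] [NormedSpace ℂ E]

/-- The `1`-form `h (v, i ·)`. -/
def flat (h : Alt E 2) : E →ₗ[ℝ] (E →L[ℝ] ℂ) where
  toFun v := compI (slotL h v)
  map_add' v u := by rw [map_add]; rfl
  map_smul' c v := by rw [map_smul]; rfl

theorem flat_apply (h : Alt E 2) (v u : E) : flat h v u = h ![v, Complex.I • u] := by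
  rw [← slotL_apply]; rfl

theorem IsRealOneOne.compI_flat {h : Alt E 2} (hh : IsRealOneOne h) (v : E) :
    compI (flat h v) = -flat h (Complex.I • v) := by
  ext u
  rw [compI_apply, neg_apply, flat_apply, flat_apply, hh.apply_I_left, neg_neg]

theorem IsRealOneOne.slotL_I {h : Alt E 2} (hh : IsRealOneOne h) (v : E) :
    slotL h (Complex.I • v) = -flat h v := by
  ext u
  rw [slotL_apply, neg_apply, flat_apply, hh.apply_I_left]

/-- The `1`-form `η ξ' + ξ''`, where `ξ = ξ' + ξ''` is the decomposition into bidegrees. -/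
def twistOne (η : ℝ) (ξ : E →L[ℝ] ℂ) : E →L[ℝ] ℂ := (η : ℂ) • holOne ξ + antiOne ξ

/-- The `1`-form `ξ' - η ξ''`, where `ξ = ξ' + ξ''` is the decomposition into bidegrees. -/
def cotwistOne (η : ℝ) (ξ : E →L[ℝ] ℂ) : E →L[ℝ] ℂ := holOne ξ - (η : ℂ) • antiOne ξ

/-- Composition with i multiplies ξ' by i and ξ'' by -i, and conjugation exchanges the two when ξ is
real. Put into `lam_mul_eps`, this and the next lemma give [Λ, c] = i b^⋆ and [Λ, b] = -i c^⋆ for c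
= η ξ' + ξ'' and b = ξ' - η ξ''. -/
theorem neg_conjOne_compI_twistOne (η : ℝ) {ξ : E →L[ℝ] ℂ} (hξ : conjOne ξ = ξ) :
    -conjOne (compI (twistOne η ξ)) = -(Complex.I • cotwistOne η ξ) := by
  have hr : ∀ v, conj (ξ v) = ξ v := fun v => congrArg (fun ζ : E →L[ℝ] ℂ => ζ v) hξ
  ext v
  simp only [twistOne, cotwistOne, neg_apply, conjOne_apply, compI_apply, add_apply, sub_apply,
    smul_apply, smul_eq_mul, holOne_apply, antiOne_apply, map_add, map_sub, map_mul, hr, map_inv₀,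
    map_ofNat, Complex.conj_I, Complex.conj_ofReal, smul_smul, Complex.I_mul_I, neg_one_smul,
    map_neg]
  linear_combination (-(2 : ℂ)⁻¹ * ξ (Complex.I • v) - (η : ℂ) * 2⁻¹ * ξ (Complex.I • v)) *
    Complex.I_mul_I

theorem neg_conjOne_compI_cotwistOne (η : ℝ) {ξ : E →L[ℝ] ℂ} (hξ : conjOne ξ = ξ) :
    -conjOne (compI (cotwistOne η ξ)) = Complex.I • twistOne η ξ := by
  have hr : ∀ v, conj (ξ v) = ξ v := fun v => congrArg (fun ζ : E →L[ℝ] ℂ => ζ v) hξ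
  ext v
  simp only [twistOne, cotwistOne, neg_apply, conjOne_apply, compI_apply, add_apply, sub_apply,
    smul_apply, smul_eq_mul, holOne_apply, antiOne_apply, map_add, map_sub, map_mul, hr, map_inv₀,
    map_ofNat, Complex.conj_I, Complex.conj_ofReal, smul_smul, Complex.I_mul_I, neg_one_smul,
    map_neg]
  linear_combination ((2 : ℂ)⁻¹ * (ξ (Complex.I • v) + (η : ℂ) * ξ (Complex.I • v)) -
    ξ (Complex.I • v)) * Complex.I_mul_I

variable [FiniteDimensional ℂ E]

namespace IsHerm

variable {w : Alt E 2} (hw : IsHerm w)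
include hw

theorem flat_fr (a : Fin (Module.finrank ℝ E)) : flat w (fr w a) = coord a := by
  ext u
  rw [flat_apply, hw.coord_eq]

theorem sh_flat (v : E) : sh w (flat w v) = ins v := by
  conv_rhs => rw [← hw.sum_metr_basis v]
  rw [map_sum, sh]
  refine Finset.sum_congr rfl fun a _ => ?_
  rw [flat_apply, hw.conj_apply, ← hw.ofReal_metr, hw.metr_symm, LinearMap.map_smul,
    Complex.coe_smul]

/-- After transposing each term of Q, the two expressions differ by an exchange of dual frames and
by the position of a factor i, which `sum_bilin_swap` and `sum_bilin_I` settle. -/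
theorem isAdj_antiDeg : IsAdj w antiDeg antiDeg := by
  have h1 : IsAdj w antiDeg (∑ a, eps (flat w (realBasis E a)) * sh w (antiOne (coord a))) := by
    refine IsAdj.sum fun a => ?_
    refine (isAdj_eps w _).mul ?_
    rw [← hw.sh_flat]
    exact (isAdj_eps w _).symm hw
  convert h1 using 1
  let B : E →ₗ[ℝ] E →ₗ[ℝ] Op E :=
    (LinearMap.mul ℝ (Op E)).compl₁₂ ((eps.restrictScalars ℝ).comp (flat w)) ins
  have hB : ∀ v u, B v u = eps (flat w v) * ins u := fun v u => rfl
  let J : E →ₗ[ℝ] E := (LinearMap.lsmul ℂ E Complex.I).restrictScalars ℝ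
  have hJ : ∀ v, J v = Complex.I • v := fun v => rfl
  have h2 := hw.sum_bilin_swap B
  have h3 := hw.sum_bilin_swap (B.compl₁₂ J LinearMap.id)
  have h4 := hw.sum_bilin_I B
  simp only [LinearMap.compl₁₂_apply, LinearMap.id_apply, hJ, hB] at h2 h3 h4
  have h5 : ∀ a, sh w (antiOne (coord a)) =
      (2 : ℂ)⁻¹ • (ins (fr w a) + Complex.I • ins (Complex.I • fr w a)) := by
    intro a
    rw [antiOne, sh_smul, sh_add, sh_smul, ← hw.flat_fr, hw.compI_flat, ← neg_one_smul ℂ (flat w _),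
      sh_smul, hw.sh_flat, hw.sh_flat, smul_smul, map_inv₀, map_ofNat, Complex.conj_I, map_neg,
      map_one, neg_mul_neg, mul_one]
  have h6 : ∀ a, eps (antiOne (coord a)) * (ins (realBasis E a) : Op E) =
      (2 : ℂ)⁻¹ • (eps (flat w (fr w a)) * ins (realBasis E a) -
        Complex.I • (eps (flat w (Complex.I • fr w a)) * ins (realBasis E a))) := by
    intro a
    rw [antiOne, map_smul, map_add, map_smul, ← hw.flat_fr, hw.compI_flat, map_neg, smul_neg,
      ← sub_eq_add_neg, smul_mul_assoc, sub_mul, smul_mul_assoc]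
  rw [antiDeg]
  simp only [h5, h6, mul_smul_comm, mul_add]
  rw [← Finset.smul_sum, ← Finset.smul_sum, Finset.sum_sub_distrib, Finset.sum_add_distrib,
    ← Finset.smul_sum, ← Finset.smul_sum, ← h2, ← h3, h4, smul_neg, sub_neg_eq_add]

/-- Moving the factor i across the frames leaves, up to sign, ∑ g(f_a, ·) ∧ g(e_a, ·), which is
symmetric under the exchange of the frames and skew as an exterior product. It expresses that ω is
of bidegree (1,1), and yields [P, L] = [Q, L] = L. -/
theorem sum_compI_slot :
    ∑ a, eps (compI (coord a)) * (eps (slotL w (realBasis E a)) : Op E) = 0 := by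
  let B : E →ₗ[ℝ] E →ₗ[ℝ] Op E :=
    (LinearMap.mul ℝ (Op E)).compl₁₂ ((eps.restrictScalars ℝ).comp (flat w))
      ((eps.restrictScalars ℝ).comp (slotL w))
  have hB : ∀ v u, B v u = eps (flat w v) * eps (slotL w u) := fun v u => rfl
  let C : E →ₗ[ℝ] E →ₗ[ℝ] Op E :=
    (LinearMap.mul ℝ (Op E)).compl₁₂ ((eps.restrictScalars ℝ).comp (flat w))
      ((eps.restrictScalars ℝ).comp (flat w))
  have hC : ∀ v u, C v u = eps (flat w v) * eps (flat w u) := fun v u => rfl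
  have h1 := hw.sum_bilin_I B.flip
  have h2 := hw.sum_bilin_swap C
  simp only [LinearMap.flip_apply, hB, hC] at h1 h2
  have h3 : ∀ a, eps (compI (coord a)) * (eps (slotL w (realBasis E a)) : Op E) =
      -(eps (flat w (Complex.I • fr w a)) * eps (slotL w (realBasis E a))) := by
    intro a
    rw [← hw.flat_fr, hw.compI_flat, map_neg, neg_mul]
  simp only [h3]
  rw [Finset.sum_neg_distrib, ← h1]
  simp only [hw.slotL_I, map_neg, mul_neg]
  rw [Finset.sum_neg_distrib, neg_eq_zero]
  refine Op.eq_zero_of_eq_neg ?_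
  conv_rhs => rw [← h2]
  rw [← Finset.sum_neg_distrib]
  refine Finset.sum_congr rfl fun a _ => ?_
  rw [eps_mul_eps]

theorem antiDeg_mul_wd_self : antiDeg * wd 2 w = wd 2 w * antiDeg + wd 2 w := by
  rw [antiDeg, Finset.sum_mul, Finset.mul_sum]
  nth_rewrite 3 [wd_two_slotL]
  have h : ∀ a, eps (antiOne (coord a)) * ins (realBasis E a) * wd 2 w =
      wd 2 w * (eps (antiOne (coord a)) * ins (realBasis E a)) +
      ((2 : ℂ)⁻¹ • (eps (coord a) * eps (slotL w (realBasis E a))) +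
       (2 : ℂ)⁻¹ • Complex.I • (eps (compI (coord a)) * eps (slotL w (realBasis E a)))) := by
    intro a
    rw [mul_assoc, ins_mul_wd_two, mul_add, ← mul_assoc, ← wd_two_mul_eps, mul_assoc]
    congr 1
    rw [antiOne, map_smul, map_add, map_smul, smul_mul_assoc, add_mul, smul_mul_assoc, smul_add]
  simp only [h]
  rw [Finset.sum_add_distrib, Finset.sum_add_distrib, ← Finset.smul_sum, ← Finset.smul_sum,
    ← Finset.smul_sum, hw.sum_compI_slot, smul_zero, smul_zero, add_zero]

theorem holDeg_mul_wd_self : holDeg * wd 2 w = wd 2 w * holDeg + wd 2 w := by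
  rw [holDeg, Finset.sum_mul, Finset.mul_sum]
  nth_rewrite 3 [wd_two_slotL]
  have h : ∀ a, eps (holOne (coord a)) * ins (realBasis E a) * wd 2 w =
      wd 2 w * (eps (holOne (coord a)) * ins (realBasis E a)) +
      ((2 : ℂ)⁻¹ • (eps (coord a) * eps (slotL w (realBasis E a))) -
       (2 : ℂ)⁻¹ • Complex.I • (eps (compI (coord a)) * eps (slotL w (realBasis E a)))) := by
    intro a
    rw [mul_assoc, ins_mul_wd_two, mul_add, ← mul_assoc, ← wd_two_mul_eps, mul_assoc]
    congr 1
    rw [holOne, map_smul, map_sub, map_smul, smul_mul_assoc, sub_mul, smul_mul_assoc, smul_sub]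
  simp only [h]
  rw [Finset.sum_add_distrib, Finset.sum_sub_distrib, ← Finset.smul_sum, ← Finset.smul_sum,
    ← Finset.smul_sum, hw.sum_compI_slot, smul_zero, smul_zero, sub_zero]

end IsHerm

/-- The algebraic identity behind the commutation relations. -/
theorem commutation_algebra {A : Type*} [Ring A] [Algebra ℂ A] {Λ L h c s P Q X Y : A}
    {η k n : ℂ} (hΛc : Λ * c = c * Λ + Complex.I • s) (hsL : s * L = L * s + Complex.I • c)
    (hΛL : Λ * L = L * Λ + n • (1 : A) - (P + Q)) (hhc : h * c = c * h)
    (hQc : Q * c = c * Q + Y) (hQL : Q * L = L * Q + L) (hc : c = η • X + Y) :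
    (Λ * (c * (h - k • L)) - c * (h - k • L) * Λ) - k • (c * P) +
      (Complex.I * k) • (Q * s * L) - Complex.I • (h * s) - (Complex.I * k) • (L * (Q * s)) +
      (Complex.I * k * n) • (L * s - s * L) =
    (Λ * h - h * Λ) * c + (k * η) • X := by
  have hI : Complex.I * Complex.I = -1 := Complex.I_mul_I
  have e1 : Λ * (c * (h - k • L)) = c * (Λ * h) + Complex.I • (s * h) -
      k • (c * (L * Λ) + n • c - (c * P + c * Q) + Complex.I • (L * s) - c) := by
    rw [← mul_assoc, hΛc, mul_sub, add_mul, mul_smul_comm, add_mul, smul_mul_assoc, smul_mul_assoc,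
      hsL, mul_assoc, mul_assoc c Λ L, hΛL, mul_sub, mul_add, mul_smul_comm, mul_one, mul_add,
      smul_add Complex.I, smul_smul, hI, neg_one_smul]
    module
  have e2 : c * (h - k • L) * Λ = c * (h * Λ) - k • (c * (L * Λ)) := by
    rw [mul_sub, sub_mul, mul_smul_comm, smul_mul_assoc, mul_assoc, mul_assoc]
  have e3 : Q * s * L = L * (Q * s) + L * s + Complex.I • (c * Q + Y) := by
    rw [mul_assoc, hsL, mul_add, mul_smul_comm, hQc, ← mul_assoc, hQL, add_mul, mul_assoc]
  have e4 : (Λ * h - h * Λ) * c = c * (Λ * h) + Complex.I • (s * h) - c * (h * Λ) -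
      Complex.I • (h * s) := by
    rw [sub_mul, mul_assoc, mul_assoc, hhc, hΛc, ← mul_assoc Λ, hΛc, mul_add, add_mul,
      mul_smul_comm, smul_mul_assoc, ← mul_assoc h c Λ, hhc, mul_assoc, mul_assoc]
    abel
  have e6 : (k * η) • X = k • c - k • Y := by rw [hc, smul_add, smul_smul]; abel
  have e7 : L * s - s * L = -(Complex.I • c) := by rw [hsL]; abel
  rw [e1, e2, e3, e4, e6, e7]
  have e8 : (Complex.I * k) • (Complex.I • (c * Q + Y)) = -(k • (c * Q + Y)) := by
    rw [smul_smul, mul_right_comm, hI, neg_one_mul, neg_smul]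
  -- Here the n coming from [Λ, L] in `e1` is cancelled: this is the role of the terms with n/η in
  -- the theorem.
  have e9 : (Complex.I * k * n) • (-(Complex.I • c)) = (k * n) • c := by
    rw [smul_neg, smul_smul, ← neg_smul]
    congr 1
    linear_combination (-k * n) * hI
  rw [smul_add (Complex.I * k), e8, e9]
  module

/-- The pointwise identity behind the commutation relations. -/
theorem IsHerm.pointwise_identity {w h : Alt E 2} (hw : IsHerm w)
    {ξ : E →L[ℝ] ℂ} (hξ : conjOne ξ = ξ) {η s : ℝ} (hη : η ≠ 0) (u u' v v' : Fib E) :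
    ip w (eps (twistOne η ξ) (u' - ((s : ℂ) / η) • holDeg u)) v +
      ip w ((lam w * (eps (twistOne η ξ) * (wd 2 h - ((s : ℂ) / η) • wd 2 w)) -
        (eps (twistOne η ξ) * (wd 2 h - ((s : ℂ) / η) • wd 2 w)) * lam w) u) v +
      ip w u (Complex.I • (lam w (eps (cotwistOne η ξ) (v' - ((s : ℂ) / η) • antiDeg v)) -
        eps (cotwistOne η ξ) (lam w v' - contr w 2 h v - ((s : ℂ) / η) • antiDeg (lam w v)))) -
      ip w u (((Module.finrank ℂ E : ℂ) * ((s : ℂ) / η)) • (Complex.I •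
        (eps (cotwistOne η ξ) (lam w v) - lam w (eps (cotwistOne η ξ) v)))) =
    ip w (eps (twistOne η ξ) u') v + ip w (eps (twistOne η ξ) u) v' +
      ip w ((lam w * wd 2 h - wd 2 h * lam w) (eps (twistOne η ξ) u)) v +
      s * ip w (eps (holOne ξ) u) v := by
  set k : ℂ := (s : ℂ) / η with hk
  set n : ℂ := (Module.finrank ℂ E : ℂ) with hn
  have hkc : conj k = k := by rw [hk, map_div₀, Complex.conj_ofReal, Complex.conj_ofReal]
  have hnc : conj n = n := by rw [hn, Complex.conj_natCast]
  set c : Op E := eps (twistOne η ξ) with hc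
  set b : Op E := eps (cotwistOne η ξ) with hb
  have hΛc : lam w * c = c * lam w + Complex.I • sh w (cotwistOne η ξ) := by
    rw [hc, hw.lam_mul_eps, neg_conjOne_compI_twistOne η hξ, ← neg_smul Complex.I (cotwistOne η ξ),
      sh_smul, map_neg, Complex.conj_I, neg_neg]
  have hΛb : lam w * b = b * lam w - Complex.I • sh w (twistOne η ξ) := by
    rw [hb, hw.lam_mul_eps, neg_conjOne_compI_cotwistOne η hξ, sh_smul,
      Complex.conj_I, neg_smul, sub_eq_add_neg]
  have hsL : sh w (cotwistOne η ξ) * wd 2 w =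
      wd 2 w * sh w (cotwistOne η ξ) + Complex.I • c := by
    rw [hw.sh_mul_wd_two, sub_eq_add_neg, ← map_neg, neg_conjOne_compI_cotwistOne η hξ, map_smul]
  have hΛL : lam w * wd 2 w = wd 2 w * lam w + n • (1 : Op E) - (holDeg + antiDeg) := by
    rw [hw.lam_mul_wd_self, holDeg_add_antiDeg]
  have hQc : antiDeg * c = c * antiDeg + eps (antiOne ξ) := by
    rw [hc, antiDeg_mul_eps, twistOne, antiOne_smul_add]
  have hcX : c = (η : ℂ) • eps (holOne ξ) + eps (antiOne ξ) := by
    rw [hc, twistOne, map_add, map_smul]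
  have key := commutation_algebra (k := k) hΛc hsL hΛL (wd_two_mul_eps h _) hQc
    hw.antiDeg_mul_wd_self hcX
  have hkη : k * (η : ℂ) = s := by
    rw [hk, div_mul_cancel₀]; exact_mod_cast hη
  rw [hkη] at key
  have adb : IsAdj w (sh w (cotwistOne η ξ)) b := (isAdj_eps w _).symm hw
  have adL := hw.isAdj_lam
  have adQ := hw.isAdj_antiDeg
  have adh : IsAdj w (wd 2 h) (contr w 2 h) := isAdj_wd w 2 h
  have ad1 := (((adQ.mul adb).mul adL).smul (Complex.I * k))
  have ad2 := (adh.mul adb).smul (-Complex.I)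
  have ad3 := (adL.mul (adQ.mul adb)).smul (-(Complex.I * k))
  have ad4 := ((adL.mul adb).sub (adb.mul adL)).smul (Complex.I * k * n)
  have ad := ((ad1.add ad2).add ad3).add ad4
  have hv : IsAdj w c (sh w (twistOne η ξ)) := isAdj_eps w _
  -- The derivative v' enters only through i (Λ b - b Λ) v' = c^⋆ v'. The terms of order zero in v
  -- are transposed onto u, where `commutation_algebra` applies.
  have hrhs : ip w u (Complex.I • (lam w (b (v' - k • antiDeg v)) -
        b (lam w v' - contr w 2 h v - k • antiDeg (lam w v)))) -
      ip w u ((n * k) • (Complex.I • (b (lam w v) - lam w (b v)))) =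
      ip w (c u) v' + ip w ((((Complex.I * k) • (antiDeg * sh w (cotwistOne η ξ) * wd 2 w) +
        (-Complex.I) • (wd 2 h * sh w (cotwistOne η ξ)) +
        (-(Complex.I * k)) • (wd 2 w * (antiDeg * sh w (cotwistOne η ξ))) +
        (Complex.I * k * n) • (wd 2 w * sh w (cotwistOne η ξ) -
          sh w (cotwistOne η ξ) * wd 2 w)) : Op E) u) v := by
    rw [ad u v, hv u v', ← ip_sub_right, ← ip_add_right]
    congr 1
    have h1 : sh w (twistOne η ξ) v' = Complex.I • (lam w (b v') - b (lam w v')) := by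
      have h2 := congrArg (fun T : Op E => T v') hΛb
      simp only [Op.mul_apply, Op.sub_apply, Op.smul_apply] at h2
      rw [h2, sub_sub_cancel_left, smul_neg, smul_smul, Complex.I_mul_I]
      module
    rw [h1]
    simp only [Op.add_apply, Op.sub_apply, Op.smul_apply, Op.mul_apply, map_mul, map_neg,
      Complex.conj_I, hkc, hnc, map_sub, map_smul, neg_neg]
    module
  rw [add_sub_assoc, hrhs]
  have h3 := congrArg (fun T : Op E => ip w (T u) v) key
  simp only [Op.add_apply, Op.sub_apply, Op.smul_apply, Op.mul_apply, ip_add_left, ip_sub_left,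
    ip_smul_left, map_sub, map_smul] at h3 ⊢
  simp only [neg_mul] at h3 ⊢
  linear_combination h3

end Identity

/-! ### Derivatives of determinants and inverse matrices -/

section MatrixCalculus

variable {ι : Type*} [Fintype ι] [DecidableEq ι]

/-- The determinant, as a continuous multilinear function of the rows. -/
def detCMM (ι : Type*) [Fintype ι] [DecidableEq ι] :
    ContinuousMultilinearMap ℝ (fun _ : ι => ι → ℝ) ℝ where
  toMultilinearMap := (Matrix.detRowAlternating (n := ι) (R := ℝ)).toMultilinearMap
  cont := by
    change Continuous fun A : ι → ι → ℝ => (Matrix.of A).det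
    exact Continuous.matrix_det continuous_id

/-- Jacobi's formula: the determinant is multilinear in the rows, and replacing one row gives a
Cramer determinant, an entry of the adjugate applied to that row. -/
theorem hasDerivAt_det {G : ℝ → Matrix ι ι ℝ} {G' : Matrix ι ι ℝ} {t : ℝ}
    (hG : ∀ a b, HasDerivAt (fun s => G s a b) (G' a b) t) :
    HasDerivAt (fun s => (G s).det) (((G t).adjugate * G').trace) t := by
  have h1 : HasDerivAt (fun s => fun a b => G s a b) (fun a b => G' a b) t :=
    hasDerivAt_pi.2 fun a => hasDerivAt_pi.2 fun b => hG a b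
  have h2 := ((detCMM ι).hasStrictFDerivAt (fun a b => G t a b)).hasFDerivAt.comp_hasDerivAt t h1
  refine h2.congr_deriv ?_
  rw [ContinuousMultilinearMap.linearDeriv_apply, Matrix.trace_mul_comm]
  refine Finset.sum_congr rfl fun i _ => ?_
  have h3 : detCMM ι (Function.update (fun a b => G t a b) i (fun b => G' i b)) =
      ((G t).updateRow i (G' i)).det := rfl
  rw [h3, ← Matrix.cramer_transpose_apply, Matrix.cramer_eq_adjugate_mulVec,
    ← Matrix.adjugate_transpose]
  simp [Matrix.mulVec, dotProduct, Matrix.mul_apply, mul_comm]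

variable {V : Type*} [NormedAddCommGroup V] [NormedSpace ℝ V]

theorem contDiffOn_det {G : V → Matrix ι ι ℝ} {U : Set V}
    (hG : ∀ a b, ContDiffOn ℝ ∞ (fun y => G y a b) U) :
    ContDiffOn ℝ ∞ (fun y => (G y).det) U := by
  simp only [Matrix.det_apply']
  exact ContDiffOn.sum fun σ _ => contDiffOn_const.mul (contDiffOn_prod fun i _ => hG _ _)

theorem contDiffOn_inv {G : V → Matrix ι ι ℝ} {U : Set V}
    (hG : ∀ a b, ContDiffOn ℝ ∞ (fun y => G y a b) U) (hU : ∀ y ∈ U, IsUnit (G y).det) (a b : ι) :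
    ContDiffOn ℝ ∞ (fun y => (G y)⁻¹ a b) U := by
  simp only [Matrix.inv_def, Matrix.smul_apply, Matrix.adjugate_apply, Ring.inverse_eq_inv',
    smul_eq_mul]
  refine ((contDiffOn_det hG).inv fun y hy => (hU y hy).ne_zero).mul (contDiffOn_det fun c d => ?_)
  simp only [Matrix.updateRow_apply]
  split_ifs
  · exact contDiffOn_const
  · exact hG c d

/-- Cramer's formula shows that the entries of the inverse are differentiable; the value of the
derivative is then found by differentiating G G⁻¹ = 1. -/
theorem hasDerivAt_inv {G : ℝ → Matrix ι ι ℝ} {G' : Matrix ι ι ℝ} {t : ℝ}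
    (hG : ∀ a b, HasDerivAt (fun s => G s a b) (G' a b) t) (hU : IsUnit (G t).det) (a b : ι) :
    HasDerivAt (fun s => (G s)⁻¹ a b) (-((G t)⁻¹ * G' * (G t)⁻¹) a b) t := by
  have hdet := hasDerivAt_det hG
  have hadj : ∀ c d, ∃ x, HasDerivAt (fun s => (G s)⁻¹ c d) x t := by
    intro c d
    have h1 : ∃ x, HasDerivAt (fun s => (G s).adjugate c d) x t := by
      simp only [Matrix.adjugate_apply]
      refine ⟨_, hasDerivAt_det
        (G' := fun i j => if i = d then 0 else G' i j) fun i j => ?_⟩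
      simp only [Matrix.updateRow_apply]
      split_ifs
      · exact hasDerivAt_const _ _
      · exact hG i j
    obtain ⟨x, hx⟩ := h1
    simp only [Matrix.inv_def, Matrix.smul_apply, Ring.inverse_eq_inv', smul_eq_mul]
    exact ⟨_, (hdet.fun_inv hU.ne_zero).mul hx⟩
  choose H' hH' using hadj
  have hev : ∀ᶠ s in nhds t, IsUnit (G s).det := by
    filter_upwards [hdet.continuousAt.eventually_ne hU.ne_zero] with s hs
    exact isUnit_iff_ne_zero.2 hs
  have h1 : G' * (G t)⁻¹ + G t * Matrix.of H' = 0 := by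
    ext c d
    have h2 : HasDerivAt (fun s => (G s * (G s)⁻¹) c d)
        (∑ e, (G' c e * (G t)⁻¹ e d + G t c e * H' e d)) t := by
      simp only [Matrix.mul_apply]
      exact HasDerivAt.fun_sum fun e _ => (hG c e).mul (hH' e d)
    have h3 : HasDerivAt (fun s => (G s * (G s)⁻¹) c d) 0 t := by
      refine (hasDerivAt_const t ((1 : Matrix ι ι ℝ) c d)).congr_of_eventuallyEq ?_
      filter_upwards [hev] with s hs
      rw [Matrix.mul_nonsing_inv _ hs]
    have h4 := h2.unique h3
    rw [Finset.sum_add_distrib] at h4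
    simpa [Matrix.mul_apply] using h4
  have h5 : Matrix.of H' = -((G t)⁻¹ * G' * (G t)⁻¹) := by
    have h6 := congrArg (fun A => (G t)⁻¹ * A) (eq_neg_of_add_eq_zero_right h1)
    rwa [← Matrix.mul_assoc, Matrix.nonsing_inv_mul _ hU, Matrix.one_mul, Matrix.mul_neg,
      ← Matrix.mul_assoc] at h6
  refine (hH' a b).congr_deriv ?_
  exact congrFun (congrFun h5 a) b

end MatrixCalculus

/-! ### Smooth sections and differentiable paths of forms and of operators -/

section Sections

variable {E : Type*} [NormedAddCommGroup E] [NormedSpace ℂ E]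

/-- The exterior product by a `1`-form, as a real-linear map. -/
def oneWedgeL (ξ : E →L[ℝ] ℂ) (k : ℕ) : Alt E k →ₗ[ℝ] Alt E (k + 1) where
  toFun := oneWedge ξ
  map_add' := oneWedge_add_right ξ
  map_smul' c α := by
    exact oneWedge_smul_right (c : ℂ) ξ α

/-- The contraction by a vector, as a real-linear map. -/
def curryLeftL (v : E) (k : ℕ) : Alt E (k + 1) →ₗ[ℝ] Alt E k where
  toFun α := α.curryLeft v
  map_add' _ _ := rfl
  map_smul' _ _ := rfl

/-- The value of a form at given vectors, as a real-linear map. -/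
def evalL {k : ℕ} (v : Fin k → E) : Alt E k →ₗ[ℝ] ℂ where
  toFun α := α v
  map_add' _ _ := rfl
  map_smul' _ _ := rfl

/-- The section `u` of the bundle of forms over `U` is `C^∞`. -/
def SmoothFib (u : E → Fib E) (U : Set E) : Prop := ∀ k, ContDiffOn ℝ ∞ (fun y => u y k) U

/-- The family `T` of operators maps `C^∞` sections over `U` to `C^∞` sections. -/
def SmoothOp (T : E → Op E) (U : Set E) : Prop :=
  ∀ u, SmoothFib u U → SmoothFib (fun y => T y (u y)) U

/-- The path `u` of forms has derivative `u'` at `t`. -/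
def HasDerivFib (u : ℝ → Fib E) (u' : Fib E) (t : ℝ) : Prop :=
  ∀ k, HasDerivAt (fun s => u s k) (u' k) t

/-- The path `T` of operators has derivative `T'` at `t`. -/
def HasDerivOp (T : ℝ → Op E) (T' : Op E) (t : ℝ) : Prop :=
  ∀ u u', HasDerivFib u u' t → HasDerivFib (fun s => T s (u s)) (T t u' + T' (u t)) t

theorem HasDerivFib.add {u v : ℝ → Fib E} {u' v' : Fib E} {t : ℝ} (hu : HasDerivFib u u' t)
    (hv : HasDerivFib v v' t) : HasDerivFib (fun s => u s + v s) (u' + v') t :=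
  fun k => (hu k).add (hv k)

theorem HasDerivFib.sum {ι : Type*} {F : Finset ι} {u : ι → ℝ → Fib E} {u' : ι → Fib E} {t : ℝ}
    (hu : ∀ i, HasDerivFib (u i) (u' i) t) :
    HasDerivFib (fun s => ∑ i ∈ F, u i s) (∑ i ∈ F, u' i) t := fun k => by
  simp only [Finset.sum_apply]
  exact HasDerivAt.fun_sum fun i _ => hu i k

theorem HasDerivFib.smul {u : ℝ → Fib E} {u' : Fib E} {t : ℝ} {f : ℝ → ℂ} {f' : ℂ}
    (hf : HasDerivAt f f' t) (hu : HasDerivFib u u' t) :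
    HasDerivFib (fun s => f s • u s) (f t • u' + f' • u t) t :=
  fun k => hf.smul (hu k)

theorem HasDerivFib.unique {u : ℝ → Fib E} {u' u'' : Fib E} {t : ℝ} (hu : HasDerivFib u u' t)
    (hu' : HasDerivFib u u'' t) : u' = u'' := funext fun k => (hu k).unique (hu' k)

theorem HasDerivOp.add {S T : ℝ → Op E} {S' T' : Op E} {t : ℝ} (hS : HasDerivOp S S' t)
    (hT : HasDerivOp T T' t) : HasDerivOp (fun s => S s + T s) (S' + T') t := fun u u' hu => by
  have h := (hS u u' hu).add (hT u u' hu)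
  simp only [Op.add_apply]
  convert h using 1
  abel

theorem HasDerivOp.sum {ι : Type*} {F : Finset ι} {T : ι → ℝ → Op E} {T' : ι → Op E} {t : ℝ}
    (hT : ∀ i, HasDerivOp (T i) (T' i) t) :
    HasDerivOp (fun s => ∑ i ∈ F, T i s) (∑ i ∈ F, T' i) t := fun u u' hu => by
  simp only [Op.sum_apply, ← Finset.sum_add_distrib]
  exact HasDerivFib.sum fun i => hT i u u' hu

theorem HasDerivOp.mul {S T : ℝ → Op E} {S' T' : Op E} {t : ℝ} (hS : HasDerivOp S S' t)
    (hT : HasDerivOp T T' t) :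
    HasDerivOp (fun s => S s * T s) (S' * T t + S t * T') t := fun u u' hu => by
  have h := hS _ _ (hT u u' hu)
  simp only [Op.add_apply, Op.mul_apply]
  convert h using 1
  rw [map_add]
  abel

theorem HasDerivOp.smul {T : ℝ → Op E} {T' : Op E} {t : ℝ} {f : ℝ → ℂ} {f' : ℂ}
    (hf : HasDerivAt f f' t) (hT : HasDerivOp T T' t) :
    HasDerivOp (fun s => f s • T s) (f t • T' + f' • T t) t := fun u u' hu => by
  have h := HasDerivFib.smul hf (hT u u' hu)
  simp only [Op.add_apply, Op.smul_apply]
  convert h using 1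
  module

theorem SmoothFib.smul {u : E → Fib E} {U : Set E} {f : E → ℂ} (hf : ContDiffOn ℝ ∞ f U)
    (hu : SmoothFib u U) : SmoothFib (fun y => f y • u y) U := fun k => hf.smul (hu k)

theorem SmoothFib.sum {ι : Type*} {F : Finset ι} {u : ι → E → Fib E} {U : Set E}
    (hu : ∀ i, SmoothFib (u i) U) : SmoothFib (fun y => ∑ i ∈ F, u i y) U := fun k => by
  simp only [Finset.sum_apply]
  exact ContDiffOn.sum fun i _ => hu i k

theorem SmoothOp.mul {S T : E → Op E} {U : Set E} (hS : SmoothOp S U) (hT : SmoothOp T U) :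
    SmoothOp (fun y => S y * T y) U := fun u hu => hS _ (hT u hu)

theorem SmoothOp.smul {T : E → Op E} {U : Set E} {f : E → ℂ} (hf : ContDiffOn ℝ ∞ f U)
    (hT : SmoothOp T U) : SmoothOp (fun y => f y • T y) U := fun u hu => (hT u hu).smul hf

theorem SmoothOp.sum {ι : Type*} {F : Finset ι} {T : ι → E → Op E} {U : Set E}
    (hT : ∀ i, SmoothOp (T i) U) : SmoothOp (fun y => ∑ i ∈ F, T i y) U := fun u hu => by
  simp only [Op.sum_apply]
  exact SmoothFib.sum fun i => hT i u hu

theorem smoothOp_one (U : Set E) : SmoothOp (fun _ => (1 : Op E)) U := fun _ hu => hu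

theorem contDiffOn_linear {V W : Type*} [NormedAddCommGroup V] [NormedSpace ℝ V]
    [FiniteDimensional ℝ V] [NormedAddCommGroup W] [NormedSpace ℝ W] (L : V →ₗ[ℝ] W)
    {f : E → V} {U : Set E} (hf : ContDiffOn ℝ ∞ f U) :
    ContDiffOn ℝ ∞ (fun y => L (f y)) U :=
  (LinearMap.toContinuousLinearMap L).contDiff.comp_contDiffOn hf

theorem hasDerivAt_linear {V W : Type*} [NormedAddCommGroup V] [NormedSpace ℝ V]
    [FiniteDimensional ℝ V] [NormedAddCommGroup W] [NormedSpace ℝ W] (L : V →ₗ[ℝ] W)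
    {f : ℝ → V} {f' : V} {t : ℝ} (hf : HasDerivAt f f' t) :
    HasDerivAt (fun s => L (f s)) (L f') t :=
  (LinearMap.toContinuousLinearMap L).hasFDerivAt.comp_hasDerivAt t hf

variable [FiniteDimensional ℂ E]

instance finiteDimensional_alt (k : ℕ) : FiniteDimensional ℝ (Alt E k) := by
  let f : Alt E k →ₗ[ℝ] MultilinearMap ℝ (fun _ : Fin k => E) ℂ :=
    { toFun := fun α => α.toMultilinearMap
      map_add' := fun _ _ => rfl
      map_smul' := fun _ _ => rfl }
  refine FiniteDimensional.of_injective f fun α β h => ?_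
  ext v
  exact congrArg (fun m : MultilinearMap ℝ (fun _ : Fin k => E) ℂ => m v) h

theorem smoothOp_eps_const (ξ : E →L[ℝ] ℂ) (U : Set E) :
    SmoothOp (fun _ => (eps ξ : Op E)) U := fun u hu k => by
  cases k with
  | zero => simp only [eps_apply_zero]; exact contDiffOn_const
  | succ k => exact contDiffOn_linear (oneWedgeL ξ k) (hu k)

theorem smoothOp_ins (v : E) (U : Set E) : SmoothOp (fun _ => (ins v : Op E)) U :=
  fun _ hu k => contDiffOn_linear (curryLeftL v k) (hu (k + 1))

theorem hasDerivOp_eps (ξ : E →L[ℝ] ℂ) (t : ℝ) :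
    HasDerivOp (fun _ => (eps ξ : Op E)) 0 t := fun u u' hu k => by
  rw [Op.zero_apply, add_zero]
  cases k with
  | zero => simp only [eps_apply_zero]; exact hasDerivAt_const _ _
  | succ k => exact hasDerivAt_linear (oneWedgeL ξ k) (hu k)

theorem hasDerivOp_ins (v : E) (t : ℝ) : HasDerivOp (fun _ => (ins v : Op E)) 0 t :=
  fun u u' hu k => by
    rw [Op.zero_apply, add_zero]
    exact hasDerivAt_linear (curryLeftL v k) (hu (k + 1))

end Sections

/-! ### Variation of the metric: derivatives of Λ, of the inner product and of the volume density -/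

section MetricCalculus

variable {E : Type*} [NormedAddCommGroup E] [NormedSpace ℂ E]

theorem contDiffOn_ofReal {f : E → ℝ} {U : Set E} (hf : ContDiffOn ℝ ∞ f U) :
    ContDiffOn ℝ ∞ (fun y => (f y : ℂ)) U := Complex.ofRealCLM.contDiff.comp_contDiffOn hf

theorem contDiffOn_conj {f : E → ℂ} {U : Set E} (hf : ContDiffOn ℝ ∞ f U) :
    ContDiffOn ℝ ∞ (fun y => conj (f y)) U :=
  (Complex.conjCLE : ℂ →L[ℝ] ℂ).contDiff.comp_contDiffOn hf

theorem curryLeft_curryLeft_swap {k : ℕ} (α : Alt E (k + 2)) (v u : E) :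
    (α.curryLeft v).curryLeft u = -(α.curryLeft u).curryLeft v := by
  have h := congrArg (fun T : Op E => T (Pi.single (k + 2) α) k) (ins_mul_ins u v)
  simpa [Op.mul_apply, Op.neg_apply, ins_apply] using h

variable [FiniteDimensional ℂ E]

theorem hasDerivAt_gram {w : ℝ → Alt E 2} {h : Alt E 2} {t : ℝ} (hw : HasDerivAt w h t)
    (a b : Fin (Module.finrank ℝ E)) :
    HasDerivAt (fun s => gram (w s) a b) (gram h a b) t :=
  hasDerivAt_linear (Complex.reLm.comp (evalL ![realBasis E a, Complex.I • realBasis E b])) hw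

theorem contDiffOn_gram {w : E → Alt E 2} {U : Set E} (hw : ContDiffOn ℝ ∞ w U)
    (a b : Fin (Module.finrank ℝ E)) : ContDiffOn ℝ ∞ (fun y => gram (w y) a b) U :=
  contDiffOn_linear (Complex.reLm.comp (evalL ![realBasis E a, Complex.I • realBasis E b])) hw

theorem contDiffOn_gram_inv {w : E → Alt E 2} {U : Set E} (hw : ContDiffOn ℝ ∞ w U)
    (hU : ∀ y ∈ U, IsHerm (w y)) (a b : Fin (Module.finrank ℝ E)) :
    ContDiffOn ℝ ∞ (fun y => (gram (w y))⁻¹ a b) U :=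
  contDiffOn_inv (contDiffOn_gram hw) (fun y hy => (hU y hy).isUnit_det) a b

theorem ins_fr (w : Alt E 2) (a : Fin (Module.finrank ℝ E)) :
    (ins (fr w a) : Op E) = ∑ b, ((gram w)⁻¹ a b : ℂ) • ins (realBasis E b) := by
  simp only [fr, map_sum, LinearMap.map_smul, Complex.coe_smul]

theorem smoothOp_ins_fr {w : E → Alt E 2} {U : Set E} (hw : ContDiffOn ℝ ∞ w U)
    (hU : ∀ y ∈ U, IsHerm (w y)) (a : Fin (Module.finrank ℝ E)) :
    SmoothOp (fun y => (ins (fr (w y) a) : Op E)) U := by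
  simp only [ins_fr]
  exact SmoothOp.sum fun b =>
    (smoothOp_ins _ U).smul (contDiffOn_ofReal (contDiffOn_gram_inv hw hU a b))

theorem smoothOp_lam {w : E → Alt E 2} {U : Set E} (hw : ContDiffOn ℝ ∞ w U)
    (hU : ∀ y ∈ U, IsHerm (w y)) : SmoothOp (fun y => lam (w y)) U :=
  (SmoothOp.sum fun _ => (smoothOp_ins _ U).mul (smoothOp_ins_fr hw hU _)).smul contDiffOn_const

theorem smoothOp_eps {ξ : E → E →L[ℝ] ℂ} {U : Set E}
    (hξ : ∀ v, ContDiffOn ℝ ∞ (fun y => ξ y v) U) : SmoothOp (fun y => (eps (ξ y) : Op E)) U := by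
  have h : ∀ y, (eps (ξ y) : Op E) = ∑ a, ξ y (realBasis E a) • eps (coord a) := fun y => by
    conv_lhs => rw [← sum_coord_smul (ξ y)]
    simp only [map_sum, map_smul]
  simp only [h]
  exact SmoothOp.sum fun a => (smoothOp_eps_const _ U).smul (hξ _)

theorem smoothOp_wd (p : ℕ) {ρ : E → Alt E p} {U : Set E} (hρ : ContDiffOn ℝ ∞ ρ U) :
    SmoothOp (fun y => wd p (ρ y)) U := by
  induction p with
  | zero =>
    have h1 : ContDiffOn ℝ ∞ (fun y => ρ y 0) U := contDiffOn_linear (evalL 0) hρ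
    simp only [wd_zero]
    exact SmoothOp.smul (f := fun y => ρ y 0) (T := fun _ => 1) h1 (smoothOp_one U)
  | succ p ih =>
    simp only [wd_succ]
    have h1 (a : Fin (Module.finrank ℝ E)) :
        SmoothOp (fun y => wd p ((ρ y).curryLeft (realBasis E a))) U :=
      ih (contDiffOn_linear (curryLeftL _ p) hρ)
    exact (SmoothOp.sum fun a => (smoothOp_eps_const _ U).mul (h1 a)).smul contDiffOn_const

theorem smoothOp_contr {w : E → Alt E 2} {U : Set E} (hw : ContDiffOn ℝ ∞ w U)
    (hU : ∀ y ∈ U, IsHerm (w y)) (p : ℕ) {ρ : E → Alt E p} (hρ : ContDiffOn ℝ ∞ ρ U) :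
    SmoothOp (fun y => contr (w y) p (ρ y)) U := by
  induction p with
  | zero =>
    have h1 : ContDiffOn ℝ ∞ (fun y => ρ y 0) U := contDiffOn_linear (evalL 0) hρ
    simp only [contr]
    exact SmoothOp.smul (f := fun y => conj (ρ y 0)) (T := fun _ => 1) (contDiffOn_conj h1)
      (smoothOp_one U)
  | succ p ih =>
    simp only [contr]
    have h1 (a : Fin (Module.finrank ℝ E)) :
        SmoothOp (fun y => contr (w y) p ((ρ y).curryLeft (realBasis E a))) U :=
      ih (contDiffOn_linear (curryLeftL _ p) hρ)
    exact (SmoothOp.sum fun a => (h1 a).mul (smoothOp_ins_fr hw hU a)).smul contDiffOn_const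

theorem contDiffOn_altInner {w : E → Alt E 2} {U : Set E} (hw : ContDiffOn ℝ ∞ w U)
    (hU : ∀ y ∈ U, IsHerm (w y)) {k : ℕ} {α β : E → Alt E k} (hα : ContDiffOn ℝ ∞ α U)
    (hβ : ContDiffOn ℝ ∞ β U) : ContDiffOn ℝ ∞ (fun y => altInner (w y) (α y) (β y)) U := by
  refine contDiffOn_const.mul (ContDiffOn.sum fun I _ => ContDiffOn.sum fun J _ => ?_)
  refine ((contDiffOn_ofReal (contDiffOn_prod fun l _ => contDiffOn_gram_inv hw hU _ _)).mul
    (contDiffOn_linear (evalL _) hα)).mul (contDiffOn_conj (contDiffOn_linear (evalL _) hβ))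

theorem contDiffOn_ip {w : E → Alt E 2} {U : Set E} (hw : ContDiffOn ℝ ∞ w U)
    (hU : ∀ y ∈ U, IsHerm (w y)) {u v : E → Fib E} (hu : SmoothFib u U) (hv : SmoothFib v U) :
    ContDiffOn ℝ ∞ (fun y => ip (w y) (u y) (v y)) U :=
  ContDiffOn.sum fun k _ => contDiffOn_altInner hw hU (hu k) (hv k)

theorem IsHerm.det_pos {w : Alt E 2} (hw : IsHerm w) : 0 < (gram w).det := hw.gram_posDef.det_pos

theorem contDiffOn_sqrt_det {w : E → Alt E 2} {U : Set E} (hw : ContDiffOn ℝ ∞ w U)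
    (hU : ∀ y ∈ U, IsHerm (w y)) : ContDiffOn ℝ ∞ (fun y => √(gram (w y)).det) U :=
  (contDiffOn_det (contDiffOn_gram hw)).sqrt fun y hy => (hU y hy).det_pos.ne'

section Path

variable {w : ℝ → Alt E 2} {h : Alt E 2} {t : ℝ} (hd : HasDerivAt w h t) (hw : IsHerm (w t))
include hd hw

theorem hasDerivAt_gram_inv (a b : Fin (Module.finrank ℝ E)) :
    HasDerivAt (fun s => (gram (w s))⁻¹ a b) (-metr h (fr (w t) a) (fr (w t) b)) t := by
  refine (hasDerivAt_inv (hasDerivAt_gram hd) hw.isUnit_det a b).congr_deriv ?_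
  congr 1
  simp only [fr, map_sum, map_smul, LinearMap.sum_apply, LinearMap.smul_apply, smul_eq_mul,
    Matrix.mul_apply, gram_apply, Finset.sum_mul]
  refine Finset.sum_congr rfl fun c _ => ?_
  rw [Finset.mul_sum]
  refine Finset.sum_congr rfl fun d _ => ?_
  rw [hw.gram_inv_symm c b]
  ring

theorem hasDerivOp_ins_fr (a : Fin (Module.finrank ℝ E)) :
    HasDerivOp (fun s => (ins (fr (w s) a) : Op E))
      (-∑ b, (metr h (fr (w t) a) (fr (w t) b) : ℂ) • ins (realBasis E b)) t := by
  have h0 : (fun s => (ins (fr (w s) a) : Op E)) = fun s =>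
      ∑ b, ((gram (w s))⁻¹ a b : ℂ) • ins (realBasis E b) := funext fun s => ins_fr (w s) a
  rw [h0]
  have h1 := HasDerivOp.sum (F := Finset.univ) fun b =>
    HasDerivOp.smul (hasDerivAt_gram_inv hd hw a b).ofReal_comp
      (hasDerivOp_ins (realBasis E b) t)
  convert h1 using 1
  rw [← Finset.sum_neg_distrib]
  refine Finset.sum_congr rfl fun b _ => ?_
  push_cast
  module

/-- Only the dual frame in Λ varies, with the inverse metric, whose derivative is -g⁻¹ h g⁻¹;
`contr_two` recognises the result. -/
theorem hasDerivOp_lam (hh : IsRealOneOne h) :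
    HasDerivOp (fun s => lam (w s)) (-contr (w t) 2 h) t := by
  have h1 := HasDerivOp.smul (hasDerivAt_const t (2 : ℂ)⁻¹) <|
    HasDerivOp.sum (F := Finset.univ) fun a =>
      (hasDerivOp_ins (Complex.I • realBasis E a) t).mul (hasDerivOp_ins_fr hd hw a)
  convert h1 using 1
  · rfl
  rw [hw.contr_two hh, zero_smul, add_zero, ← smul_neg, ← Finset.sum_neg_distrib]
  congr 1
  refine Finset.sum_congr rfl fun a _ => ?_
  rw [zero_mul, zero_add, mul_neg, Finset.mul_sum]
  congr 1
  refine Finset.sum_congr rfl fun b _ => ?_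
  rw [mul_smul_comm, hh.ofReal_metr]

/-- By Jacobi's formula the logarithmic derivative of √det is half the trace of g⁻¹ h, which is the
scalar part of [Λ, h ∧ ·]. -/
theorem hasDerivAt_sqrt_det :
    HasDerivAt (fun s => √(gram (w s)).det)
      (√(gram (w t)).det * (2⁻¹ * ∑ a, metr h (fr (w t) a) (realBasis E a))) t := by
  refine ((hasDerivAt_det (hasDerivAt_gram hd)).sqrt hw.det_pos.ne').congr_deriv ?_
  have h1 : (gram (w t)).adjugate = (gram (w t)).det • (gram (w t))⁻¹ := by
    rw [Matrix.inv_def, smul_smul, Ring.mul_inverse_cancel _ hw.isUnit_det, one_smul]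
  have h2 : ∑ a, metr h (fr (w t) a) (realBasis E a) = ((gram (w t))⁻¹ * gram h).trace := by
    simp only [Matrix.trace, Matrix.diag_apply, Matrix.mul_apply, fr, map_sum, map_smul,
      LinearMap.sum_apply, LinearMap.smul_apply, smul_eq_mul, gram_apply]
  have h3 : √(gram (w t)).det ≠ 0 := (Real.sqrt_pos.2 hw.det_pos).ne'
  rw [h1, h2, Matrix.smul_mul, Matrix.trace_smul, smul_eq_mul]
  field_simp
  rw [Real.sq_sqrt hw.det_pos.le, mul_comm]

end Path

/-- The pairing `∑ h (f_a, i f_b) ⟨ι_a α, ι_b β⟩`, where `(f_a)` is the dual frame. -/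
def varInner (w h : Alt E 2) : (k : ℕ) → Alt E k → Alt E k → ℂ
  | 0, _, _ => 0
  | _ + 1, α, β => ∑ a, ∑ b, (metr h (fr w a) (fr w b) : ℂ) *
      altInner w (α.curryLeft (realBasis E a)) (β.curryLeft (realBasis E b))

theorem varInner_succ (w h : Alt E 2) {k : ℕ} (α β : Alt E (k + 1)) :
    varInner w h (k + 1) α β = ∑ a, ∑ b, (metr h (fr w a) (fr w b) : ℂ) *
      altInner w (α.curryLeft (realBasis E a)) (β.curryLeft (realBasis E b)) := rfl

theorem altInner_neg_neg (w : Alt E 2) {k : ℕ} (α β : Alt E k) :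
    altInner w (-α) (-β) = altInner w α β := by
  simp only [← altInnerL_apply, map_neg, LinearMap.neg_apply, neg_neg]

theorem sum_sum_comm_sum_sum {ι M : Type*} [Fintype ι] [AddCommMonoid M]
    (F : ι → ι → ι → ι → M) :
    ∑ a, ∑ b, ∑ c, ∑ d, F a b c d = ∑ c, ∑ d, ∑ a, ∑ b, F a b c d := by
  have h (a : ι) : ∑ b, ∑ c, ∑ d, F a b c d = ∑ c, ∑ d, ∑ b, F a b c d := by
    rw [Finset.sum_comm]
    exact Finset.sum_congr rfl fun c _ => Finset.sum_comm
  simp only [h]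
  rw [Finset.sum_comm]
  exact Finset.sum_congr rfl fun c _ => Finset.sum_comm

/-- In `varInner` the variation occupies one slot of the contraction. Contracting another slot first
gives the same sum, since exchanging the two contractions changes the sign in both arguments. -/
theorem sum_varInner_curryLeft (w h : Alt E 2) {k : ℕ} (α β : Alt E (k + 1)) :
    ∑ a, ∑ b, ((gram w)⁻¹ a b : ℂ) *
        varInner w h k (α.curryLeft (realBasis E a)) (β.curryLeft (realBasis E b)) =
      k * varInner w h (k + 1) α β := by
  cases k with
  | zero => simp [varInner]
  | succ k =>
    simp only [varInner, Finset.mul_sum]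
    rw [sum_sum_comm_sum_sum]
    refine Finset.sum_congr rfl fun c _ => Finset.sum_congr rfl fun d _ => ?_
    rw [altInner_succ_gram, Finset.mul_sum, Finset.mul_sum, Finset.mul_sum]
    refine Finset.sum_congr rfl fun a _ => ?_
    rw [Finset.mul_sum, Finset.mul_sum, Finset.mul_sum]
    refine Finset.sum_congr rfl fun b _ => ?_
    rw [curryLeft_curryLeft_swap _ (realBasis E a), curryLeft_curryLeft_swap _ (realBasis E b),
      altInner_neg_neg]
    have : ((k : ℂ) + 1) ≠ 0 := by exact_mod_cast Nat.succ_ne_zero k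
    push_cast
    field_simp

/-- In the recursion on the degree, the derivative of the inverse metric contributes 1 / (k + 1) of
the variation, and the induction hypothesis contributes the remaining k / (k + 1) by
`sum_varInner_curryLeft`. -/
theorem hasDerivAt_altInner {w : ℝ → Alt E 2} {h : Alt E 2} {t : ℝ} (hd : HasDerivAt w h t)
    (hw : IsHerm (w t)) : ∀ {k : ℕ} {α β : ℝ → Alt E k} {α' β' : Alt E k},
    HasDerivAt α α' t → HasDerivAt β β' t →
    HasDerivAt (fun s => altInner (w s) (α s) (β s))
      (altInner (w t) α' (β t) + altInner (w t) (α t) β' - varInner (w t) h k (α t) (β t)) t := by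
  intro k
  induction k with
  | zero =>
    intro α β α' β' hα hβ
    simp only [altInner_zero_degree, varInner, sub_zero]
    exact (hasDerivAt_linear (evalL 0) hα).mul
      (hasDerivAt_linear (Complex.conjAe.toLinearMap.comp (evalL 0)) hβ)
  | succ k ih =>
    intro α β α' β' hα hβ
    simp only [altInner_succ_gram (w _) (α _)]
    have h1 (a b : Fin (Module.finrank ℝ E)) :
        HasDerivAt (fun s => ((gram (w s))⁻¹ a b : ℂ) *
            altInner (w s) ((α s).curryLeft (realBasis E a)) ((β s).curryLeft (realBasis E b)))
          (((-metr h (fr (w t) a) (fr (w t) b) : ℝ) : ℂ) *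
              altInner (w t) ((α t).curryLeft (realBasis E a)) ((β t).curryLeft (realBasis E b)) +
            ((gram (w t))⁻¹ a b : ℂ) *
              (altInner (w t) (α'.curryLeft (realBasis E a)) ((β t).curryLeft (realBasis E b)) +
                altInner (w t) ((α t).curryLeft (realBasis E a)) (β'.curryLeft (realBasis E b)) -
                varInner (w t) h k ((α t).curryLeft (realBasis E a))
                  ((β t).curryLeft (realBasis E b)))) t :=
      (hasDerivAt_gram_inv hd hw a b).ofReal_comp.mul
        (ih (hasDerivAt_linear (curryLeftL (realBasis E a) k) hα)
          (hasDerivAt_linear (curryLeftL (realBasis E b) k) hβ))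
    have h2 := (HasDerivAt.fun_sum (u := Finset.univ) fun a _ =>
      HasDerivAt.fun_sum (u := Finset.univ) fun b _ => h1 a b).const_mul ((k : ℂ) + 1)⁻¹
    refine h2.congr_deriv ?_
    have h3 : (k : ℂ) + 1 ≠ 0 := by exact_mod_cast Nat.succ_ne_zero k
    have h4 : varInner (w t) h (k + 1) (α t) (β t) = ((k : ℂ) + 1)⁻¹ *
        (∑ a, ∑ b, ((gram (w t))⁻¹ a b : ℂ) * varInner (w t) h k
          ((α t).curryLeft (realBasis E a)) ((β t).curryLeft (realBasis E b)) +
          varInner (w t) h (k + 1) (α t) (β t)) := by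
      rw [sum_varInner_curryLeft]
      field_simp
    rw [h4, altInner_succ_gram (w t) α', ← mul_add, ← mul_sub]
    congr 1
    simp only [varInner_succ, ← Finset.sum_add_distrib, ← Finset.sum_sub_distrib]
    refine Finset.sum_congr rfl fun a _ => Finset.sum_congr rfl fun b _ => ?_
    push_cast
    ring

theorem sum_range_varInner (w h : Alt E 2) (α β : Fib E) :
    ∑ k ∈ Finset.range (Module.finrank ℝ E + 1), varInner w h k (α k) (β k) =
      ∑ a, ∑ b, (metr h (fr w a) (fr w b) : ℂ) *
        ip w (ins (realBasis E a) α) (ins (realBasis E b) β) := by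
  rw [Finset.sum_range_succ']
  simp only [varInner, add_zero, ip, Finset.sum_range_succ _ (Module.finrank ℝ E)]
  have h1 (a b : Fin (Module.finrank ℝ E)) :
      altInner w (ins (realBasis E a) α (Module.finrank ℝ E))
        (ins (realBasis E b) β (Module.finrank ℝ E)) = 0 := by
    have : (ins (realBasis E a) α (Module.finrank ℝ E)) = 0 := by
      rw [ins_apply, subsingleton_alt (Nat.lt_succ_self _) (α _)]
      rfl
    rw [this, ← altInnerL_apply, map_zero, LinearMap.zero_apply]
  simp only [h1, add_zero]
  simp only [ins_apply, Finset.mul_sum]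
  rw [Finset.sum_comm]
  exact Finset.sum_congr rfl fun a _ => Finset.sum_comm

/-- The half trace of `lam_mul_wd_two` is the logarithmic derivative of the volume density. Its
derivation term, with the exterior factor transposed, is minus the pairing that measures the
variation of the inner product. -/
theorem IsHerm.ip_commutator {w h : Alt E 2} (hw : IsHerm w) (hh : IsRealOneOne h)
    (α β : Fib E) : ip w ((lam w * wd 2 h - wd 2 h * lam w) α) β =
      ((2⁻¹ * ∑ a, metr h (fr w a) (realBasis E a) : ℝ) : ℂ) * ip w α β -
        ∑ k ∈ Finset.range (Module.finrank ℝ E + 1), varInner w h k (α k) (β k) := by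
  have h1 (a : Fin (Module.finrank ℝ E)) : sh w (slotL h (Complex.I • fr w a)) =
      -∑ b, (metr h (fr w a) (fr w b) : ℂ) • (ins (realBasis E b) : Op E) := by
    have h2 := hw.sum_bilin_swap ((LinearMap.lsmul ℝ (Op E)).compl₁₂ (metr h (fr w a)) ins)
    simp only [LinearMap.compl₁₂_apply, LinearMap.lsmul_apply, ← Complex.coe_smul] at h2
    rw [← h2, sh, ← Finset.sum_neg_distrib]
    refine Finset.sum_congr rfl fun b _ => ?_
    rw [hh.slotL_I, neg_apply, flat_apply, ← hh.ofReal_metr, map_neg, Complex.conj_ofReal, neg_smul]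
  rw [sum_range_varInner, hw.lam_mul_wd_two, add_assoc, add_sub_cancel_left, Op.add_apply,
    Op.smul_apply, Op.one_apply, Op.sum_apply, ip_add_left, ip_smul_left, ip_sum_left,
    sub_eq_add_neg, ← Finset.sum_neg_distrib]
  congr 1
  · congr 1
    simp only [← hh.ofReal_metr]
    push_cast
    rfl
  · refine Finset.sum_congr rfl fun a _ => ?_
    rw [Op.mul_apply, isAdj_eps w, h1, Op.neg_apply, ip_neg_right, Op.sum_apply, ip_sum_right]
    congr 1
    refine Finset.sum_congr rfl fun b _ => ?_
    rw [Op.smul_apply, ip_smul_right, Complex.conj_ofReal]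

/-- The derivative of `√(det g) ⟨u, v⟩` along a path. -/
theorem hasDerivAt_sqrt_det_mul_ip {w : ℝ → Alt E 2} {h : Alt E 2} {t : ℝ}
    (hd : HasDerivAt w h t) (hw : IsHerm (w t)) (hh : IsRealOneOne h) {u v : ℝ → Fib E}
    {u' v' : Fib E} (hu : HasDerivFib u u' t) (hv : HasDerivFib v v' t) :
    HasDerivAt (fun s => (√(gram (w s)).det : ℂ) * ip (w s) (u s) (v s))
      (√(gram (w t)).det * (ip (w t) u' (v t) + ip (w t) (u t) v' +
        ip (w t) ((lam (w t) * wd 2 h - wd 2 h * lam (w t)) (u t)) (v t))) t := by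
  have h1 : HasDerivAt (fun s => ip (w s) (u s) (v s)) (ip (w t) u' (v t) + ip (w t) (u t) v' -
      ∑ k ∈ Finset.range (Module.finrank ℝ E + 1), varInner (w t) h k (u t k) (v t k)) t := by
    refine (HasDerivAt.fun_sum fun k _ => hasDerivAt_altInner hd hw (hu k) (hv k)).congr_deriv ?_
    simp only [Finset.sum_sub_distrib, Finset.sum_add_distrib, ip]
  refine ((hasDerivAt_sqrt_det hd hw).ofReal_comp.mul h1).congr_deriv ?_
  rw [hw.ip_commutator hh]
  push_cast
  ring

end MetricCalculus

/-! ### Bidegrees, the operator θ_s and its derivative in s -/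

section Types

variable {E : Type*} [NormedAddCommGroup E] [NormedSpace ℂ E]

theorem oneWedge_comp {k : ℕ} (ξ : E →L[ℝ] ℂ) (α : Alt E k) (A : E →L[ℝ] E) :
    (oneWedge ξ α).compContinuousLinearMap A =
      oneWedge (ξ.comp A) (α.compContinuousLinearMap A) := by
  ext v
  simp only [ContinuousAlternatingMap.compContinuousLinearMap_apply, oneWedge_apply]
  rfl

/-- The form `α` is of bidegree `(p, k - p)`. -/
def HasType {k : ℕ} (p : ℕ) (α : Alt E k) : Prop :=
  p ≤ k ∧ ∀ z : ℂ, α.compContinuousLinearMap (mulCLM E z) = (z ^ p * conj z ^ (k - p)) • α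

theorem apply_smul_eq (ξ : E →L[ℝ] ℂ) (z : ℂ) (v : E) :
    ξ (z • v) = z.re * ξ v + z.im * ξ (Complex.I • v) := by
  have h : z • v = z.re • v + z.im • (Complex.I • v) := by
    rw [← Complex.coe_smul, ← Complex.coe_smul, smul_smul, ← add_smul, Complex.re_add_im]
  rw [h, map_add, map_smul, map_smul, Complex.real_smul, Complex.real_smul]

theorem apply_I_smul_smul_eq (ξ : E →L[ℝ] ℂ) (z : ℂ) (v : E) :
    ξ (Complex.I • z • v) = z.re * ξ (Complex.I • v) - z.im * ξ v := by
  rw [smul_comm, apply_smul_eq, smul_smul, Complex.I_mul_I, neg_one_smul, map_neg]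
  ring

theorem holOne_comp_mulCLM (ξ : E →L[ℝ] ℂ) (z : ℂ) :
    (holOne ξ).comp (mulCLM E z) = z • holOne ξ := by
  ext v
  change holOne ξ (z • v) = z * holOne ξ v
  rw [holOne_apply, holOne_apply, apply_smul_eq, apply_I_smul_smul_eq]
  conv_rhs => rw [← Complex.re_add_im z]
  linear_combination ((2 : ℂ)⁻¹ * z.im * ξ (Complex.I • v)) * Complex.I_mul_I

theorem antiOne_comp_mulCLM (ξ : E →L[ℝ] ℂ) (z : ℂ) :
    (antiOne ξ).comp (mulCLM E z) = conj z • antiOne ξ := by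
  ext v
  have hz : conj z = z.re - z.im * Complex.I := by
    apply Complex.ext <;> simp
  change antiOne ξ (z • v) = conj z * antiOne ξ v
  rw [antiOne_apply, antiOne_apply, apply_smul_eq, apply_I_smul_smul_eq, hz]
  linear_combination ((2 : ℂ)⁻¹ * z.im * ξ (Complex.I • v)) * Complex.I_mul_I

theorem HasType.holOne_wedge {k p : ℕ} {α : Alt E k} (h : HasType p α) (ξ : E →L[ℝ] ℂ) :
    HasType (p + 1) (oneWedge (holOne ξ) α) := by
  refine ⟨Nat.succ_le_succ h.1, fun z => ?_⟩
  rw [oneWedge_comp, h.2, holOne_comp_mulCLM, oneWedge_smul_left, oneWedge_smul_right, smul_smul,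
    Nat.add_sub_add_right, pow_succ]
  congr 1
  ring

theorem HasType.antiOne_wedge {k p : ℕ} {α : Alt E k} (h : HasType p α) (ξ : E →L[ℝ] ℂ) :
    HasType p (oneWedge (antiOne ξ) α) := by
  refine ⟨h.1.trans (Nat.le_succ k), fun z => ?_⟩
  rw [oneWedge_comp, h.2, antiOne_comp_mulCLM, oneWedge_smul_left, oneWedge_smul_right, smul_smul,
    Nat.succ_sub h.1, pow_succ]
  congr 1
  ring

theorem hasType_zero (α : Alt E 0) : HasType 0 α := by
  refine ⟨le_rfl, fun z => ?_⟩
  ext v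
  simp only [ContinuousAlternatingMap.compContinuousLinearMap_apply, pow_zero, Nat.sub_self,
    mul_one, one_smul]
  congr 1
  exact Subsingleton.elim _ _

/-- On bidegree (p, k - p) the pull-back by exp(it) is the multiplication by exp(i(2p - k)t), so the
defining sum is the geometric sum of the powers of ζ = exp(2πi(p - q)/(k + 1)). As p and q lie
between 0 and k, ζ = 1 only if p = q; otherwise ζ is a nontrivial (k + 1)-st root of unity and the
sum vanishes. -/
theorem HasType.typePart {k p : ℕ} {α : Alt E k} (h : HasType p α) (q : ℕ) :
    typePart q α = if q = p then α else 0 := by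
  rw [TwistedForms.typePart]
  by_cases hq : q ≤ k
  swap
  · rw [if_neg hq, if_neg]
    rintro rfl
    exact hq h.1
  rw [if_pos hq]
  have hk : (k : ℂ) + 1 ≠ 0 := by exact_mod_cast Nat.succ_ne_zero k
  set ζ : ℂ := Complex.exp (2 * Real.pi * Complex.I * (((p : ℤ) - q : ℤ) / ((k + 1 : ℕ) : ℂ)))
    with hζ
  have h1 (j : ℕ) : Complex.exp (-((2 * q - k : ℂ) * (Real.pi * j / (k + 1)) * Complex.I)) •
      α.compContinuousLinearMap (mulCLM E (Complex.exp ((Real.pi * j / (k + 1)) * Complex.I))) =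
      ζ ^ j • α := by
    rw [h.2, smul_smul]
    congr 1
    have h2 : conj (Complex.exp ((Real.pi * j / (k + 1)) * Complex.I)) =
        Complex.exp (-((Real.pi * j / (k + 1)) * Complex.I)) := by
      rw [← Complex.exp_conj]
      congr 1
      simp
    rw [h2, ← Complex.exp_nat_mul, ← Complex.exp_nat_mul, ← Complex.exp_add, ← Complex.exp_add, hζ,
      ← Complex.exp_nat_mul, Nat.cast_sub h.1]
    congr 1
    push_cast
    field_simp
    ring
  simp only [h1]
  rw [← Finset.sum_smul, smul_smul]
  split_ifs with hqp
  · have : ζ = 1 := by rw [hζ, hqp]; simp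
    rw [this]
    simp only [one_pow, Finset.sum_const, Finset.card_range, nsmul_eq_mul, mul_one]
    push_cast
    rw [inv_mul_cancel₀ hk, one_smul]
  · have hζ1 : ζ ≠ 1 := by
      rw [hζ, Ne, Complex.exp_eq_one_iff]
      rintro ⟨m, hm⟩
      have h3 : (2 * Real.pi * Complex.I : ℂ) ≠ 0 := Complex.two_pi_I_ne_zero
      rw [mul_comm (m : ℂ)] at hm
      have h4 := mul_left_cancel₀ h3 hm
      have hk' : ((k + 1 : ℕ) : ℂ) ≠ 0 := by exact_mod_cast Nat.succ_ne_zero k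
      rw [div_eq_iff hk'] at h4
      have h5 : (p : ℤ) - q = m * (k + 1 : ℕ) := by exact_mod_cast h4
      have h6 := h.1
      have h7 : ((k + 1 : ℕ) : ℤ) ∣ (p : ℤ) - q := ⟨m, by rw [h5]; ring⟩
      have h8 := Int.eq_zero_of_abs_lt_dvd h7 (by rw [abs_lt]; constructor <;> push_cast <;> omega)
      omega
    have h9 : ζ ^ (k + 1) = 1 := by
      rw [hζ, ← Complex.exp_nat_mul, Complex.exp_eq_one_iff]
      refine ⟨(p : ℤ) - q, ?_⟩
      push_cast
      field_simp
    have h10 : ∑ j ∈ Finset.range (k + 1), ζ ^ j = 0 := by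
      rw [geom_sum_eq hζ1, h9, sub_self, zero_div]
    rw [h10, mul_zero, alt_zero_smul]

theorem typePart_add {k : ℕ} (p : ℕ) (α β : Alt E k) :
    typePart p (α + β) = typePart p α + typePart p β := by
  unfold typePart
  split_ifs
  · ext v
    simp only [ContinuousAlternatingMap.compContinuousLinearMap_apply,
      ContinuousAlternatingMap.smul_apply, ContinuousAlternatingMap.sum_apply,
      ContinuousAlternatingMap.add_apply, smul_eq_mul, mul_add, Finset.sum_add_distrib]
  · rw [add_zero]

theorem typePart_smul {k : ℕ} (p : ℕ) (c : ℂ) (α : Alt E k) :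
    typePart p (c • α) = c • typePart p α := by
  unfold typePart
  split_ifs
  · ext v
    simp only [ContinuousAlternatingMap.compContinuousLinearMap_apply,
      ContinuousAlternatingMap.smul_apply, ContinuousAlternatingMap.sum_apply,
      smul_eq_mul, mul_left_comm _ c, Finset.mul_sum]
  · rw [alt_smul_zero]

theorem typePart_zero {k : ℕ} (p : ℕ) : typePart p (0 : Alt E k) = 0 := by
  have h := typePart_smul p 0 (0 : Alt E k)
  rwa [alt_zero_smul, alt_zero_smul] at h

theorem typePart_eq_zero {k p : ℕ} (h : k < p) (α : Alt E k) : typePart p α = 0 :=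
  if_neg (not_le.2 h)

theorem typePart_comp {k : ℕ} (p : ℕ) (α : Alt E k) {A : E →L[ℝ] E}
    (hA : ∀ (z : ℂ) v, A (z • v) = z • A v) :
    (typePart p α).compContinuousLinearMap A = typePart p (α.compContinuousLinearMap A) := by
  unfold typePart
  split_ifs
  · ext v
    simp only [ContinuousAlternatingMap.compContinuousLinearMap_apply,
      ContinuousAlternatingMap.smul_apply, ContinuousAlternatingMap.sum_apply]
    congr 1
    refine Finset.sum_congr rfl fun j _ => ?_
    congr 2
    funext i
    exact (hA _ _).symm
  · rfl

/-- The operator `θ_s`, that multiplies the forms of bidegree `(p, q)` by `s ^ p`. -/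
def thetaOp (s : ℂ) : Op E := Op.of
  { toFun := fun α k => ∑ p ∈ Finset.range (k + 1), s ^ p • typePart p (α k)
    map_add' := fun α β => by
      funext k
      simp only [Pi.add_apply, typePart_add, smul_add, Finset.sum_add_distrib]
    map_smul' := fun c α => by
      funext k
      simp only [Pi.smul_apply, typePart_smul, RingHom.id_apply, Finset.smul_sum]
      exact Finset.sum_congr rfl fun p _ => smul_comm _ _ _ }

theorem thetaOp_apply (s : ℂ) (α : Fib E) (k : ℕ) :
    thetaOp s α k = ∑ p ∈ Finset.range (k + 1), s ^ p • typePart p (α k) := rfl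

/-- The sum of the components of bidegrees `(p, q)` times `p s ^ (p - 1)`. -/
def thetaOp' (s : ℂ) : Op E := Op.of
  { toFun := fun α k => ∑ p ∈ Finset.range (k + 1), (p * s ^ (p - 1)) • typePart p (α k)
    map_add' := fun α β => by
      funext k
      simp only [Pi.add_apply, typePart_add, smul_add, Finset.sum_add_distrib]
    map_smul' := fun c α => by
      funext k
      simp only [Pi.smul_apply, typePart_smul, RingHom.id_apply, Finset.smul_sum]
      exact Finset.sum_congr rfl fun p _ => smul_comm _ _ _ }

theorem thetaOp'_apply (s : ℂ) (α : Fib E) (k : ℕ) :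
    thetaOp' s α k = ∑ p ∈ Finset.range (k + 1), (p * s ^ (p - 1)) • typePart p (α k) := rfl

/-- The form `α` of degree `k`, seen as an element of the fibre. -/
def singleL (k : ℕ) : Alt E k →ₗ[ℂ] Fib E where
  toFun α := Pi.single k α
  map_add' α β := Pi.single_add _ α β
  map_smul' c α := by
    funext m
    rcases eq_or_ne m k with rfl | h
    · simp
    · simp only [Pi.single_eq_of_ne h, RingHom.id_apply, Pi.smul_apply]
      exact (alt_smul_zero c).symm

theorem singleL_self {k : ℕ} (α : Alt E k) : singleL k α k = α := Pi.single_eq_same _ _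

theorem singleL_of_ne {k m : ℕ} (h : m ≠ k) (α : Alt E k) : singleL k α m = 0 :=
  Pi.single_eq_of_ne h α

theorem eps_singleL {k : ℕ} (ξ : E →L[ℝ] ℂ) (α : Alt E k) :
    eps ξ (singleL k α) = singleL (k + 1) (oneWedge ξ α) := by
  funext m
  cases m with
  | zero => rw [eps_apply_zero, singleL_of_ne (Nat.succ_ne_zero k).symm]
  | succ m =>
    rw [eps_apply_succ]
    rcases eq_or_ne m k with rfl | h
    · rw [singleL_self, singleL_self]
    · rw [singleL_of_ne h, singleL_of_ne (by omega)]
      have := oneWedge_smul_right 0 ξ (0 : Alt E m)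
      rwa [alt_zero_smul, alt_zero_smul] at this

theorem HasType.sum_typePart {k p : ℕ} {α : Alt E k} (h : HasType p α) (f : ℕ → ℂ) :
    ∑ q ∈ Finset.range (k + 1), f q • TwistedForms.typePart q α = f p • α := by
  rw [Finset.sum_eq_single p]
  · rw [h.typePart, if_pos rfl]
  · intro q _ hq
    rw [h.typePart, if_neg hq, alt_smul_zero]
  · intro hp
    exact absurd (Finset.mem_range.2 (Nat.lt_succ_of_le h.1)) hp

theorem HasType.thetaOp {k p : ℕ} {α : Alt E k} (h : HasType p α) (s : ℂ) :
    thetaOp s (singleL k α) = singleL k (s ^ p • α) := by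
  funext m
  rw [thetaOp_apply]
  rcases eq_or_ne m k with rfl | hm
  · rw [singleL_self, singleL_self, h.sum_typePart]
  · rw [singleL_of_ne hm, singleL_of_ne hm]
    exact Finset.sum_eq_zero fun q _ => by rw [typePart_zero, alt_smul_zero]

theorem HasType.thetaOp' {k p : ℕ} {α : Alt E k} (h : HasType p α) (s : ℂ) :
    thetaOp' s (singleL k α) = singleL k ((p * s ^ (p - 1)) • α) := by
  funext m
  rw [thetaOp'_apply]
  rcases eq_or_ne m k with rfl | hm
  · rw [singleL_self, singleL_self, h.sum_typePart]
  · rw [singleL_of_ne hm, singleL_of_ne hm]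
    exact Finset.sum_eq_zero fun q _ => by rw [typePart_zero, alt_smul_zero]

variable [FiniteDimensional ℂ E]

/-- Splitting one-forms as ξ' + ξ'' and inducting on the degree, every form is a finite sum of forms
of pure bidegree. This is proved first as an existence statement, because `motive` need not be
stable under products by one-forms. -/
theorem type_induction {motive : ∀ k : ℕ, Alt E k → Prop}
    (add : ∀ k α β, motive k α → motive k β → motive k (α + β))
    (type : ∀ k p α, HasType p α → motive k α) (k : ℕ) (α : Alt E k) : motive k α := by
  have key : ∀ k (α : Alt E k), ∃ (n : ℕ) (β : Fin n → Alt E k),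
      (∀ i, ∃ p, HasType p (β i)) ∧ α = ∑ i, β i := by
    refine alt_induction ?_ ?_ ?_ ?_
    · intro α
      exact ⟨1, fun _ => α, fun _ => ⟨0, hasType_zero α⟩, by simp⟩
    · rintro k α β ⟨n, a, ha, rfl⟩ ⟨m, b, hb, rfl⟩
      refine ⟨n + m, Fin.append a b, fun i => ?_, ?_⟩
      · induction i using Fin.addCases with
        | left i => rw [Fin.append_left]; exact ha i
        | right i => rw [Fin.append_right]; exact hb i
      · rw [Fin.sum_univ_add]
        simp
    · rintro k c α ⟨n, a, ha, rfl⟩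
      refine ⟨n, fun i => c • a i, fun i => ?_, by rw [Finset.smul_sum]⟩
      obtain ⟨p, hp⟩ := ha i
      refine ⟨p, hp.1, fun z => ?_⟩
      rw [smul_comm, ← hp.2]
      rfl
    · rintro k ξ α ⟨n, a, ha, rfl⟩
      refine ⟨n + n, Fin.append (fun i => oneWedge (holOne ξ) (a i))
        (fun i => oneWedge (antiOne ξ) (a i)), fun i => ?_, ?_⟩
      · induction i using Fin.addCases with
        | left i =>
          rw [Fin.append_left]
          obtain ⟨p, hp⟩ := ha i
          exact ⟨_, hp.holOne_wedge ξ⟩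
        | right i =>
          rw [Fin.append_right]
          obtain ⟨p, hp⟩ := ha i
          exact ⟨_, hp.antiOne_wedge ξ⟩
      · rw [Fin.sum_univ_add]
        simp only [Fin.append_left, Fin.append_right]
        rw [← Finset.sum_add_distrib]
        simp only [← oneWedge_add_left, holOne_add_antiOne]
        exact map_sum (oneWedgeL ξ k) _ _
  obtain ⟨n, β, hβ, rfl⟩ := key k α
  have hz : motive k 0 := type k 0 0 ⟨Nat.zero_le k, fun z => by rw [alt_smul_zero]; rfl⟩
  refine Finset.sum_induction _ _ (fun a b => add k a b) hz fun i _ => ?_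
  obtain ⟨p, hp⟩ := hβ i
  exact type k p _ hp

/-- Two operators that agree on the forms of pure bidegree are equal, if each component of their
value depends on finitely many components of the argument. -/
theorem op_ext_type {S T : Op E} (hS : ∀ (α : Fib E) k, ∃ m, S α k = S (singleL m (α m)) k ∧
      T α k = T (singleL m (α m)) k)
    (h : ∀ k p (α : Alt E k), HasType p α → S (singleL k α) = T (singleL k α)) : S = T := by
  refine Op.ext fun α => funext fun k => ?_
  obtain ⟨m, h1, h2⟩ := hS α k
  rw [h1, h2]
  have : S (singleL m (α m)) = T (singleL m (α m)) := by
    refine type_induction (motive := fun k α => S (singleL k α) = T (singleL k α)) ?_ h m (α m)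
    intro k a b ha hb
    rw [map_add, map_add, map_add, ha, hb]
  rw [this]

theorem thetaOp_mul (s t : ℂ) : (thetaOp s * thetaOp t : Op E) = thetaOp (s * t) := by
  refine op_ext_type (fun α k => ⟨k, ?_, ?_⟩) fun k p α hα => ?_
  · simp only [Op.mul_apply, thetaOp_apply, singleL_self]
  · simp only [thetaOp_apply, singleL_self]
  · rw [Op.mul_apply, hα.thetaOp, map_smul, map_smul, hα.thetaOp, hα.thetaOp, ← map_smul, smul_smul,
      mul_pow, mul_comm]

theorem thetaOp_one : (thetaOp 1 : Op E) = 1 := by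
  refine op_ext_type (fun α k => ⟨k, ?_, ?_⟩) fun k p α hα => ?_
  · simp only [thetaOp_apply, singleL_self]
  · simp only [Op.one_apply, singleL_self]
  · rw [hα.thetaOp, one_pow, one_smul, Op.one_apply]

/-- The product by ξ' raises p by one and the product by ξ'' preserves it. -/
theorem thetaOp_mul_eps (s : ℂ) (ξ : E →L[ℝ] ℂ) :
    (thetaOp s * eps ξ : Op E) = eps (s • holOne ξ + antiOne ξ) * thetaOp s := by
  refine Op.ext fun α => funext fun k => ?_
  cases k with
  | zero =>
    rw [Op.mul_apply, Op.mul_apply, eps_apply_zero, thetaOp_apply, eps_apply_zero]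
    exact Finset.sum_eq_zero fun q _ => by rw [typePart_zero, alt_smul_zero]
  | succ k =>
    suffices h : ∀ a : Alt E k, (thetaOp s * eps ξ : Op E) (singleL k a) =
        (eps (s • holOne ξ + antiOne ξ) * thetaOp s : Op E) (singleL k a) by
      have h1 := congrFun (h (α k)) (k + 1)
      simpa only [Op.mul_apply, thetaOp_apply, eps_apply_succ, singleL_self] using h1
    refine type_induction (motive := fun k a => (thetaOp s * eps ξ : Op E) (singleL k a) =
        (eps (s • holOne ξ + antiOne ξ) * thetaOp s : Op E) (singleL k a)) ?_ ?_ k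
    · intro k a b ha hb
      rw [map_add, map_add, map_add, ha, hb]
    · intro k p a ha
      rw [Op.mul_apply, Op.mul_apply, ha.thetaOp, map_smul, map_smul, eps_singleL, eps_singleL]
      conv_lhs => rw [← holOne_add_antiOne ξ, oneWedge_add_left, map_add, map_add,
        (ha.holOne_wedge ξ).thetaOp, (ha.antiOne_wedge ξ).thetaOp]
      rw [oneWedge_add_left, oneWedge_smul_left, map_add, map_smul, map_smul, map_smul, smul_add,
        smul_smul, pow_succ]

theorem thetaOp'_mul_eps_one (ξ : E →L[ℝ] ℂ) :
    (thetaOp' 1 * eps ξ : Op E) = eps ξ * thetaOp' 1 + eps (holOne ξ) := by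
  refine Op.ext fun α => funext fun k => ?_
  cases k with
  | zero =>
    rw [Op.add_apply, Pi.add_apply, Op.mul_apply, Op.mul_apply, eps_apply_zero, eps_apply_zero,
      thetaOp'_apply, eps_apply_zero, add_zero]
    exact Finset.sum_eq_zero fun q _ => by rw [typePart_zero, alt_smul_zero]
  | succ k =>
    suffices h : ∀ a : Alt E k, (thetaOp' 1 * eps ξ : Op E) (singleL k a) =
        (eps ξ * thetaOp' 1 + eps (holOne ξ) : Op E) (singleL k a) by
      have h1 := congrFun (h (α k)) (k + 1)
      simpa only [Op.add_apply, Pi.add_apply, Op.mul_apply, thetaOp'_apply, eps_apply_succ,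
        singleL_self] using h1
    refine type_induction (motive := fun k a => (thetaOp' 1 * eps ξ : Op E) (singleL k a) =
        (eps ξ * thetaOp' 1 + eps (holOne ξ) : Op E) (singleL k a)) ?_ ?_ k
    · intro k a b ha hb
      rw [map_add, map_add, map_add, ha, hb]
    · intro k p a ha
      rw [Op.add_apply, Op.mul_apply, Op.mul_apply, ha.thetaOp', map_smul, map_smul, eps_singleL,
        eps_singleL]
      conv_lhs => rw [← holOne_add_antiOne ξ, oneWedge_add_left, map_add, map_add,
        (ha.holOne_wedge ξ).thetaOp', (ha.antiOne_wedge ξ).thetaOp']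
      conv_rhs => rw [← holOne_add_antiOne ξ, oneWedge_add_left, map_add]
      simp only [holOne_add_antiOne, one_pow, mul_one, map_smul]
      push_cast
      module

/-- Both operators vanish in degree 0 and have the same commutator with the product by any one-form.
-/
theorem thetaOp'_one : (thetaOp' 1 : Op E) = holDeg := by
  refine Op.ext fun α => funext fun k => ?_
  suffices h : ∀ a : Alt E k, (thetaOp' 1 : Op E) (singleL k a) = (holDeg : Op E) (singleL k a) by
    have h1 := congrFun (h (α k)) k
    rw [thetaOp'_apply, singleL_self, ← thetaOp'_apply] at h1
    rw [h1]
    cases k with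
    | zero =>
      simp only [holDeg, Op.sum_apply, Finset.sum_apply, Op.mul_apply, eps_apply_zero]
    | succ k =>
      simp only [holDeg, Op.sum_apply, Finset.sum_apply, Op.mul_apply, eps_apply_succ, ins_apply,
        singleL_self]
  refine alt_induction (motive := fun k a =>
    (thetaOp' 1 : Op E) (singleL k a) = (holDeg : Op E) (singleL k a)) ?_ ?_ ?_ ?_ k
  · intro a
    rw [(hasType_zero a).thetaOp', Nat.cast_zero, zero_mul, alt_zero_smul, map_zero]
    funext m
    cases m with
    | zero =>
      simp only [holDeg, Op.sum_apply, Finset.sum_apply, Op.mul_apply, eps_apply_zero,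
        Finset.sum_const_zero, Pi.zero_apply]
    | succ m =>
      simp only [holDeg, Op.sum_apply, Finset.sum_apply, Op.mul_apply, eps_apply_succ, ins_apply,
        singleL_of_ne (Nat.succ_ne_zero m)]
      refine (Finset.sum_eq_zero fun i _ => ?_).symm
      exact map_zero (oneWedgeL (holOne (coord i)) m)
  · intro k a b ha hb
    rw [map_add, map_add, map_add, ha, hb]
  · intro k c a ha
    rw [map_smul, map_smul, map_smul, ha]
  · intro k ξ a ha
    rw [← eps_singleL, ← Op.mul_apply, ← Op.mul_apply, thetaOp'_mul_eps_one, holDeg_mul_eps,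
      Op.add_apply, Op.add_apply, Op.mul_apply, Op.mul_apply, ha]

/-- The derivative of s^p is p s⁻¹ s^p. It is used with t = η and s = 1/η, where it yields the term
of order zero of D_η. -/
theorem thetaOp_mul_thetaOp' {s t : ℂ} (h : t * s = 1) :
    (thetaOp t * thetaOp' s : Op E) = t • holDeg := by
  rw [← thetaOp'_one]
  refine op_ext_type (fun α k => ⟨k, ?_, ?_⟩) fun k p α hα => ?_
  · simp only [Op.mul_apply, thetaOp_apply, thetaOp'_apply, singleL_self]
  · simp only [Op.smul_apply, Pi.smul_apply, thetaOp'_apply, singleL_self]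
  · rw [Op.mul_apply, Op.smul_apply, hα.thetaOp', map_smul, map_smul, hα.thetaOp, hα.thetaOp',
      ← map_smul, ← map_smul, smul_smul, smul_smul]
    congr 2
    rw [one_pow, mul_one]
    cases p with
    | zero => simp
    | succ p =>
      rw [Nat.add_sub_cancel, pow_succ]
      have h2 : s ^ p * t ^ p = 1 := by rw [← mul_pow, mul_comm, h, one_pow]
      linear_combination ((p + 1 : ℕ) : ℂ) * t * h2

end Types

/-! ### Pull-back of forms by a linear map -/

section Pull

variable {E : Type*} [NormedAddCommGroup E] [NormedSpace ℂ E]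

/-- The pull-back of forms by a linear map. -/
def pull (A : E →L[ℝ] E) : Op E := Op.of
  { toFun := fun α k => (α k).compContinuousLinearMap A
    map_add' := fun _ _ => rfl
    map_smul' := fun _ _ => rfl }

theorem pull_apply (A : E →L[ℝ] E) (α : Fib E) (k : ℕ) :
    pull A α k = (α k).compContinuousLinearMap A := rfl

theorem pull_pull (A B : E →L[ℝ] E) (α : Fib E) : pull A (pull B α) = pull (B.comp A) α := rfl

theorem pull_id (α : Fib E) : pull (ContinuousLinearMap.id ℝ E) α = α := rfl

end Pull

/-! ### Components of forms in charts, and changes of charts -/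

section Charts

variable {E : Type*} [NormedAddCommGroup E] [NormedSpace ℂ E]
  {X : Type*} [TopologicalSpace X]

theorem fderiv_symm_comp (e : OpenPartialHomeomorph X E) {y : E} (hy : y ∈ e.target) :
    fderiv ℝ (e ∘ e.symm) y = ContinuousLinearMap.id ℝ E := by
  have h : e ∘ e.symm =ᶠ[nhds y] id := by
    filter_upwards [e.open_target.mem_nhds hy] with z hz
    exact e.right_inv hz
  rw [h.fderiv_eq, fderiv_id]

variable [ChartedSpace E X]

variable (X) in
/-- The components of a form in the chart `e`. -/
def loc (e : OpenPartialHomeomorph X E) (u : Form E X) (y : E) : Fib E := fun k => inChart e u k y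

theorem IsSmooth.differentiableAt {u : Form E X} (hu : IsSmooth u)
    {e : OpenPartialHomeomorph X E} (he : e ∈ atlas E X) (k : ℕ) {y : E} (hy : y ∈ e.target) :
    DifferentiableAt ℝ (inChart e u k) y :=
  ((hu e he k).contDiffAt (e.open_target.mem_nhds hy)).differentiableAt (by simp)

variable [IsManifold 𝓘(ℂ, E) ω X]

theorem contDiffOn_transition {e f : OpenPartialHomeomorph X E} (he : e ∈ atlas E X)
    (hf : f ∈ atlas E X) : ContDiffOn ℂ ∞ (f ∘ e.symm) (e.symm ≫ₕ f).source := by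
  have h := (contDiffGroupoid ω 𝓘(ℂ, E)).compatible he hf
  rw [contDiffGroupoid, mem_groupoid_of_pregroupoid] at h
  have h1 : ContDiffOn ℂ ω (f ∘ e.symm) (e.symm ≫ₕ f).source := by
    simpa [contDiffPregroupoid] using h.1
  exact h1.of_le le_top

theorem contDiffAt_transition {e f : OpenPartialHomeomorph X E} (he : e ∈ atlas E X)
    (hf : f ∈ atlas E X) {y : E} (hy : y ∈ e.target) (hyf : e.symm y ∈ f.source) :
    ContDiffAt ℂ ∞ (f ∘ e.symm) y := by
  refine (contDiffOn_transition he hf).contDiffAt ((e.symm ≫ₕ f).open_source.mem_nhds ?_)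
  simp [hy, hyf]

instance isManifold_real : IsManifold 𝓘(ℝ, E) ∞ X := by
  refine isManifold_of_contDiffOn _ _ _ fun e f he hf => ?_
  have h := (contDiffOn_transition he hf).restrict_scalars ℝ
  simpa using h

/-- The tangent space at a point is identified with `E` by the preferred chart there, so the
derivative of `e.symm` is that of the transition map to this chart. -/
theorem mfderiv_symm {e : OpenPartialHomeomorph X E} (he : e ∈ atlas E X) {y : E}
    (hy : y ∈ e.target) :
    mfderiv 𝓘(ℝ, E) 𝓘(ℝ, E) e.symm y = fderiv ℝ (chartAt E (e.symm y) ∘ e.symm) y := by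
  have h1 : MDifferentiableAt 𝓘(ℝ, E) 𝓘(ℝ, E) e.symm y := by
    have h2 := contMDiffOn_symm_of_mem_maximalAtlas
      (IsManifold.subset_maximalAtlas (I := 𝓘(ℝ, E)) (n := ∞) he)
    exact ((h2 y hy).contMDiffAt (e.open_target.mem_nhds hy)).mdifferentiableAt (by simp)
  refine h1.mfderiv.trans ?_
  simp only [writtenInExtChartAt, extChartAt, mfld_simps]
  exact congrFun (fderivWithin_univ (𝕜 := ℝ) (f := chartAt E (e.symm y) ∘ e.symm)) y

theorem loc_eq_pull {e : OpenPartialHomeomorph X E} (he : e ∈ atlas E X) (u : Form E X) {y : E}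
    (hy : y ∈ e.target) :
    loc X e u y = pull (fderiv ℝ (chartAt E (e.symm y) ∘ e.symm) y) (u (e.symm y)) := by
  funext k
  rw [loc, inChart, mfderiv_symm he hy]
  rfl

theorem fderiv_transition {e f g : OpenPartialHomeomorph X E} (he : e ∈ atlas E X)
    (hf : f ∈ atlas E X) (hg : g ∈ atlas E X) {y : E} (hy : y ∈ e.target)
    (hyf : e.symm y ∈ f.source) (hyg : e.symm y ∈ g.source) :
    fderiv ℝ (g ∘ e.symm) y =
      (fderiv ℝ (g ∘ f.symm) (f (e.symm y))).comp (fderiv ℝ (f ∘ e.symm) y) := by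
  have h1 : (g ∘ f.symm) ∘ (f ∘ e.symm) =ᶠ[nhds y] g ∘ e.symm := by
    have h2 : e.target ∩ e.symm ⁻¹' f.source ∈ nhds y :=
      (e.symm.isOpen_inter_preimage f.open_source).mem_nhds ⟨hy, hyf⟩
    filter_upwards [h2] with z hz
    simp [f.left_inv hz.2]
  rw [← h1.fderiv_eq]
  have h3 := ((contDiffAt_transition he hf hy hyf).restrict_scalars ℝ).differentiableAt
    (by simp)
  refine fderiv_comp y ?_ h3
  have h4 : f (e.symm y) ∈ f.target := f.map_source hyf
  exact ((contDiffAt_transition hf hg h4 (by rwa [f.left_inv hyf])).restrict_scalars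
    ℝ).differentiableAt (by simp)

theorem loc_eq_pull_transition {e f : OpenPartialHomeomorph X E} (he : e ∈ atlas E X)
    (hf : f ∈ atlas E X) (u : Form E X) {y : E} (hy : y ∈ e.target)
    (hyf : e.symm y ∈ f.source) :
    loc X e u y = pull (fderiv ℝ (f ∘ e.symm) y) (loc X f u (f (e.symm y))) := by
  have hfy : f (e.symm y) ∈ f.target := f.map_source hyf
  rw [loc_eq_pull he u hy, loc_eq_pull hf u hfy, f.left_inv hyf, pull_pull,
    fderiv_transition he hf (chart_mem_atlas E _) hy hyf (mem_chart_source E _)]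

theorem fderiv_transition_smul {e f : OpenPartialHomeomorph X E} (he : e ∈ atlas E X)
    (hf : f ∈ atlas E X) {y : E} (hy : y ∈ e.target) (hyf : e.symm y ∈ f.source) (z : ℂ) (v : E) :
    fderiv ℝ (f ∘ e.symm) y (z • v) = z • fderiv ℝ (f ∘ e.symm) y v := by
  have h := (contDiffAt_transition he hf hy hyf).differentiableAt (by simp)
  rw [h.fderiv_restrictScalars ℝ]
  simp

theorem fderiv_transition_comp {e f : OpenPartialHomeomorph X E} (he : e ∈ atlas E X)
    (hf : f ∈ atlas E X) {y : E} (hy : y ∈ e.target) (hyf : e.symm y ∈ f.source) :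
    (fderiv ℝ (e ∘ f.symm) (f (e.symm y))).comp (fderiv ℝ (f ∘ e.symm) y) =
      ContinuousLinearMap.id ℝ E := by
  rw [← fderiv_transition he hf he hy hyf (e.map_target hy), fderiv_symm_comp e hy]

/-- A complex-linear isomorphism, seen as a real-linear map. -/
def IsCIso (A : E →L[ℝ] E) : Prop :=
  (∀ (z : ℂ) v, A (z • v) = z • A v) ∧ ∃ B : E →L[ℝ] E, (∀ (z : ℂ) v, B (z • v) = z • B v) ∧
    B.comp A = ContinuousLinearMap.id ℝ E ∧ A.comp B = ContinuousLinearMap.id ℝ E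

theorem isCIso_fderiv_transition {e f : OpenPartialHomeomorph X E} (he : e ∈ atlas E X)
    (hf : f ∈ atlas E X) {y : E} (hy : y ∈ e.target) (hyf : e.symm y ∈ f.source) :
    IsCIso (fderiv ℝ (f ∘ e.symm) y) := by
  have hfy : f (e.symm y) ∈ f.target := f.map_source hyf
  have hfe : f.symm (f (e.symm y)) ∈ e.source := by
    rw [f.left_inv hyf]; exact e.map_target hy
  refine ⟨fderiv_transition_smul he hf hy hyf, fderiv ℝ (e ∘ f.symm) (f (e.symm y)),
    fderiv_transition_smul hf he hfy hfe, fderiv_transition_comp he hf hy hyf, ?_⟩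
  have h := fderiv_transition_comp hf he hfy hfe
  rwa [f.left_inv hyf, e.right_inv hy] at h

/-- In `extd` the preferred chart changes with the point. Naturality of the exterior derivative
under transition maps allows one fixed chart to compute it throughout its domain, which is what
smoothness and further differentiation require. -/
theorem inChart_extd {u : Form E X} (hu : IsSmooth u) {e : OpenPartialHomeomorph X E}
    (he : e ∈ atlas E X) (k : ℕ) {y : E} (hy : y ∈ e.target) :
    inChart e (extd u) (k + 1) y = extDeriv (inChart e u k) y := by
  set x := e.symm y with hx
  set f := chartAt E x with hf
  have hfa : f ∈ atlas E X := chart_mem_atlas E x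
  have hxf : e.symm y ∈ f.source := mem_chart_source E x
  have h1 : inChart e u k =ᶠ[nhds y] fun z =>
      (inChart f u k ((f ∘ e.symm) z)).compContinuousLinearMap (fderiv ℝ (f ∘ e.symm) z) := by
    have h2 : e.target ∩ e.symm ⁻¹' f.source ∈ nhds y :=
      (e.symm.isOpen_inter_preimage f.open_source).mem_nhds ⟨hy, hxf⟩
    filter_upwards [h2] with z hz
    exact congrFun (loc_eq_pull_transition he hfa u hz.1 hz.2) k
  have h3 : f (e.symm y) ∈ f.target := f.map_source hxf
  rw [h1.extDeriv_eq, extDeriv_pullback (r := ∞)]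
  · rw [inChart, mfderiv_symm he hy]
    rfl
  · exact hu.differentiableAt hfa k h3
  · exact (contDiffAt_transition he hfa hy hxf).restrict_scalars ℝ
  · rw [minSmoothness_of_isRCLikeNormedField]
    exact WithTop.coe_le_coe.2 le_top

end Charts

/-! ### The exterior derivative in coordinates -/

section ExteriorDerivative

variable {E : Type*} [NormedAddCommGroup E] [NormedSpace ℂ E] [FiniteDimensional ℂ E]

/-- The exterior derivative in coordinates. -/
theorem extDeriv_eq_sum {k : ℕ} (α : E → Alt E k) (y : E) :
    extDeriv α y = ∑ j, oneWedge (coord j) (fderiv ℝ α y (realBasis E j)) := by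
  have h : fderiv ℝ α y =
      ∑ j, (coord j).smulRight (fderiv ℝ α y (realBasis E j)) := by
    ext1 v
    conv_lhs => rw [← (realBasis E).sum_repr v, map_sum]
    rw [sum_apply]
    refine Finset.sum_congr rfl fun j _ => ?_
    rw [map_smul, ContinuousLinearMap.smulRight_apply, coord_apply, Complex.coe_smul]
  conv_lhs => rw [extDeriv, h]
  exact map_sum (ContinuousAlternatingMap.alternatizeUncurryFinCLM ℝ E ℂ) _ _

end ExteriorDerivative

/-! ### Compatibility of the pointwise operators with pull-back and conjugation -/

section Naturality

variable {E : Type*} [NormedAddCommGroup E] [NormedSpace ℂ E]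

theorem altWedge_comp {p q m : ℕ} (h : p + q = m) (α : Alt E p) (β : Alt E q) (A : E →L[ℝ] E) :
    (altWedge h α β).compContinuousLinearMap A =
      altWedge h (α.compContinuousLinearMap A) (β.compContinuousLinearMap A) := by
  ext v
  rw [ContinuousAlternatingMap.compContinuousLinearMap_apply, altWedge_apply, altWedge_apply]
  rfl

theorem zero_comp {k : ℕ} (A : E →L[ℝ] E) : (0 : Alt E k).compContinuousLinearMap A = 0 := rfl

theorem pull_wd (A : E →L[ℝ] E) {p : ℕ} (ρ : Alt E p) (α : Fib E) :
    pull A (wd p ρ α) = wd p (ρ.compContinuousLinearMap A) (pull A α) := by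
  funext m
  rw [pull_apply]
  rcases le_or_gt p m with h | h
  · rw [wd_apply_of_le h, wd_apply_of_le h, altWedge_comp, pull_apply]
  · rw [wd_apply_of_lt h, wd_apply_of_lt h, zero_comp]

theorem pull_thetaOp {A : E →L[ℝ] E} (hA : ∀ (z : ℂ) v, A (z • v) = z • A v) (s : ℂ)
    (α : Fib E) : pull A (thetaOp s α) = thetaOp s (pull A α) := by
  funext k
  rw [pull_apply, thetaOp_apply, thetaOp_apply]
  simp only [pull_apply, ← typePart_comp _ _ hA]
  ext v
  simp only [ContinuousAlternatingMap.compContinuousLinearMap_apply,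
    ContinuousAlternatingMap.sum_apply, ContinuousAlternatingMap.smul_apply]

theorem curryLeft_comp {k : ℕ} (α : Alt E (k + 1)) (A : E →L[ℝ] E) (v : E) :
    (α.compContinuousLinearMap A).curryLeft v =
      (α.curryLeft (A v)).compContinuousLinearMap A := by
  ext u
  change α (A ∘ Fin.cons v u) = α (Fin.cons (A v) (A ∘ u))
  congr 1
  funext i
  cases i using Fin.cases <;> rfl

theorem IsRealOneOne.comp {h : Alt E 2} (hh : IsRealOneOne h) {A : E →L[ℝ] E}
    (hA : ∀ (z : ℂ) v, A (z • v) = z • A v) : IsRealOneOne (h.compContinuousLinearMap A) where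
  real v := hh.real _
  invariant v u := by
    have h1 : ∀ a b : E, h.compContinuousLinearMap A ![a, b] = h ![A a, A b] := fun a b => by
      rw [ContinuousAlternatingMap.compContinuousLinearMap_apply]
      congr 1
      funext i
      fin_cases i <;> rfl
    rw [h1, h1, hA, hA, hh.invariant]

theorem comp_two_apply (h : Alt E 2) (A : E →L[ℝ] E) (v u : E) :
    h.compContinuousLinearMap A ![v, u] = h ![A v, A u] := by
  rw [ContinuousAlternatingMap.compContinuousLinearMap_apply]
  congr 1
  funext i
  fin_cases i <;> rfl

theorem IsHerm.comp {w : Alt E 2} (hw : IsHerm w) {A : E →L[ℝ] E} (hA : IsCIso A) :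
    IsHerm (w.compContinuousLinearMap A) where
  toIsRealOneOne := hw.toIsRealOneOne.comp hA.1
  pos v hv := by
    rw [comp_two_apply, hA.1]
    refine hw.pos _ fun h => hv ?_
    obtain ⟨B, -, hBA, -⟩ := hA.2
    have h1 := congrArg (fun T : E →L[ℝ] E => T v) hBA
    simpa [h] using h1.symm

theorem metr_comp (w : Alt E 2) {A : E →L[ℝ] E} (hA : ∀ (z : ℂ) v, A (z • v) = z • A v)
    (v u : E) : metr (w.compContinuousLinearMap A) v u = metr w (A v) (A u) := by
  rw [metr_apply, metr_apply, comp_two_apply, hA]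

/-- The complex conjugate of an element of the fibre. -/
def conjF (α : Fib E) : Fib E := fun k =>
  (Complex.conjCLE : ℂ →L[ℝ] ℂ).compContinuousAlternatingMap (α k)

theorem conjF_apply_apply (α : Fib E) (k : ℕ) (v : Fin k → E) : conjF α k v = conj (α k v) := rfl

theorem conjF_conjF (α : Fib E) : conjF (conjF α) = α := by
  funext k
  ext v
  simp [conjF_apply_apply]

theorem conjF_add (α β : Fib E) : conjF (α + β) = conjF α + conjF β := by
  funext k
  ext v
  exact map_add (starRingEnd ℂ) _ _

theorem conjF_smul (c : ℂ) (α : Fib E) : conjF (c • α) = conj c • conjF α := by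
  funext k
  ext v
  exact map_mul (starRingEnd ℂ) _ _

theorem conjF_sum {ι : Type*} (s : Finset ι) (α : ι → Fib E) :
    conjF (∑ i ∈ s, α i) = ∑ i ∈ s, conjF (α i) :=
  map_sum (AddMonoidHom.mk' conjF conjF_add) α s

theorem conjF_sub (α β : Fib E) : conjF (α - β) = conjF α - conjF β :=
  map_sub (AddMonoidHom.mk' conjF conjF_add) α β

theorem conjF_zero : conjF (0 : Fib E) = 0 := map_zero (AddMonoidHom.mk' conjF conjF_add)

theorem conjF_eps (ξ : E →L[ℝ] ℂ) (α : Fib E) :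
    conjF (eps ξ α) = eps (conjOne ξ) (conjF α) := by
  funext k
  cases k with
  | zero =>
    rw [eps_apply_zero, conjF, eps_apply_zero]
    ext v
    exact map_zero (starRingEnd ℂ)
  | succ k =>
    ext v
    rw [conjF_apply_apply, eps_apply_succ, eps_apply_succ, oneWedge_apply, oneWedge_apply, map_sum]
    refine Finset.sum_congr rfl fun i _ => ?_
    simp only [map_zsmul, map_mul, conjOne_apply, conjF_apply_apply]

theorem conjF_ins (v : E) (α : Fib E) : conjF (ins v α) = ins v (conjF α) := rfl

theorem conjF_wd {p : ℕ} (ρ : Alt E p) (α : Fib E) :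
    conjF (wd p ρ α) =
      wd p ((Complex.conjCLE : ℂ →L[ℝ] ℂ).compContinuousAlternatingMap ρ) (conjF α) := by
  funext m
  rcases le_or_gt p m with h | h
  · ext v
    rw [conjF_apply_apply, wd_apply_of_le h, wd_apply_of_le h, altWedge_apply, altWedge_apply]
    simp only [Complex.real_smul, map_mul, Complex.conj_ofReal, map_sum, Units.smul_def, map_zsmul]
    rfl
  · rw [conjF, wd_apply_of_lt h, wd_apply_of_lt h]
    ext v
    exact map_zero (starRingEnd ℂ)

theorem conjOne_holOne (ξ : E →L[ℝ] ℂ) : conjOne (holOne ξ) = antiOne (conjOne ξ) := by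
  ext v
  simp only [conjOne_apply, holOne_apply, antiOne_apply, map_mul, map_sub, map_inv₀, map_ofNat,
    Complex.conj_I]
  ring

theorem conjOne_antiOne (ξ : E →L[ℝ] ℂ) : conjOne (antiOne ξ) = holOne (conjOne ξ) := by
  ext v
  simp only [conjOne_apply, holOne_apply, antiOne_apply, map_mul, map_add, map_inv₀, map_ofNat,
    Complex.conj_I]
  ring

/-- Conjugation exchanges the two bidegrees of a real one-form, so -η ξ' + ξ'' becomes ξ' - η ξ''.
The sign in D̄_{-η} is thus the one for which the Kähler identity pairs it with D_η. -/
theorem conjOne_twistOne (η : ℝ) {ξ : E →L[ℝ] ℂ} (hξ : conjOne ξ = ξ) :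
    conjOne (twistOne (-η) ξ) = cotwistOne η ξ := by
  have h : conjOne (twistOne (-η) ξ) = ((-η : ℝ) : ℂ) • conjOne (holOne ξ) + conjOne (antiOne ξ) := by
    ext v
    simp [conjOne_apply, twistOne]
  rw [h, conjOne_holOne, conjOne_antiOne, hξ, cotwistOne]
  ext v
  simp only [add_apply, sub_apply, smul_apply, smul_eq_mul]
  push_cast
  ring

variable [FiniteDimensional ℂ E]

theorem conjOne_coord (a : Fin (Module.finrank ℝ E)) : conjOne (coord a) = coord a := by
  ext v
  rw [conjOne_apply, coord_apply, Complex.conj_ofReal]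

theorem conjF_holDeg (α : Fib E) : conjF (holDeg α) = antiDeg (conjF α) := by
  simp only [holDeg, antiDeg, Op.sum_apply, Op.mul_apply, conjF_sum, conjF_eps, conjF_ins,
    conjOne_holOne, conjOne_coord]

theorem altInner_conjF (w : Alt E 2) (α β : Fib E) (k : ℕ) :
    altInner w (conjF α k) (conjF β k) = conj (altInner w (α k) (β k)) := by
  simp only [altInner, conjF_apply_apply, map_mul, map_sum, map_inv₀, Complex.conj_conj,
    Complex.conj_natCast, Complex.conj_ofReal]

theorem ip_conjF (w : Alt E 2) (α β : Fib E) :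
    ip w (conjF α) (conjF β) = conj (ip w α β) := by
  simp only [ip, altInner_conjF, map_sum]

/-- The map `A` carries frames dual for the pulled-back metric to frames dual for `w`, and the
inverse metric does not depend on the dual pair. -/
theorem IsHerm.altInner_comp {w : Alt E 2} (hw : IsHerm w) {A : E →L[ℝ] E} (hA : IsCIso A) :
    ∀ {k : ℕ} (α β : Alt E k), altInner (w.compContinuousLinearMap A)
      (α.compContinuousLinearMap A) (β.compContinuousLinearMap A) = altInner w α β := by
  intro k
  induction k with
  | zero =>
    intro α β
    have h (γ : Alt E 0) : γ.compContinuousLinearMap A 0 = γ 0 :=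
      congrArg γ (Subsingleton.elim _ _)
    rw [altInner_zero_degree, altInner_zero_degree, h, h]
  | succ k ih =>
    intro α β
    have h1 (a : Fin (Module.finrank ℝ E)) :
        altInner (w.compContinuousLinearMap A)
          ((α.compContinuousLinearMap A).curryLeft (realBasis E a))
          ((β.compContinuousLinearMap A).curryLeft (fr (w.compContinuousLinearMap A) a)) =
        pairCurry w α β (A (realBasis E a)) (A (fr (w.compContinuousLinearMap A) a)) := by
      rw [curryLeft_comp, curryLeft_comp, ih, pairCurry_apply]
    rw [altInner_succ (w.compContinuousLinearMap A), altInner_succ w,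
      Finset.sum_congr rfl fun a _ => h1 a]
    refine congrArg (fun x => ((k : ℂ) + 1)⁻¹ * x) ?_
    refine (hw.sum_bilin_eq_of_dual (pairCurry w α β) (fun a => A (realBasis E a))
      (fun a => A (fr (w.compContinuousLinearMap A) a)) fun v => ?_).symm
    obtain ⟨B, -, -, hAB⟩ := hA.2
    have h1 : A (B v) = v := congrArg (fun T : E →L[ℝ] E => T v) hAB
    have h2 := congrArg A ((hw.comp hA).sum_metr_fr (B v))
    rw [h1, map_sum] at h2
    conv_rhs => rw [← h2]
    refine Finset.sum_congr rfl fun a _ => ?_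
    rw [map_smul, metr_comp w hA.1, h1]

theorem IsHerm.ip_pull {w : Alt E 2} (hw : IsHerm w) {A : E →L[ℝ] E} (hA : IsCIso A)
    (α β : Fib E) : ip (w.compContinuousLinearMap A) (pull A α) (pull A β) = ip w α β :=
  Finset.sum_congr rfl fun k _ => hw.altInner_comp hA (α k) (β k)

/-- The pull-back is an isometry that respects exterior products, hence also their adjoints, by
uniqueness. -/
theorem IsHerm.pull_contr {w : Alt E 2} (hw : IsHerm w) {A : E →L[ℝ] E} (hA : IsCIso A) {p : ℕ}
    (ρ : Alt E p) (α : Fib E) : pull A (contr w p ρ α) =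
      contr (w.compContinuousLinearMap A) p (ρ.compContinuousLinearMap A) (pull A α) := by
  refine (hw.comp hA).eq_of_ip fun γ => ?_
  obtain ⟨B, -, hBA, -⟩ := hA.2
  obtain ⟨δ, rfl⟩ : ∃ δ, γ = pull A δ := ⟨pull B γ, by rw [pull_pull, hBA, pull_id]⟩
  rw [hw.ip_pull hA, ← isAdj_wd (w.compContinuousLinearMap A), ← pull_wd, hw.ip_pull hA,
    isAdj_wd w]

end Naturality

/-! ### The twisted derivatives in real coordinates -/

section Coordinates

variable {E : Type*} [NormedAddCommGroup E] [NormedSpace ℂ E]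

theorem hasDerivAt_line {V : Type*} [NormedAddCommGroup V] [NormedSpace ℝ V] {f : E → V} {y : E}
    (hf : DifferentiableAt ℝ f y) (v : E) :
    HasDerivAt (fun t : ℝ => f (y + t • v)) (fderiv ℝ f y v) 0 := by
  have h1 : HasDerivAt (fun t : ℝ => y + t • v) v 0 := by
    simpa using ((hasDerivAt_id (0 : ℝ)).smul_const v).const_add y
  have h2 : HasFDerivAt f (fderiv ℝ f y) (y + (0 : ℝ) • v) := by
    simpa using hf.hasFDerivAt
  exact h2.comp_hasDerivAt 0 h1

theorem hasDerivFib_thetaOp {s : ℝ → ℂ} {s' : ℂ} {u : ℝ → Fib E} {u' : Fib E} {t : ℝ}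
    [FiniteDimensional ℂ E] (hs : HasDerivAt s s' t) (hu : HasDerivFib u u' t) :
    HasDerivFib (fun r => thetaOp (s r) (u r))
      (thetaOp (s t) u' + s' • thetaOp' (s t) (u t)) t := fun k => by
  have h1 (p : ℕ) : HasDerivAt (fun r => typePart p (u r k)) (typePart p (u' k)) t := by
    let L : Alt E k →ₗ[ℝ] Alt E k :=
      { toFun := typePart p
        map_add' := typePart_add p
        map_smul' := fun c α => typePart_smul p (c : ℂ) α }
    exact hasDerivAt_linear L (hu k)
  have h2 := HasDerivAt.fun_sum (u := Finset.range (k + 1)) fun p _ => (hs.pow p).smul (h1 p)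
  refine h2.congr_deriv ?_
  rw [Finset.sum_add_distrib, Pi.add_apply, thetaOp_apply, Pi.smul_apply, thetaOp'_apply,
    Finset.smul_sum]
  congr 1
  refine Finset.sum_congr rfl fun p _ => ?_
  rw [smul_smul, mul_comm]

theorem smoothFib_thetaOp [FiniteDimensional ℂ E] {s : E → ℂ} {u : E → Fib E} {U : Set E}
    (hs : ContDiffOn ℝ ∞ s U) (hu : SmoothFib u U) :
    SmoothFib (fun y => thetaOp (s y) (u y)) U := fun k => by
  have h1 (p : ℕ) : ContDiffOn ℝ ∞ (fun y => typePart p (u y k)) U := by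
    let L : Alt E k →ₗ[ℝ] Alt E k :=
      { toFun := typePart p
        map_add' := typePart_add p
        map_smul' := fun c α => typePart_smul p (c : ℂ) α }
    exact contDiffOn_linear L (hu k)
  have h2 : ContDiffOn ℝ ∞
      (fun y => ∑ p ∈ Finset.range (k + 1), s y ^ p • typePart p (u y k)) U :=
    ContDiffOn.sum fun p _ => (hs.pow p).smul (h1 p)
  exact h2

variable [FiniteDimensional ℂ E]

/-- The partial derivatives of a section of the bundle of forms. -/
def pd (j : Fin (Module.finrank ℝ E)) (u : E → Fib E) (y : E) : Fib E := fun k =>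
  fderiv ℝ (fun z => u z k) y (realBasis E j)

theorem SmoothFib.hasDerivFib {u : E → Fib E} {U : Set E} (hu : SmoothFib u U) (hU : IsOpen U)
    {y : E} (hy : y ∈ U) (j : Fin (Module.finrank ℝ E)) :
    HasDerivFib (fun t : ℝ => u (y + t • realBasis E j)) (pd j u y) 0 := fun k =>
  hasDerivAt_line (((hu k).contDiffAt (hU.mem_nhds hy)).differentiableAt (by simp)) _

theorem SmoothFib.pd_eq {u : E → Fib E} {U : Set E} (hu : SmoothFib u U) (hU : IsOpen U)
    {y : E} (hy : y ∈ U) {j : Fin (Module.finrank ℝ E)} {u' : Fib E}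
    (h : HasDerivFib (fun t : ℝ => u (y + t • realBasis E j)) u' 0) : pd j u y = u' :=
  (hu.hasDerivFib hU hy j).unique h

theorem SmoothFib.pd {u : E → Fib E} {U : Set E} (hu : SmoothFib u U) (hU : IsOpen U)
    (j : Fin (Module.finrank ℝ E)) : SmoothFib (TwistedForms.pd j u) U := fun k =>
  (((hu k).fderiv_of_isOpen hU (m := ∞) (by simp)).clm_apply contDiffOn_const)

theorem SmoothFib.conjF {u : E → Fib E} {U : Set E} (hu : SmoothFib u U) :
    SmoothFib (fun y => TwistedForms.conjF (u y)) U := fun k => by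
  let L : Alt E k →ₗ[ℝ] Alt E k :=
    { toFun := fun α => (Complex.conjCLE : ℂ →L[ℝ] ℂ).compContinuousAlternatingMap α
      map_add' := fun α β => by ext v; exact map_add (starRingEnd ℂ) _ _
      map_smul' := fun c α => by ext v; exact map_smul (Complex.conjCLE : ℂ →L[ℝ] ℂ) _ _ }
  exact contDiffOn_linear L (hu k)

theorem HasDerivFib.conjF {u : ℝ → Fib E} {u' : Fib E} {t : ℝ} (hu : HasDerivFib u u' t) :
    HasDerivFib (fun s => TwistedForms.conjF (u s)) (TwistedForms.conjF u') t := fun k => by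
  let L : Alt E k →ₗ[ℝ] Alt E k :=
    { toFun := fun α => (Complex.conjCLE : ℂ →L[ℝ] ℂ).compContinuousAlternatingMap α
      map_add' := fun α β => by ext v; exact map_add (starRingEnd ℂ) _ _
      map_smul' := fun c α => by ext v; exact map_smul (Complex.conjCLE : ℂ →L[ℝ] ℂ) _ _ }
  exact hasDerivAt_linear L (hu k)

/-- The twisted exterior derivative in coordinates. -/
def twistedDLoc (η : E → ℝ) (u : E → Fib E) (y : E) : Fib E :=
  ∑ j, eps (twistOne (η y) (coord j))
    (pd j u y - ((fderiv ℝ η y (realBasis E j) : ℂ) / η y) • holDeg (u y))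

/-- The conjugate of the operator `twistedDLoc (-η)`. -/
def twistedDbarLoc (η : E → ℝ) (u : E → Fib E) (y : E) : Fib E :=
  ∑ j, eps (cotwistOne (η y) (coord j))
    (pd j u y - ((fderiv ℝ η y (realBasis E j) : ℂ) / η y) • antiDeg (u y))

theorem conjF_twistedDLoc {η : E → ℝ} {u : E → Fib E} {U : Set E} (hU : IsOpen U)
    (hu : SmoothFib u U) {y : E} (hy : y ∈ U) :
    conjF (twistedDLoc (-η) (fun z => conjF (u z)) y) = twistedDbarLoc η u y := by
  rw [twistedDLoc, twistedDbarLoc, conjF_sum]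
  refine Finset.sum_congr rfl fun j _ => ?_
  have h1 : pd j (fun z => conjF (u z)) y = conjF (pd j u y) :=
    hu.conjF.pd_eq hU hy (hu.hasDerivFib hU hy j).conjF
  rw [conjF_eps, h1, conjF_sub, conjF_conjF, conjF_smul, conjF_holDeg, conjF_conjF, Pi.neg_apply,
    conjOne_twistOne _ (conjOne_coord j)]
  congr 3
  have h2 : fderiv ℝ (-η) y (realBasis E j) = -fderiv ℝ η y (realBasis E j) := by
    rw [fderiv_neg]; rfl
  rw [h2]
  push_cast
  rw [neg_div_neg_eq, map_div₀, Complex.conj_ofReal, Complex.conj_ofReal]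

/-- The expression of `θ_η d θ_η⁻¹` in coordinates. -/
theorem thetaOp_sum_eps_pd {η : E → ℝ} {U : Set E} (hU : IsOpen U) (hη : ContDiffOn ℝ ∞ η U)
    (hη0 : ∀ y ∈ U, η y ≠ 0) {u : E → Fib E} (hu : SmoothFib u U) {y : E} (hy : y ∈ U) :
    thetaOp (η y) (∑ j, eps (coord j) (pd j (fun z => thetaOp ((η z)⁻¹ : ℝ) (u z)) y)) =
      twistedDLoc η u y := by
  have hs : SmoothFib (fun z => thetaOp ((η z)⁻¹ : ℝ) (u z)) U :=
    smoothFib_thetaOp (contDiffOn_ofReal (hη.inv hη0)) hu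
  rw [map_sum, twistedDLoc]
  refine Finset.sum_congr rfl fun j _ => ?_
  have hd := hasDerivAt_line ((hη.contDiffAt (hU.mem_nhds hy)).differentiableAt (by simp))
    (realBasis E j)
  have h0 : y + (0 : ℝ) • realBasis E j = y := by simp
  have hηy := hη0 y hy
  have hηy' : (η y : ℂ) ≠ 0 := by exact_mod_cast hηy
  have hi := (hd.fun_inv (by rw [h0]; exact hηy)).ofReal_comp
  have h1 := hasDerivFib_thetaOp hi (hu.hasDerivFib hU hy j)
  simp only [h0] at h1
  rw [hs.pd_eq hU hy h1, ← Op.mul_apply, thetaOp_mul_eps, Op.mul_apply,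
    map_add (thetaOp (η y : ℂ)), map_smul (thetaOp (η y : ℂ)),
    ← Op.mul_apply (thetaOp (η y : ℂ)), ← Op.mul_apply (thetaOp (η y : ℂ)), thetaOp_mul, thetaOp_mul_thetaOp']
  · rw [Complex.ofReal_inv, mul_inv_cancel₀ hηy', thetaOp_one, Op.one_apply, Op.smul_apply, smul_smul]
    -- The derivative of 1/η is -η'/η², and the remaining factor η comes from
    -- `thetaOp_mul_thetaOp'`.
    have h2 : ((-fderiv ℝ η y (realBasis E j) / η y ^ 2 : ℝ) : ℂ) * η y =
        -((fderiv ℝ η y (realBasis E j) : ℂ) / η y) := by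
      push_cast
      field_simp
    rw [h2]
    change eps (twistOne (η y) (coord j)) _ = _
    congr 1
    module
  · rw [Complex.ofReal_inv, mul_inv_cancel₀ hηy']

end Coordinates

/-! ### Forms on the manifold: degree, smoothness, locality and local expressions -/

section Forms

variable {E : Type*} [NormedAddCommGroup E] [NormedSpace ℂ E]
  {X : Type*} [TopologicalSpace X] [ChartedSpace E X]

/-- The form has no component in the degrees other than `p`. -/
def IsDeg (p : ℕ) (ρ : Form E X) : Prop := ∀ x k, k ≠ p → ρ x k = 0

omit [TopologicalSpace X] [ChartedSpace E X] in
-- The left factor of each exterior product considered here is homogeneous, so the sum over degrees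
-- reduces to a single operator on the fibre.
theorem wedge_apply_of_isDeg {p : ℕ} {ρ : Form E X} (h : IsDeg p ρ) (u : Form E X) (x : X) :
    wedge ρ u x = wd p (ρ x p) (u x) := by
  funext m
  rw [wedge]
  rcases le_or_gt p m with hp | hp
  · rw [wd_apply_of_le hp, Finset.sum_eq_single ⟨p, Nat.lt_succ_of_le hp⟩]
    · intro q _ hq
      rw [h x q fun hqp => hq (Fin.ext hqp), altWedge_left_zero]
    · intro hq
      exact absurd (Finset.mem_univ _) hq
  · rw [wd_apply_of_lt hp]
    refine Finset.sum_eq_zero fun q _ => ?_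
    rw [h x q (by omega), altWedge_left_zero]

theorem loc_sub (e : OpenPartialHomeomorph X E) (u v : Form E X) (y : E) :
    loc X e (u - v) y = loc X e u y - loc X e v y := rfl

theorem loc_mulForm (e : OpenPartialHomeomorph X E) (f : X → ℂ) (u : Form E X) (y : E) :
    loc X e (mulForm f u) y = f (e.symm y) • loc X e u y := rfl

theorem loc_conjForm (e : OpenPartialHomeomorph X E) (u : Form E X) (y : E) :
    loc X e (conjForm u) y = conjF (loc X e u y) := rfl

omit [TopologicalSpace X] [ChartedSpace E X] in
theorem conjForm_apply (u : Form E X) (x : X) : conjForm u x = conjF (u x) := rfl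

omit [TopologicalSpace X] [ChartedSpace E X] in
theorem conjForm_conjForm (u : Form E X) : conjForm (conjForm u) = u :=
  funext fun x => conjF_conjF (u x)

omit [TopologicalSpace X] [ChartedSpace E X] in
theorem theta_apply (η : X → ℝ) (u : Form E X) (x : X) : theta η u x = thetaOp (η x) (u x) := rfl

omit [TopologicalSpace X] [ChartedSpace E X] in
theorem mulForm_const (c : ℂ) (u : Form E X) : mulForm (fun _ => c) u = c • u := rfl

omit [TopologicalSpace X] [ChartedSpace E X] in
theorem conjForm_ofFun (f : X → ℝ) : conjForm (ofFun E f) = ofFun E f := by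
  funext x k
  ext v
  rcases eq_or_ne k 0 with rfl | hk
  · simp [conjForm, ofFun]
  · simp [conjForm, ofFun, Pi.single_eq_of_ne hk]

variable [IsManifold 𝓘(ℂ, E) ω X]

theorem isCIso_chart {e : OpenPartialHomeomorph X E} (he : e ∈ atlas E X) {y : E}
    (hy : y ∈ e.target) : IsCIso (fderiv ℝ (chartAt E (e.symm y) ∘ e.symm) y) :=
  isCIso_fderiv_transition he (chart_mem_atlas E _) hy (mem_chart_source E _)

theorem loc_wedge {p : ℕ} {ρ : Form E X} (h : IsDeg p ρ) (u : Form E X)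
    {e : OpenPartialHomeomorph X E} (he : e ∈ atlas E X) {y : E} (hy : y ∈ e.target) :
    loc X e (wedge ρ u) y = wd p (inChart e ρ p y) (loc X e u y) := by
  rw [loc_eq_pull he _ hy, wedge_apply_of_isDeg h, pull_wd, ← loc_eq_pull he _ hy,
    inChart, mfderiv_symm he hy]

theorem loc_theta (η : X → ℝ) (u : Form E X) {e : OpenPartialHomeomorph X E} (he : e ∈ atlas E X)
    {y : E} (hy : y ∈ e.target) :
    loc X e (theta η u) y = thetaOp (η (e.symm y)) (loc X e u y) := by
  rw [loc_eq_pull he _ hy, theta_apply, pull_thetaOp (isCIso_chart he hy).1,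
    ← loc_eq_pull he _ hy]

theorem contDiffOn_comp_symm {V : Type*} [NormedAddCommGroup V] [NormedSpace ℝ V] {f : X → V}
    (hf : ContMDiff 𝓘(ℝ, E) 𝓘(ℝ, V) ∞ f) {e : OpenPartialHomeomorph X E} (he : e ∈ atlas E X) :
    ContDiffOn ℝ ∞ (f ∘ e.symm) e.target := by
  rw [← contMDiffOn_iff_contDiffOn]
  exact hf.comp_contMDiffOn (contMDiffOn_symm_of_mem_maximalAtlas
    (IsManifold.subset_maximalAtlas (I := 𝓘(ℝ, E)) (n := ∞) he))

/-- The function `f : X → ℂ` is of class `C^∞` in every chart. -/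
def IsSmoothFun (f : X → ℂ) : Prop := ∀ e ∈ atlas E X, ContDiffOn ℝ ∞ (f ∘ e.symm) e.target

omit [IsManifold 𝓘(ℂ, E) ω X] in
theorem IsSmooth.add {u v : Form E X} (hu : IsSmooth u) (hv : IsSmooth v) : IsSmooth (u + v) :=
  fun e he k => (hu e he k).add (hv e he k)

omit [IsManifold 𝓘(ℂ, E) ω X] in
theorem IsSmooth.sub {u v : Form E X} (hu : IsSmooth u) (hv : IsSmooth v) : IsSmooth (u - v) :=
  fun e he k => (hu e he k).sub (hv e he k)

omit [IsManifold 𝓘(ℂ, E) ω X] in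
theorem IsSmooth.neg {u : Form E X} (hu : IsSmooth u) : IsSmooth (-u) :=
  fun e he k => (hu e he k).neg

omit [IsManifold 𝓘(ℂ, E) ω X] in
theorem IsSmooth.mulForm {u : Form E X} (hu : IsSmooth u) {f : X → ℂ}
    (hf : IsSmoothFun (E := E) f) : IsSmooth (mulForm f u) :=
  fun e he k => (hf e he).smul (hu e he k)

omit [IsManifold 𝓘(ℂ, E) ω X] in
theorem IsSmooth.const_smul {u : Form E X} (hu : IsSmooth u) (c : ℂ) : IsSmooth (c • u) :=
  fun e he k => by
    have h : ContDiffOn ℝ ∞ (fun y => c • inChart e u k y) e.target :=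
      (hu e he k).const_smul c
    exact h

omit [IsManifold 𝓘(ℂ, E) ω X] in
theorem inChart_zero (e : OpenPartialHomeomorph X E) (k : ℕ) :
    inChart e (0 : Form E X) k = fun _ => 0 := rfl

omit [IsManifold 𝓘(ℂ, E) ω X] in
theorem isSmooth_zero : IsSmooth (0 : Form E X) := fun e _ k => by
  rw [inChart_zero]
  exact contDiffOn_const

theorem isSmoothFun_ofReal {f : X → ℝ} (hf : ContMDiff 𝓘(ℝ, E) 𝓘(ℝ, ℝ) ∞ f) :
    IsSmoothFun (E := E) (fun x => (f x : ℂ)) := fun _ he =>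
  contDiffOn_ofReal (contDiffOn_comp_symm hf he)

omit [IsManifold 𝓘(ℂ, E) ω X] in
theorem extd_add {u v : Form E X} (hu : IsSmooth u) (hv : IsSmooth v) :
    extd (u + v) = extd u + extd v := by
  funext x k
  cases k with
  | zero => exact (add_zero (0 : Alt E 0)).symm
  | succ k =>
    exact extDeriv_add (hu.differentiableAt (chart_mem_atlas E x) k (mem_chart_target E x))
      (hv.differentiableAt (chart_mem_atlas E x) k (mem_chart_target E x))

omit [IsManifold 𝓘(ℂ, E) ω X] in
theorem extd_eq_zero {u : Form E X} {x : X} (h : ∀ᶠ z in nhds x, u z = 0) : extd u x = 0 := by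
  funext k
  cases k with
  | zero => rfl
  | succ k =>
    have h1 : inChart (chartAt E x) u k =ᶠ[nhds (chartAt E x x)] fun _ => 0 := by
      have hc : ContinuousAt (chartAt E x).symm (chartAt E x x) :=
        (chartAt E x).continuousAt_symm (mem_chart_target E x)
      have h2 : ∀ᶠ z in nhds ((chartAt E x).symm (chartAt E x x)), u z = 0 := by
        rwa [(chartAt E x).left_inv (mem_chart_source E x)]
      filter_upwards [hc.eventually h2] with z hz
      rw [inChart, hz]
      rfl
    change extDeriv (inChart (chartAt E x) u k) (chartAt E x x) = 0
    rw [h1.extDeriv_eq, extDeriv]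
    have h3 : fderiv ℝ (fun _ : E => (0 : Alt E k)) (chartAt E x x) = 0 := by
      simp
    rw [h3]
    exact map_zero (ContinuousAlternatingMap.alternatizeUncurryFinCLM ℝ E ℂ)

/-- A form that vanishes in the degree `k` has no exterior derivative in the degree `k + 1`. -/
theorem extd_apply_eq_zero {E : Type*} [NormedAddCommGroup E] [NormedSpace ℂ E]
    {X : Type*} [TopologicalSpace X] [ChartedSpace E X] {u : Form E X} {k : ℕ}
    (h : ∀ x, u x k = 0) (x : X) : extd u x (k + 1) = 0 := by
  have h1 : inChart (chartAt E x) u k = fun _ => 0 := by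
    funext z
    rw [inChart, h]
    rfl
  change extDeriv (inChart (chartAt E x) u k) (chartAt E x x) = 0
  rw [h1, extDeriv]
  have h3 : fderiv ℝ (fun _ : E => (0 : Alt E k)) (chartAt E x x) = 0 := by
    simp
  rw [h3]
  exact map_zero (ContinuousAlternatingMap.alternatizeUncurryFinCLM ℝ E ℂ)

theorem IsDeg.extd {E : Type*} [NormedAddCommGroup E] [NormedSpace ℂ E]
    {X : Type*} [TopologicalSpace X] [ChartedSpace E X] {u : Form E X} {p : ℕ}
    (h : IsDeg p u) : IsDeg (p + 1) (extd u) := by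
  intro x k hk
  cases k with
  | zero => rfl
  | succ k => exact extd_apply_eq_zero (fun z => h z k (by omega)) x

theorem IsDeg.theta {E : Type*} [NormedAddCommGroup E] [NormedSpace ℂ E]
    {X : Type*} [TopologicalSpace X] [ChartedSpace E X] {u : Form E X} {p : ℕ}
    (h : IsDeg p u) (η : X → ℝ) : IsDeg p (theta η u) := by
  intro x k hk
  rw [theta_apply, thetaOp_apply, h x k hk]
  exact Finset.sum_eq_zero fun q _ => by rw [typePart_zero, alt_smul_zero]

variable [FiniteDimensional ℂ E]

omit [IsManifold 𝓘(ℂ, E) ω X] in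
theorem IsSmooth.conjForm {u : Form E X} (hu : IsSmooth u) : IsSmooth (conjForm u) :=
  fun e he => SmoothFib.conjF (hu e he)

theorem IsSmooth.theta {u : Form E X} (hu : IsSmooth u) {η : X → ℝ}
    (hη : ContMDiff 𝓘(ℝ, E) 𝓘(ℝ, ℝ) ∞ η) : IsSmooth (theta η u) := fun e he k =>
  (smoothFib_thetaOp (contDiffOn_ofReal (contDiffOn_comp_symm hη he)) (hu e he) k).congr
    fun _ hy => congrFun (loc_theta η u he hy) k

theorem loc_extd {u : Form E X} (hu : IsSmooth u) {e : OpenPartialHomeomorph X E}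
    (he : e ∈ atlas E X) {y : E} (hy : y ∈ e.target) :
    loc X e (extd u) y = ∑ j, eps (coord j) (pd j (loc X e u) y) := by
  funext k
  rw [Finset.sum_apply]
  cases k with
  | zero => simp only [eps_apply_zero, Finset.sum_const_zero]; rfl
  | succ k =>
    simp only [eps_apply_succ]
    exact (inChart_extd hu he k hy).trans (extDeriv_eq_sum _ y)

theorem IsSmooth.extd {u : Form E X} (hu : IsSmooth u) : IsSmooth (extd u) := fun e he k => by
  have h : SmoothFib (fun y => ∑ j, eps (coord j) (pd j (loc X e u) y)) e.target :=
    SmoothFib.sum fun j => smoothOp_eps_const _ _ _ (SmoothFib.pd (hu e he) e.open_target j)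
  exact (h k).congr fun y hy => congrFun (loc_extd hu he hy) k

theorem IsSmooth.wedge {p : ℕ} {ρ u : Form E X} (hρ : IsSmooth ρ) (h : IsDeg p ρ)
    (hu : IsSmooth u) : IsSmooth (wedge ρ u) := fun e he k =>
  (smoothOp_wd p (hρ e he p) (loc X e u) (hu e he) k).congr
    fun _ hy => congrFun (loc_wedge h u he hy) k

omit [FiniteDimensional ℂ E] in
theorem isSmooth_ofFun {f : X → ℝ} (hf : ContMDiff 𝓘(ℝ, E) 𝓘(ℝ, ℝ) ∞ f) :
    IsSmooth (ofFun E f) := fun e he k => by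
  rcases eq_or_ne k 0 with rfl | hk
  · have h : ContDiffOn ℝ ∞ (fun y => ((f ∘ e.symm) y : ℂ) • (altOne : Alt E 0)) e.target :=
      (contDiffOn_ofReal (contDiffOn_comp_symm hf he)).smul contDiffOn_const
    refine h.congr fun y hy => ?_
    ext v
    change ((f (e.symm y) : ℝ) : ℂ) = (f (e.symm y) : ℂ) * 1
    rw [mul_one]
  · have h : inChart e (ofFun E f) k = fun _ => 0 := by
      funext y
      rw [inChart, ofFun, Pi.single_eq_of_ne hk]
      rfl
    rw [h]
    exact contDiffOn_const

section Twisted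

variable {η : X → ℝ} (hη : ContMDiff 𝓘(ℝ, E) 𝓘(ℝ, ℝ) ∞ η) (hη0 : ∀ x, η x ≠ 0)
include hη hη0

omit [IsManifold 𝓘(ℂ, E) ω X] [FiniteDimensional ℂ E] in
theorem contMDiff_inv : ContMDiff 𝓘(ℝ, E) 𝓘(ℝ, ℝ) ∞ (fun x => (η x)⁻¹) := hη.inv₀ hη0

theorem IsSmooth.twistedD {u : Form E X} (hu : IsSmooth u) : IsSmooth (twistedD η u) :=
  (hu.theta (contMDiff_inv hη hη0)).extd.theta hη

theorem loc_twistedD {u : Form E X} (hu : IsSmooth u) {e : OpenPartialHomeomorph X E}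
    (he : e ∈ atlas E X) {y : E} (hy : y ∈ e.target) :
    loc X e (twistedD η u) y = twistedDLoc (η ∘ e.symm) (loc X e u) y := by
  rw [twistedD, loc_theta _ _ he hy, loc_extd (hu.theta (contMDiff_inv hη hη0)) he hy,
    ← thetaOp_sum_eps_pd e.open_target (contDiffOn_comp_symm hη he) (fun z _ => hη0 _)
      (u := loc X e u) (hu e he) hy]
  have h (j) : pd j (loc X e (theta (fun x => (η x)⁻¹) u)) y =
      pd j (fun z => thetaOp (((η ∘ e.symm) z)⁻¹ : ℝ) (loc X e u z)) y := by
    funext k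
    have h1 : (fun z => loc X e (theta (fun x => (η x)⁻¹) u) z k) =ᶠ[nhds y]
        fun z => thetaOp (((η ∘ e.symm) z)⁻¹ : ℝ) (loc X e u z) k := by
      filter_upwards [e.open_target.mem_nhds hy] with z hz
      rw [loc_theta _ _ he hz]
      rfl
    rw [pd, pd, h1.fderiv_eq]
  simp only [h]
  rfl

theorem IsSmooth.twistedDbar {u : Form E X} (hu : IsSmooth u) :
    IsSmooth (twistedDbar (-η) u) :=
  (IsSmooth.twistedD (η := -η) hη.neg (fun x => neg_ne_zero.2 (hη0 x)) hu.conjForm).conjForm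

theorem loc_twistedDbar {u : Form E X} (hu : IsSmooth u) {e : OpenPartialHomeomorph X E}
    (he : e ∈ atlas E X) {y : E} (hy : y ∈ e.target) :
    loc X e (twistedDbar (-η) u) y = twistedDbarLoc (η ∘ e.symm) (loc X e u) y := by
  rw [← conjF_twistedDLoc e.open_target (u := loc X e u) (hu e he) hy]
  rw [twistedDbar, conjOp, loc_conjForm,
    loc_twistedD (η := -η) hη.neg (fun x => neg_ne_zero.2 (hη0 x)) hu.conjForm he hy]
  rfl

theorem twistedD_add {u v : Form E X} (hu : IsSmooth u) (hv : IsSmooth v) :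
    twistedD η (u + v) = twistedD η u + twistedD η v := by
  have h (s : X → ℝ) (a b : Form E X) : theta s (a + b) = theta s a + theta s b :=
    funext fun x => map_add (thetaOp (s x : ℂ)) (a x) (b x)
  rw [twistedD, h, extd_add (hu.theta (contMDiff_inv hη hη0)) (hv.theta (contMDiff_inv hη hη0)), h]
  rfl

end Twisted

omit [TopologicalSpace X] [ChartedSpace E X] in
omit [IsManifold 𝓘(ℂ, E) ω X] [FiniteDimensional ℂ E] in
theorem theta_apply_eq_zero {u : Form E X} {x : X} (h : u x = 0) (s : X → ℝ) : theta s u x = 0 := by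
  rw [theta_apply, h, map_zero]

omit [IsManifold 𝓘(ℂ, E) ω X] [FiniteDimensional ℂ E] in
theorem twistedD_eq_zero {u : Form E X} {x : X} (h : ∀ᶠ z in nhds x, u z = 0) (η : X → ℝ) :
    twistedD η u x = 0 :=
  theta_apply_eq_zero (extd_eq_zero (h.mono fun _ hz => theta_apply_eq_zero hz _)) _

end Forms

/-! ### The bidegree of ω and of its derivatives -/

section Structure

variable {E : Type*} [NormedAddCommGroup E] [NormedSpace ℂ E] [FiniteDimensional ℂ E]

/-- Applied to the constant 1, an identity between exterior operators becomes one between forms; for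
instance [P, L] = L gives P ω = ω. -/
theorem wd_singleL_altOne (p : ℕ) (ρ : Alt E p) : wd p ρ (singleL 0 altOne) = singleL p ρ := by
  induction p, ρ using alt_induction with
  | zero ρ =>
    rw [wd_zero, Op.smul_apply, Op.one_apply, ← map_smul]
    congr 1
    ext v
    change ρ 0 * 1 = ρ v
    rw [mul_one, Subsingleton.elim v 0]
  | add k α β hα hβ => rw [map_add, Op.add_apply, hα, hβ, map_add]
  | smul k c α hα => rw [map_smul, Op.smul_apply, hα, map_smul]
  | wedge k ξ α hα => rw [wd_oneWedge, Op.mul_apply, hα, eps_singleL]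

omit [FiniteDimensional ℂ E] in
theorem wd_three_eq {ι : Type*} [Fintype ι] {ρ : Alt E 3} {ξ : ι → E →L[ℝ] ℂ} {h : ι → Alt E 2}
    (hρ : ρ = ∑ j, oneWedge (ξ j) (h j)) : wd 3 ρ = ∑ j, eps (ξ j) * wd 2 (h j) := by
  rw [hρ, map_sum]
  exact Finset.sum_congr rfl fun j _ => wd_oneWedge _ _

omit [FiniteDimensional ℂ E] in
theorem ins_singleL_zero (v : E) (α : Alt E 0) : ins v (singleL 0 α) = 0 := by
  funext k
  rw [ins_apply, singleL_of_ne (Nat.succ_ne_zero k)]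
  rfl

theorem holDeg_singleL_zero (α : Alt E 0) : holDeg (singleL 0 α) = 0 := by
  rw [holDeg, Op.sum_apply]
  refine Finset.sum_eq_zero fun a _ => ?_
  rw [Op.mul_apply, ins_singleL_zero, map_zero]

theorem IsHerm.holDeg_singleL {w : Alt E 2} (hw : IsHerm w) :
    holDeg (singleL 2 w) = singleL 2 w := by
  rw [← wd_singleL_altOne, ← Op.mul_apply, hw.holDeg_mul_wd_self, Op.add_apply, Op.mul_apply,
    holDeg_singleL_zero, map_zero, zero_add]

omit [FiniteDimensional ℂ E] in
-- A linear condition valid on an open set passes to the derivatives. Thus the partial derivatives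
-- of ω are again real of bidegree (1,1), as `contr_two` requires.
theorem fderiv_pred {V : Type*} [NormedAddCommGroup V] [NormedSpace ℝ V]
    {W : Type*} [NormedAddCommGroup W] [NormedSpace ℝ W] [FiniteDimensional ℝ V]
    (L : V →ₗ[ℝ] W) {f : E → V} {U : Set E} (hU : IsOpen U) {y : E} (hy : y ∈ U)
    (hf : DifferentiableAt ℝ f y) (h : ∀ z ∈ U, L (f z) = 0) (v : E) : L (fderiv ℝ f y v) = 0 := by
  have h1 : HasFDerivAt (fun z => L (f z)) ((LinearMap.toContinuousLinearMap L).comp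
      (fderiv ℝ f y)) y :=
    (LinearMap.toContinuousLinearMap L).hasFDerivAt.comp y hf.hasFDerivAt
  have h2 : (fun z => L (f z)) =ᶠ[nhds y] fun _ => 0 := by
    filter_upwards [hU.mem_nhds hy] with z hz using h z hz
  have h3 := (h1.congr_of_eventuallyEq h2.symm).unique (hasFDerivAt_const (0 : W) y)
  exact congrArg (fun T : E →L[ℝ] W => T v) h3

theorem isRealOneOne_fderiv {f : E → Alt E 2} {U : Set E} (hU : IsOpen U)
    (hf : ContDiffOn ℝ ∞ f U) (h : ∀ z ∈ U, IsRealOneOne (f z)) {y : E} (hy : y ∈ U) (v : E) :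
    IsRealOneOne (fderiv ℝ f y v) := by
  have hd : DifferentiableAt ℝ f y :=
    (hf.contDiffAt (hU.mem_nhds hy)).differentiableAt (by simp)
  refine ⟨fun a => ?_, fun a b => ?_⟩
  · exact fderiv_pred (Complex.imLm.comp (evalL a)) hU hy hd (fun z hz => (h z hz).real a) v
  · exact sub_eq_zero.1 (fderiv_pred (evalL ![Complex.I • a, Complex.I • b] - evalL ![a, b]) hU hy hd
      (fun z hz => sub_eq_zero.2 ((h z hz).invariant a b)) v)

end Structure

/-! ### The metric, Λ and the pointwise adjoints in charts -/

section Metric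

variable {E : Type*} [NormedAddCommGroup E] [NormedSpace ℂ E] [FiniteDimensional ℂ E]
  {X : Type*} [TopologicalSpace X] [ChartedSpace E X] (g : HermitianMetric E X)

namespace HermitianMetric

omit [FiniteDimensional ℂ E] in
theorem isHerm (x : X) : IsHerm (g.toAlt x) := ⟨⟨g.real x, g.invariant x⟩, g.pos x⟩

omit [FiniteDimensional ℂ E] in
theorem form_two (x : X) : g.form x 2 = g.toAlt x := Pi.single_eq_same _ _

omit [FiniteDimensional ℂ E] in
theorem isDeg_form : IsDeg 2 g.form := fun _ _ hk => Pi.single_eq_of_ne hk _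

omit [FiniteDimensional ℂ E] in
theorem contDiffOn_form {e : OpenPartialHomeomorph X E} (he : e ∈ atlas E X) :
    ContDiffOn ℝ ∞ (inChart e g.form 2) e.target := g.smooth e he 2

theorem inner_eq (u v : Form E X) (x : X) : g.inner u v x = ip (g.toAlt x) (u x) (v x) := rfl

omit [FiniteDimensional ℂ E] in
theorem lefschetz_apply (u : Form E X) (x : X) : g.lefschetz u x = wd 2 (g.toAlt x) (u x) := by
  rw [lefschetz, wedge_apply_of_isDeg g.isDeg_form, form_two]

/-- The pointwise adjoint of the exterior product with `ρ`. -/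
def contrForm (p : ℕ) (ρ u : Form E X) : Form E X := fun x => contr (g.toAlt x) p (ρ x p) (u x)

/-- The pointwise adjoint of the Lefschetz operator. -/
def Lam (u : Form E X) : Form E X := fun x => lam (g.toAlt x) (u x)

variable [IsManifold 𝓘(ℂ, E) ω X] {e : OpenPartialHomeomorph X E} (he : e ∈ atlas E X)
include he

omit [FiniteDimensional ℂ E] in
theorem inChart_form {y : E} (hy : y ∈ e.target) : inChart e g.form 2 y =
    (g.toAlt (e.symm y)).compContinuousLinearMap
      (fderiv ℝ (chartAt E (e.symm y) ∘ e.symm) y) := by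
  rw [inChart, form_two, mfderiv_symm he hy]

omit [FiniteDimensional ℂ E] in
theorem isHerm_inChart {y : E} (hy : y ∈ e.target) : IsHerm (inChart e g.form 2 y) := by
  rw [g.inChart_form he hy]
  exact (g.isHerm _).comp (isCIso_chart he hy)

theorem inner_symm (u v : Form E X) {y : E} (hy : y ∈ e.target) :
    g.inner u v (e.symm y) = ip (inChart e g.form 2 y) (loc X e u y) (loc X e v y) := by
  rw [g.inChart_form he hy, loc_eq_pull he u hy, loc_eq_pull he v hy,
    (g.isHerm _).ip_pull (isCIso_chart he hy), inner_eq]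

theorem loc_contrForm (p : ℕ) (ρ u : Form E X) {y : E} (hy : y ∈ e.target) :
    loc X e (g.contrForm p ρ u) y =
      contr (inChart e g.form 2 y) p (inChart e ρ p y) (loc X e u y) := by
  rw [g.inChart_form he hy, loc_eq_pull he _ hy, loc_eq_pull he u hy, contrForm,
    (g.isHerm _).pull_contr (isCIso_chart he hy), inChart, mfderiv_symm he hy]

theorem loc_Lam (u : Form E X) {y : E} (hy : y ∈ e.target) :
    loc X e (g.Lam u) y = lam (inChart e g.form 2 y) (loc X e u y) := by
  rw [← (g.isHerm_inChart he hy).contr_self, ← g.loc_contrForm he 2 g.form u hy]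
  congr 1
  funext x
  rw [contrForm, form_two, (g.isHerm x).contr_self, Lam]

omit he

theorem isSmooth_contrForm {p : ℕ} {ρ u : Form E X} (hρ : IsSmooth ρ) (hu : IsSmooth u) :
    IsSmooth (g.contrForm p ρ u) := fun e he k =>
  (smoothOp_contr (g.contDiffOn_form he) (fun _ hy => g.isHerm_inChart he hy) p (hρ e he p)
    (loc X e u) (hu e he) k).congr fun _ hy => congrFun (g.loc_contrForm he p ρ u hy) k

theorem isSmooth_Lam {u : Form E X} (hu : IsSmooth u) : IsSmooth (g.Lam u) := fun e he k =>
  (smoothOp_lam (g.contDiffOn_form he) (fun _ hy => g.isHerm_inChart he hy)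
    (loc X e u) (hu e he) k).congr fun _ hy => congrFun (g.loc_Lam he u hy) k

theorem isSmooth_lefschetz {u : Form E X} (hu : IsSmooth u) : IsSmooth (g.lefschetz u) :=
  IsSmooth.wedge (p := 2) g.smooth g.isDeg_form hu

end HermitianMetric

end Metric

/-! ### The form D_η ω in a chart -/

section Special

variable {E : Type*} [NormedAddCommGroup E] [NormedSpace ℂ E] [FiniteDimensional ℂ E]
  {X : Type*} [TopologicalSpace X] [ChartedSpace E X]

omit [FiniteDimensional ℂ E] in
theorem IsDeg.twistedD {u : Form E X} {p : ℕ} (h : IsDeg p u) (η : X → ℝ) :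
    IsDeg (p + 1) (twistedD η u) := ((h.theta _).extd).theta _

omit [FiniteDimensional ℂ E] in
theorem loc_eq_singleL {u : Form E X} {p : ℕ} (h : IsDeg p u) (e : OpenPartialHomeomorph X E)
    (y : E) : loc X e u y = singleL p (inChart e u p y) := by
  funext k
  rcases eq_or_ne k p with rfl | hk
  · rw [singleL_self, loc]
  · rw [singleL_of_ne hk, loc, inChart, h _ _ hk]
    exact zero_comp _

variable [IsManifold 𝓘(ℂ, E) ω X]

omit [IsManifold 𝓘(ℂ, E) ω X] in
/-- The partial derivative of a form of degree `p`. -/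
theorem pd_loc_of_isDeg {u : Form E X} {p : ℕ} (h : IsDeg p u) (e : OpenPartialHomeomorph X E)
    (j : Fin (Module.finrank ℝ E)) (y : E) :
    pd j (loc X e u) y = singleL p (fderiv ℝ (inChart e u p) y (realBasis E j)) := by
  funext k
  rcases eq_or_ne k p with rfl | hk
  · rw [singleL_self]
    rfl
  · rw [singleL_of_ne hk, pd]
    have h1 : (fun z => loc X e u z k) = fun _ => 0 := by
      funext z
      rw [loc_eq_singleL h, singleL_of_ne hk]
    rw [h1]
    simp

/-- As P ω = ω, the local expression of D_η gives D_η ω = ∑ c_j ∧ (∂_j ω - (∂_j η / η) ω), which is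
the combination occurring in `pointwise_identity`. -/
theorem inChart_twistedD_form (g : HermitianMetric E X) {η : X → ℝ}
    (hη : ContMDiff 𝓘(ℝ, E) 𝓘(ℝ, ℝ) ∞ η) (hη0 : ∀ x, η x ≠ 0)
    {e : OpenPartialHomeomorph X E} (he : e ∈ atlas E X) {y : E} (hy : y ∈ e.target) :
    wd 3 (inChart e (twistedD η g.form) 3 y) =
      ∑ j, eps (twistOne (η (e.symm y)) (coord j)) *
        (wd 2 (fderiv ℝ (inChart e g.form 2) y (realBasis E j)) -
          ((fderiv ℝ (η ∘ e.symm) y (realBasis E j) : ℂ) / (η (e.symm y) : ℂ)) •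
            wd 2 (inChart e g.form 2 y)) := by
  have h := loc_twistedD hη hη0 (u := g.form) g.smooth he hy
  rw [loc_eq_singleL (g.isDeg_form.twistedD η), twistedDLoc] at h
  simp only [pd_loc_of_isDeg g.isDeg_form, loc_eq_singleL g.isDeg_form,
    (g.isHerm_inChart he hy).holDeg_singleL, ← map_smul, ← map_sub, eps_singleL] at h
  have h3 := congrFun h 3
  rw [Finset.sum_apply, singleL_self] at h3
  simp only [singleL_self] at h3
  rw [wd_three_eq h3]
  simp only [map_sub, map_smul]
  rfl

end Special

/-! ### The one-forms d_η η and d̄_{-η} η -/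

section Gradient

variable {E : Type*} [NormedAddCommGroup E] [NormedSpace ℂ E] [FiniteDimensional ℂ E]

omit [FiniteDimensional ℂ E] in
theorem wd_one_oneWedge (ξ : E →L[ℝ] ℂ) : wd 1 (oneWedge ξ altOne) = eps ξ := by
  rw [wd_oneWedge, wd_zero]
  change eps ξ * ((1 : ℂ) • 1) = eps ξ
  rw [one_smul, mul_one]

variable {X : Type*} [TopologicalSpace X] [ChartedSpace E X]

omit [FiniteDimensional ℂ E] [TopologicalSpace X] [ChartedSpace E X] in
theorem isDeg_ofFun (f : X → ℝ) : IsDeg 0 (ofFun E f) := fun _ _ hk => Pi.single_eq_of_ne hk _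

omit [FiniteDimensional ℂ E] [TopologicalSpace X] [ChartedSpace E X] in
theorem IsDeg.holPart {u : Form E X} {p : ℕ} (h : IsDeg p u) (q : ℕ) : IsDeg p (holPart q u) :=
  fun x k hk => by rw [TwistedForms.holPart, h x k hk, typePart_zero]

omit [FiniteDimensional ℂ E] [TopologicalSpace X] [ChartedSpace E X] in
theorem holPart_zero_ofFun (f : X → ℝ) : holPart 0 (ofFun E f) = ofFun E f := by
  funext x k
  rcases eq_or_ne k 0 with rfl | hk
  · rw [holPart, (hasType_zero _).typePart, if_pos rfl]
  · rw [holPart, isDeg_ofFun f x k hk, typePart_zero]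

omit [FiniteDimensional ℂ E] in
-- On the differential of a function, θ_s multiplies the (1,0)-part by s and fixes the (0,1)-part,
-- as s ∂ + ∂̄ does. The gradient terms therefore involve the same one-forms c_j and b_j as the
-- twisted derivatives.
theorem twistedd_ofFun (s f : X → ℝ) :
    twistedd s (ofFun E f) = theta s (extd (ofFun E f)) := by
  funext x k
  have hd (q : ℕ) : IsDeg 1 (extd (holPart q (ofFun E f))) := ((isDeg_ofFun f).holPart q).extd
  rcases eq_or_ne k 1 with rfl | hk
  · have h1 : extd (holPart 1 (ofFun E f)) x 1 = 0 :=
      extd_apply_eq_zero (fun z => typePart_eq_zero zero_lt_one _) x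
    change ((s x : ℝ) : ℂ) • del (ofFun E f) x 1 + delbar (ofFun E f) x 1 =
      ∑ p ∈ Finset.range (1 + 1), ((s x : ℂ) ^ p) • typePart p (extd (ofFun E f) x 1)
    rw [del, delbar, Finset.sum_range_succ, Finset.sum_range_one, Finset.sum_range_succ,
      Finset.sum_range_one, Finset.sum_range_succ, Finset.sum_range_one]
    simp only [holPart_zero_ofFun]
    simp only [holPart.eq_1 _ (extd _)]
    rw [h1, typePart_zero, typePart_zero, add_zero, add_zero, pow_zero, pow_one, one_smul, zero_add]
    exact add_comm _ _
  · rw [((isDeg_ofFun f).extd.theta s) x k hk]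
    change ((s x : ℝ) : ℂ) • del (ofFun E f) x k + delbar (ofFun E f) x k = 0
    rw [del, delbar, Finset.sum_eq_zero fun p _ => (hd p).holPart _ x k hk,
      Finset.sum_eq_zero fun p _ => (hd p).holPart _ x k hk, alt_smul_zero, add_zero]

omit [FiniteDimensional ℂ E] in
theorem twisteddbar_ofFun (s f : X → ℝ) :
    twisteddbar s (ofFun E f) = conjForm (twistedd s (ofFun E f)) := by
  rw [twisteddbar, conjOp, conjForm_ofFun]

omit [FiniteDimensional ℂ E] in
theorem isDeg_twistedd_ofFun (s f : X → ℝ) : IsDeg 1 (twistedd s (ofFun E f)) := by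
  rw [twistedd_ofFun]
  exact (isDeg_ofFun f).extd.theta s

omit [FiniteDimensional ℂ E] [TopologicalSpace X] [ChartedSpace E X] in
theorem IsDeg.conjForm {u : Form E X} {p : ℕ} (h : IsDeg p u) : IsDeg p (conjForm u) := by
  intro x k hk
  rw [TwistedForms.conjForm, h x k hk]
  ext v
  exact map_zero (starRingEnd ℂ)

omit [FiniteDimensional ℂ E] in
theorem isDeg_twisteddbar_ofFun (s f : X → ℝ) : IsDeg 1 (twisteddbar s (ofFun E f)) := by
  rw [twisteddbar_ofFun]
  exact (isDeg_twistedd_ofFun s f).conjForm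

variable [IsManifold 𝓘(ℂ, E) ω X] {s f : X → ℝ}
  (hs : ContMDiff 𝓘(ℝ, E) 𝓘(ℝ, ℝ) ∞ s) (hf : ContMDiff 𝓘(ℝ, E) 𝓘(ℝ, ℝ) ∞ f)
include hs hf

theorem isSmooth_twistedd_ofFun : IsSmooth (twistedd s (ofFun E f)) := by
  rw [twistedd_ofFun]
  exact (isSmooth_ofFun hf).extd.theta hs

theorem isSmooth_twisteddbar_ofFun : IsSmooth (twisteddbar s (ofFun E f)) := by
  rw [twisteddbar_ofFun]
  exact (isSmooth_twistedd_ofFun hs hf).conjForm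

variable {e : OpenPartialHomeomorph X E} (he : e ∈ atlas E X) {y : E} (hy : y ∈ e.target)
include he hy

omit hs in
theorem pd_loc_ofFun (j : Fin (Module.finrank ℝ E)) : pd j (loc X e (ofFun E f)) y =
    (fderiv ℝ (f ∘ e.symm) y (realBasis E j) : ℂ) • singleL 0 altOne := by
  refine SmoothFib.pd_eq (isSmooth_ofFun hf e he) e.open_target hy ?_
  have hd : DifferentiableAt ℝ (f ∘ e.symm) y :=
    ((contDiffOn_comp_symm hf he).contDiffAt (e.open_target.mem_nhds hy)).differentiableAt (by simp)
  have h1 := (hasDerivAt_line hd (realBasis E j)).ofReal_comp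
  have h2 : HasDerivFib (fun _ : ℝ => (singleL 0 altOne : Fib E)) 0 0 :=
    fun k => hasDerivAt_const _ _
  have h3 := HasDerivFib.smul h1 h2
  have h4 (c : ℂ) : c • (0 : Fib E) = 0 := funext fun k => alt_smul_zero c
  rw [h4, zero_add] at h3
  intro k
  refine (h3 k).congr_of_eventuallyEq (Filter.Eventually.of_forall fun t => ?_)
  change inChart e (ofFun E f) k (y + t • realBasis E j) =
    ((f (e.symm (y + t • realBasis E j)) : ℝ) : ℂ) • singleL 0 altOne k
  rcases eq_or_ne k 0 with rfl | hk
  · rw [singleL_self]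
    ext v
    change ((f (e.symm _) : ℝ) : ℂ) = (f (e.symm _) : ℂ) * 1
    rw [mul_one]
  · rw [singleL_of_ne hk, alt_smul_zero, inChart, isDeg_ofFun f _ k hk]
    exact zero_comp _

omit hs in
theorem wd_inChart_twistedd_ofFun : wd 1 (inChart e (twistedd s (ofFun E f)) 1 y) =
    ∑ j, (fderiv ℝ (f ∘ e.symm) y (realBasis E j) : ℂ) •
      eps (twistOne (s (e.symm y)) (coord j)) := by
  have h : loc X e (twistedd s (ofFun E f)) y = ∑ j,
      (fderiv ℝ (f ∘ e.symm) y (realBasis E j) : ℂ) •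
        singleL 1 (oneWedge (twistOne (s (e.symm y)) (coord j)) altOne) := by
    rw [twistedd_ofFun, loc_theta s _ he hy, loc_extd (isSmooth_ofFun hf) he hy, map_sum]
    refine Finset.sum_congr rfl fun j _ => ?_
    rw [pd_loc_ofFun hf he hy, ← Op.mul_apply, thetaOp_mul_eps, Op.mul_apply, map_smul, map_smul,
      (hasType_zero _).thetaOp, pow_zero, one_smul, eps_singleL]
    rfl
  rw [loc_eq_singleL (isDeg_twistedd_ofFun s f)] at h
  have h1 := congrFun h 1
  simp only [← map_smul, ← map_sum, singleL_self] at h1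
  rw [h1, map_sum]
  simp only [map_smul, wd_one_oneWedge]

omit hs in
theorem wd_inChart_twisteddbar_ofFun :
    wd 1 (inChart e (twisteddbar (-s) (ofFun E f)) 1 y) =
      ∑ j, (fderiv ℝ (f ∘ e.symm) y (realBasis E j) : ℂ) •
        eps (cotwistOne (s (e.symm y)) (coord j)) := by
  refine Op.ext fun α => ?_
  have h := conjF_wd (inChart e (twistedd (-s) (ofFun E f)) 1 y) (conjF α)
  rw [conjF_conjF, wd_inChart_twistedd_ofFun (s := -s) hf he hy] at h
  rw [twisteddbar_ofFun]
  refine h.symm.trans ?_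
  rw [Op.sum_apply, Op.sum_apply, conjF_sum]
  refine Finset.sum_congr rfl fun j _ => ?_
  rw [Op.smul_apply, Op.smul_apply, conjF_smul, conjF_eps, conjF_conjF, Complex.conj_ofReal,
    Pi.neg_apply, conjOne_twistOne _ (conjOne_coord j)]

end Gradient

/-! ### The divergence of the flux in coordinates -/

section LocalDivergence

variable {E : Type*} [NormedAddCommGroup E] [NormedSpace ℂ E] [FiniteDimensional ℂ E]
  {U : Set E} (hU : IsOpen U) {y : E} (hy : y ∈ U)
include hU hy

theorem fderiv_sqrt_det_mul_ip {w : E → Alt E 2} (hw : ContDiffOn ℝ ∞ w U)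
    (hwU : ∀ z ∈ U, IsHerm (w z)) {a v : E → Fib E} (ha : SmoothFib a U) (hv : SmoothFib v U)
    (j : Fin (Module.finrank ℝ E)) :
    fderiv ℝ (fun z => (√(gram (w z)).det : ℂ) * ip (w z) (a z) (v z)) y (realBasis E j) =
      √(gram (w y)).det * (ip (w y) (pd j a y) (v y) + ip (w y) (a y) (pd j v y) +
        ip (w y) ((lam (w y) * wd 2 (fderiv ℝ w y (realBasis E j)) -
          wd 2 (fderiv ℝ w y (realBasis E j)) * lam (w y)) (a y)) (v y)) := by
  have hF : DifferentiableAt ℝ (fun z => (√(gram (w z)).det : ℂ) * ip (w z) (a z) (v z)) y :=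
    (((contDiffOn_ofReal (contDiffOn_sqrt_det hw hwU)).mul
      (contDiffOn_ip hw hwU ha hv)).contDiffAt (hU.mem_nhds hy)).differentiableAt (by simp)
  have hd := hasDerivAt_line ((hw.contDiffAt (hU.mem_nhds hy)).differentiableAt (by simp))
    (realBasis E j)
  have hw0 : IsHerm (w (y + (0 : ℝ) • realBasis E j)) := by
    rw [zero_smul, add_zero]
    exact hwU y hy
  have h := hasDerivAt_sqrt_det_mul_ip hd hw0
    (isRealOneOne_fderiv hU hw (fun z hz => (hwU z hz).toIsRealOneOne) hy (realBasis E j))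
    (ha.hasDerivFib hU hy j) (hv.hasDerivFib hU hy j)
  simp only [zero_smul, add_zero] at h
  exact (hasDerivAt_line hF (realBasis E j)).unique h

theorem pd_eps_twistOne {η : E → ℝ} (hη : ContDiffOn ℝ ∞ η U) {u : E → Fib E} (hu : SmoothFib u U)
    (ξ : E →L[ℝ] ℂ) (j : Fin (Module.finrank ℝ E)) :
    pd j (fun z => eps (twistOne (η z) ξ) (u z)) y =
      eps (twistOne (η y) ξ) (pd j u y) +
        (fderiv ℝ η y (realBasis E j) : ℂ) • eps (holOne ξ) (u y) := by
  have hd : DifferentiableAt ℝ η y := (hη.contDiffAt (hU.mem_nhds hy)).differentiableAt (by simp)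
  have h1 := (hasDerivAt_line hd (realBasis E j)).ofReal_comp
  have hT : HasDerivOp (fun t : ℝ => eps (twistOne (η (y + t • realBasis E j)) ξ))
      ((fderiv ℝ η y (realBasis E j) : ℂ) • eps (holOne ξ)) 0 := by
    have h2 := (HasDerivOp.smul h1 (hasDerivOp_eps (holOne ξ) 0)).add (hasDerivOp_eps (antiOne ξ) 0)
    have h3 (c : ℂ) : c • (0 : Op E) = 0 := smul_zero c
    rw [h3, zero_add, add_zero] at h2
    have h4 : (fun t : ℝ => (eps (twistOne (η (y + t • realBasis E j)) ξ) : Op E)) = fun t =>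
        ((η (y + t • realBasis E j) : ℝ) : ℂ) • eps (holOne ξ) + eps (antiOne ξ) :=
      funext fun t => by rw [twistOne, map_add, map_smul]
    rw [h4]
    exact h2
  have hu' := hu.hasDerivFib hU hy j
  have hsm : SmoothFib (fun z => eps (twistOne (η z) ξ) (u z)) U := by
    refine smoothOp_eps (fun v => ?_) u hu
    exact ((contDiffOn_ofReal hη).mul contDiffOn_const).add contDiffOn_const
  refine hsm.pd_eq hU hy ?_
  have h5 := hT _ _ hu'
  simp only [zero_smul, add_zero] at h5
  exact h5

theorem pd_lam {w : E → Alt E 2} (hw : ContDiffOn ℝ ∞ w U) (hwU : ∀ z ∈ U, IsHerm (w z))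
    {v : E → Fib E} (hv : SmoothFib v U) (j : Fin (Module.finrank ℝ E)) :
    pd j (fun z => lam (w z) (v z)) y =
      lam (w y) (pd j v y) - contr (w y) 2 (fderiv ℝ w y (realBasis E j)) (v y) := by
  have hd := hasDerivAt_line ((hw.contDiffAt (hU.mem_nhds hy)).differentiableAt (by simp))
    (realBasis E j)
  have hw0 : IsHerm (w (y + (0 : ℝ) • realBasis E j)) := by
    rw [zero_smul, add_zero]
    exact hwU y hy
  have h := hasDerivOp_lam hd hw0
    (isRealOneOne_fderiv hU hw (fun z hz => (hwU z hz).toIsRealOneOne) hy (realBasis E j))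
  have hsm : SmoothFib (fun z => lam (w z) (v z)) U := smoothOp_lam hw hwU v hv
  refine hsm.pd_eq hU hy ?_
  have h5 := h _ _ (hv.hasDerivFib hU hy j)
  simp only [zero_smul, add_zero] at h5
  rw [sub_eq_add_neg]
  exact h5

/-- The divergence of the vector field with components `√det ⟨c_j ∧ u, v⟩`. -/
theorem sum_fderiv_flux {w : E → Alt E 2} (hw : ContDiffOn ℝ ∞ w U) (hwU : ∀ z ∈ U, IsHerm (w z))
    {η : E → ℝ} (hη : ContDiffOn ℝ ∞ η U) (hη0 : η y ≠ 0) {u v : E → Fib E} (hu : SmoothFib u U)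
    (hv : SmoothFib v U) :
    ∑ j, fderiv ℝ (fun z => (√(gram (w z)).det : ℂ) *
        ip (w z) (eps (twistOne (η z) (coord j)) (u z)) (v z)) y (realBasis E j) =
      √(gram (w y)).det * (ip (w y) (twistedDLoc η u y) (v y) +
        ip (w y) ((lam (w y) * (∑ j, eps (twistOne (η y) (coord j)) *
            (wd 2 (fderiv ℝ w y (realBasis E j)) -
              ((fderiv ℝ η y (realBasis E j) : ℂ) / (η y : ℂ)) • wd 2 (w y))) -
          (∑ j, eps (twistOne (η y) (coord j)) * (wd 2 (fderiv ℝ w y (realBasis E j)) -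
              ((fderiv ℝ η y (realBasis E j) : ℂ) / (η y : ℂ)) • wd 2 (w y))) * lam (w y))
          (u y)) (v y) +
        ip (w y) (u y) (Complex.I • (lam (w y) (twistedDbarLoc η v y) -
          twistedDbarLoc η (fun z => lam (w z) (v z)) y)) -
        ip (w y) (u y) (((Module.finrank ℂ E : ℂ) / (η y : ℂ)) • (Complex.I •
          ((∑ j, (fderiv ℝ η y (realBasis E j) : ℂ) • eps (cotwistOne (η y) (coord j)))
              (lam (w y) (v y)) -
            lam (w y) ((∑ j, (fderiv ℝ η y (realBasis E j) : ℂ) •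
              eps (cotwistOne (η y) (coord j))) (v y)))))) := by
  have hsm (j) : SmoothFib (fun z => eps (twistOne (η z) (coord j)) (u z)) U := by
    refine smoothOp_eps (fun v => ?_) u hu
    exact ((contDiffOn_ofReal hη).mul contDiffOn_const).add contDiffOn_const
  have hj (j) : fderiv ℝ (fun z => (√(gram (w z)).det : ℂ) *
        ip (w z) (eps (twistOne (η z) (coord j)) (u z)) (v z)) y (realBasis E j) =
      √(gram (w y)).det * (
        ip (w y) (eps (twistOne (η y) (coord j)) (pd j u y -
          ((fderiv ℝ η y (realBasis E j) : ℂ) / η y) • holDeg (u y))) (v y) +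
        ip (w y) ((lam (w y) * (eps (twistOne (η y) (coord j)) *
            (wd 2 (fderiv ℝ w y (realBasis E j)) -
              ((fderiv ℝ η y (realBasis E j) : ℂ) / η y) • wd 2 (w y))) -
          (eps (twistOne (η y) (coord j)) * (wd 2 (fderiv ℝ w y (realBasis E j)) -
              ((fderiv ℝ η y (realBasis E j) : ℂ) / η y) • wd 2 (w y))) * lam (w y)) (u y)) (v y) +
        ip (w y) (u y) (Complex.I • (lam (w y) (eps (cotwistOne (η y) (coord j)) (pd j v y -
            ((fderiv ℝ η y (realBasis E j) : ℂ) / η y) • antiDeg (v y))) -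
          eps (cotwistOne (η y) (coord j)) (pd j (fun z => lam (w z) (v z)) y -
            ((fderiv ℝ η y (realBasis E j) : ℂ) / η y) • antiDeg (lam (w y) (v y))))) -
        ip (w y) (u y) (((Module.finrank ℂ E : ℂ) *
          ((fderiv ℝ η y (realBasis E j) : ℂ) / η y)) • (Complex.I •
            (eps (cotwistOne (η y) (coord j)) (lam (w y) (v y)) -
              lam (w y) (eps (cotwistOne (η y) (coord j)) (v y)))))) := by
    -- For each j the derivative of the flux is the right-hand side of `pointwise_identity`; the
    -- term with `holOne` comes from the derivative of η in c_j.
    rw [fderiv_sqrt_det_mul_ip hU hy hw hwU (hsm j) hv j, pd_lam hU hy hw hwU hv,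
      pd_eps_twistOne hU hy hη hu, (hwU y hy).pointwise_identity (conjOne_coord j) hη0,
      ip_add_left, ip_smul_left]
    ring
  rw [Finset.sum_congr rfl fun j _ => hj j, ← Finset.mul_sum, Finset.sum_sub_distrib,
    Finset.sum_add_distrib, Finset.sum_add_distrib, ← ip_sum_left, ← ip_sum_left, ← ip_sum_right,
    ← ip_sum_right]
  have h1 : ∑ j, (lam (w y) * (eps (twistOne (η y) (coord j)) *
            (wd 2 (fderiv ℝ w y (realBasis E j)) -
              ((fderiv ℝ η y (realBasis E j) : ℂ) / η y) • wd 2 (w y))) -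
          (eps (twistOne (η y) (coord j)) * (wd 2 (fderiv ℝ w y (realBasis E j)) -
              ((fderiv ℝ η y (realBasis E j) : ℂ) / η y) • wd 2 (w y))) * lam (w y)) (u y) =
      (lam (w y) * (∑ j, eps (twistOne (η y) (coord j)) *
            (wd 2 (fderiv ℝ w y (realBasis E j)) -
              ((fderiv ℝ η y (realBasis E j) : ℂ) / (η y : ℂ)) • wd 2 (w y))) -
          (∑ j, eps (twistOne (η y) (coord j)) * (wd 2 (fderiv ℝ w y (realBasis E j)) -
              ((fderiv ℝ η y (realBasis E j) : ℂ) / (η y : ℂ)) • wd 2 (w y))) * lam (w y))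
          (u y) := by
    rw [Finset.mul_sum, Finset.sum_mul, ← Finset.sum_sub_distrib, Op.sum_apply]
  have h2 : ∑ j, Complex.I • (lam (w y) (eps (cotwistOne (η y) (coord j)) (pd j v y -
            ((fderiv ℝ η y (realBasis E j) : ℂ) / η y) • antiDeg (v y))) -
          eps (cotwistOne (η y) (coord j)) (pd j (fun z => lam (w z) (v z)) y -
            ((fderiv ℝ η y (realBasis E j) : ℂ) / η y) • antiDeg (lam (w y) (v y)))) =
      Complex.I • (lam (w y) (twistedDbarLoc η v y) -
          twistedDbarLoc η (fun z => lam (w z) (v z)) y) := by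
    rw [twistedDbarLoc, twistedDbarLoc, map_sum, ← Finset.sum_sub_distrib, Finset.smul_sum]
  have h3 : ∑ j, ((Module.finrank ℂ E : ℂ) *
          ((fderiv ℝ η y (realBasis E j) : ℂ) / η y)) • (Complex.I •
            (eps (cotwistOne (η y) (coord j)) (lam (w y) (v y)) -
              lam (w y) (eps (cotwistOne (η y) (coord j)) (v y)))) =
      ((Module.finrank ℂ E : ℂ) / (η y : ℂ)) • (Complex.I •
          ((∑ j, (fderiv ℝ η y (realBasis E j) : ℂ) • eps (cotwistOne (η y) (coord j)))
              (lam (w y) (v y)) -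
            lam (w y) ((∑ j, (fderiv ℝ η y (realBasis E j) : ℂ) •
              eps (cotwistOne (η y) (coord j))) (v y)))) := by
    rw [Op.sum_apply, Op.sum_apply, map_sum, ← Finset.sum_sub_distrib, Finset.smul_sum,
      Finset.smul_sum]
    refine Finset.sum_congr rfl fun j _ => ?_
    rw [Op.smul_apply, Op.smul_apply, map_smul]
    generalize eps (cotwistOne (η y) (coord j)) (lam (w y) (v y)) = A
    generalize lam (w y) (eps (cotwistOne (η y) (coord j)) (v y)) = B
    funext k
    ext a
    change _ * (_ * (A k a - B k a)) = _ * (_ * (_ * A k a - _ * B k a))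
    ring
  rw [h1, h2, h3]
  rfl

end LocalDivergence

/-! ### The candidate adjoint of D_η and the divergence formula on the manifold -/

section GlobalDivergence

variable {E : Type*} [NormedAddCommGroup E] [NormedSpace ℂ E]
  {X : Type*}

theorem wedge_const_smul {p : ℕ} {ρ : Form E X} (h : IsDeg p ρ) (c : ℂ) (u : Form E X) :
    wedge (c • ρ) u = c • wedge ρ u := by
  funext x
  have h' : IsDeg p (c • ρ) := fun z k hk => by
    change c • ρ z k = 0
    rw [h z k hk, alt_smul_zero]
  have h1 := wedge_apply_of_isDeg h' u x
  have h2 : (c • wedge ρ u) x = c • wd p (ρ x p) (u x) :=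
    congrArg (c • ·) (wedge_apply_of_isDeg h u x)
  rw [h1, h2, ← Op.smul_apply, ← map_smul]
  rfl

variable [FiniteDimensional ℂ E] [TopologicalSpace X] [ChartedSpace E X]

theorem twistedDbarLoc_congr {η : E → ℝ} {a b : E → Fib E} {U : Set E} (hU : IsOpen U)
    (h : ∀ z ∈ U, a z = b z) {y : E} (hy : y ∈ U) :
    twistedDbarLoc η a y = twistedDbarLoc η b y := by
  have hpd (j) : pd j a y = pd j b y := by
    funext k
    have h1 : (fun z => a z k) =ᶠ[nhds y] fun z => b z k := by
      filter_upwards [hU.mem_nhds hy] with z hz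
      rw [h z hz]
    rw [pd, pd, h1.fderiv_eq]
  rw [twistedDbarLoc, twistedDbarLoc, h y hy]
  simp only [hpd]

namespace HermitianMetric

variable (g : HermitianMetric E X) (η : X → ℝ)

/-- The torsion operator, in terms of the pointwise adjoint of the Lefschetz operator. -/
def tors (u : Form E X) : Form E X :=
  g.Lam (wedge (twistedD η g.form) u) - wedge (twistedD η g.form) (g.Lam u)

/-- The pointwise adjoint of the torsion operator. -/
def torsAdj (v : Form E X) : Form E X :=
  g.contrForm 3 (twistedD η g.form) (g.lefschetz v) -
    g.lefschetz (g.contrForm 3 (twistedD η g.form) v)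

/-- The operator `-i [Λ, D̄_{-η}] + (n / η) [i d̄_{-η}η ∧ ·, Λ] - τ_η^⋆`. -/
def dAdj (v : Form E X) : Form E X :=
  -(Complex.I • (g.Lam (twistedDbar (-η) v) - twistedDbar (-η) (g.Lam v))) +
    mulForm (fun x => (Module.finrank ℂ E : ℂ) / (η x : ℂ))
      (wedge (Complex.I • twisteddbar (-η) (ofFun E η)) (g.Lam v) -
        g.Lam (wedge (Complex.I • twisteddbar (-η) (ofFun E η)) v)) -
    g.torsAdj η v

/-- The components of the vector field `√det ⟨u, c_j ⌟ v⟩` in the chart `e`. -/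
def flux (e : OpenPartialHomeomorph X E) (u v : Form E X) (j : Fin (Module.finrank ℝ E))
    (y : E) : ℂ :=
  (√(gram (inChart e g.form 2 y)).det : ℂ) * ip (inChart e g.form 2 y)
    (eps (twistOne (η (e.symm y)) (coord j)) (loc X e u y)) (loc X e v y)

theorem inner_tors (u v : Form E X) (x : X) :
    g.inner (g.tors η u) v x = g.inner u (g.torsAdj η v) x := by
  have hd : IsDeg 3 (twistedD η g.form) := g.isDeg_form.twistedD η
  have hL := (g.isHerm x).isAdj_lam.symm (g.isHerm x)
  have h := (hL.mul (isAdj_wd (g.toAlt x) 3 (twistedD η g.form x 3))).sub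
    ((isAdj_wd (g.toAlt x) 3 (twistedD η g.form x 3)).mul hL) (u x) (v x)
  rw [inner_eq, inner_eq]
  refine Eq.trans ?_ (h.trans ?_)
  · congr 1
    change lam (g.toAlt x) (wedge (twistedD η g.form) u x) - wedge (twistedD η g.form) (g.Lam u) x = _
    rw [wedge_apply_of_isDeg hd, wedge_apply_of_isDeg hd]
    rfl
  · congr 1
    change _ = contr (g.toAlt x) 3 (twistedD η g.form x 3) (g.lefschetz v x) -
      g.lefschetz (g.contrForm 3 (twistedD η g.form) v) x
    rw [lefschetz_apply, lefschetz_apply]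
    rfl

variable [IsManifold 𝓘(ℂ, E) ω X] {η}
  (hη : ContMDiff 𝓘(ℝ, E) 𝓘(ℝ, ℝ) ∞ η) (hη0 : ∀ x, η x ≠ 0)
include hη hη0

theorem isSmooth_twistedD_form : IsSmooth (twistedD η g.form) :=
  IsSmooth.twistedD hη hη0 g.smooth

theorem isSmooth_torsAdj {u : Form E X} (hu : IsSmooth u) : IsSmooth (g.torsAdj η u) :=
  (g.isSmooth_contrForm (g.isSmooth_twistedD_form hη hη0) (g.isSmooth_lefschetz hu)).sub
    (g.isSmooth_lefschetz (g.isSmooth_contrForm (g.isSmooth_twistedD_form hη hη0) hu))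

omit [FiniteDimensional ℂ E] in
theorem isSmoothFun_div (c : ℂ) : IsSmoothFun (E := E) (fun x => c / (η x : ℂ)) := by
  intro e he
  have h := contDiffOn_ofReal (contDiffOn_comp_symm (contMDiff_inv hη hη0) he)
  refine (contDiffOn_const.mul h (f := fun _ => c)).congr fun y _ => ?_
  simp [div_eq_mul_inv]

theorem isSmooth_dAdj {u : Form E X} (hu : IsSmooth u) : IsSmooth (g.dAdj η u) := by
  have hb : IsSmooth (twisteddbar (-η) (ofFun E η)) :=
    isSmooth_twisteddbar_ofFun (s := -η) hη.neg hη
  have hw {u : Form E X} (hu : IsSmooth u) :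
      IsSmooth (wedge (Complex.I • twisteddbar (-η) (ofFun E η)) u) := by
    rw [wedge_const_smul (isDeg_twisteddbar_ofFun _ _)]
    exact (hb.wedge (isDeg_twisteddbar_ofFun _ _) hu).const_smul _
  exact (((((g.isSmooth_Lam (IsSmooth.twistedDbar hη hη0 hu)).sub
    (IsSmooth.twistedDbar hη hη0 (g.isSmooth_Lam hu))).const_smul _).neg).add
      (((hw (g.isSmooth_Lam hu)).sub (g.isSmooth_Lam (hw hu))).mulForm
        (isSmoothFun_div hη hη0 _))).sub (g.isSmooth_torsAdj hη hη0 hu)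

variable {e : OpenPartialHomeomorph X E} (he : e ∈ atlas E X) {u v : Form E X}
  (hu : IsSmooth u) (hv : IsSmooth v)
include he hu hv

omit hη0 in
theorem contDiffOn_flux (j : Fin (Module.finrank ℝ E)) :
    ContDiffOn ℝ ∞ (g.flux η e u v j) e.target := by
  have hw := g.contDiffOn_form he
  have hwU : ∀ z ∈ e.target, IsHerm (inChart e g.form 2 z) := fun _ hz => g.isHerm_inChart he hz
  have hc : SmoothFib (fun z => eps (twistOne (η (e.symm z)) (coord j)) (loc X e u z)) e.target := by
    refine smoothOp_eps (fun v => ?_) (loc X e u) (hu e he)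
    exact ((contDiffOn_ofReal (contDiffOn_comp_symm hη he)).mul contDiffOn_const).add
      contDiffOn_const
  exact (contDiffOn_ofReal (contDiffOn_sqrt_det hw hwU)).mul
    (contDiffOn_ip hw hwU hc (v := loc X e v) (hv e he))

/-- The divergence is the density times the pointwise defect of adjointness. The coordinate formula
has the torsion acting on u, whereas `dAdj` contains its adjoint acting on v; `inner_tors` passes
between the two. -/
theorem sum_fderiv_flux {y : E} (hy : y ∈ e.target) :
    ∑ j, fderiv ℝ (g.flux η e u v j) y (realBasis E j) =
      √(gram (inChart e g.form 2 y)).det *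
        (g.inner (twistedD η u) v (e.symm y) - g.inner u (g.dAdj η v) (e.symm y)) := by
  have hw := g.contDiffOn_form he
  have hwU : ∀ z ∈ e.target, IsHerm (inChart e g.form 2 z) := fun _ hz => g.isHerm_inChart he hz
  have h := TwistedForms.sum_fderiv_flux e.open_target hy hw hwU (contDiffOn_comp_symm hη he)
    (hη0 _) (u := loc X e u) (v := loc X e v) (hu e he) (hv e he)
  refine Eq.trans h ?_
  congr 1
  have hb : IsDeg 1 (twisteddbar (-η) (ofFun E η)) := isDeg_twisteddbar_ofFun (E := E) (-η) η
  have h1 : g.inner u (g.dAdj η v) (e.symm y) =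
      -g.inner u (Complex.I • (g.Lam (twistedDbar (-η) v) - twistedDbar (-η) (g.Lam v)))
          (e.symm y) +
        g.inner u (mulForm (fun x => (Module.finrank ℂ E : ℂ) / (η x : ℂ)) (Complex.I •
          (wedge (twisteddbar (-η) (ofFun E η)) (g.Lam v) -
            g.Lam (wedge (twisteddbar (-η) (ofFun E η)) v)))) (e.symm y) -
        g.inner (g.tors η u) v (e.symm y) := by
    have h5 (A B : Form E X) : Complex.I • A - g.Lam (Complex.I • B) =
        Complex.I • (A - g.Lam B) := by
      funext x
      change Complex.I • A x - lam (g.toAlt x) (Complex.I • B x) = Complex.I • (A x - g.Lam B x)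
      rw [map_smul, ← Lam]
      funext k
      ext a
      change _ * A x k a - _ * g.Lam B x k a = _ * (A x k a - g.Lam B x k a)
      ring
    rw [inner_tors, inner_eq, inner_eq, inner_eq, inner_eq, ← ip_neg_right, ← ip_add_right,
      ← ip_sub_right, dAdj, wedge_const_smul hb, wedge_const_smul hb, h5]
    rfl
  rw [h1, g.inner_symm he _ _ hy, g.inner_symm he _ _ hy, g.inner_symm he _ _ hy,
    g.inner_symm he _ _ hy, loc_twistedD hη hη0 hu he hy]
  have h2 : loc X e (g.tors η u) y = (lam (inChart e g.form 2 y) *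
        wd 3 (inChart e (twistedD η g.form) 3 y) -
      wd 3 (inChart e (twistedD η g.form) 3 y) * lam (inChart e g.form 2 y)) (loc X e u y) := by
    rw [tors, loc_sub, g.loc_Lam he _ hy, loc_wedge (g.isDeg_form.twistedD η) _ he hy,
      loc_wedge (g.isDeg_form.twistedD η) _ he hy, g.loc_Lam he _ hy]
    rfl
  have h3 : loc X e (Complex.I • (g.Lam (twistedDbar (-η) v) - twistedDbar (-η) (g.Lam v))) y =
      Complex.I • (lam (inChart e g.form 2 y) (twistedDbarLoc (η ∘ e.symm) (loc X e v) y) -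
        twistedDbarLoc (η ∘ e.symm)
          (fun z => lam (inChart e g.form 2 z) (loc X e v z)) y) := by
    rw [← mulForm_const, loc_mulForm, loc_sub, g.loc_Lam he _ hy, loc_twistedDbar hη hη0 hv he hy,
      loc_twistedDbar hη hη0 (g.isSmooth_Lam hv) he hy,
      twistedDbarLoc_congr e.open_target (fun z hz => g.loc_Lam he v hz) hy]
  have h4 : loc X e (mulForm (fun x => (Module.finrank ℂ E : ℂ) / (η x : ℂ)) (Complex.I •
          (wedge (twisteddbar (-η) (ofFun E η)) (g.Lam v) -
            g.Lam (wedge (twisteddbar (-η) (ofFun E η)) v)))) y =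
      ((Module.finrank ℂ E : ℂ) / (η (e.symm y) : ℂ)) • (Complex.I •
        (wd 1 (inChart e (twisteddbar (-η) (ofFun E η)) 1 y)
            (lam (inChart e g.form 2 y) (loc X e v y)) -
          lam (inChart e g.form 2 y)
            (wd 1 (inChart e (twisteddbar (-η) (ofFun E η)) 1 y) (loc X e v y)))) := by
    rw [loc_mulForm, ← mulForm_const Complex.I, loc_mulForm, loc_sub, loc_wedge hb _ he hy,
      g.loc_Lam he _ hy, g.loc_Lam he _ hy, loc_wedge hb _ he hy]
  rw [h2, h3, h4, inChart_twistedD_form g hη hη0 he hy,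
    wd_inChart_twisteddbar_ofFun (s := η) hη he hy]
  simp only [Function.comp_apply]
  ring

end HermitianMetric

end GlobalDivergence

/-! ### The Gram determinant under a change of variables -/

section Determinant

variable {E : Type*} [NormedAddCommGroup E] [NormedSpace ℂ E] [FiniteDimensional ℂ E]

theorem gram_comp (w : Alt E 2) {A : E →L[ℝ] E} (hA : ∀ (z : ℂ) v, A (z • v) = z • A v) :
    gram (w.compContinuousLinearMap A) =
      (LinearMap.toMatrix (realBasis E) (realBasis E) (A : E →ₗ[ℝ] E)).transpose * gram w *
        LinearMap.toMatrix (realBasis E) (realBasis E) (A : E →ₗ[ℝ] E) := by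
  have hr (a : Fin (Module.finrank ℝ E)) : A (realBasis E a) =
      ∑ c, LinearMap.toMatrix (realBasis E) (realBasis E) (A : E →ₗ[ℝ] E) c a • realBasis E c := by
    simp only [LinearMap.toMatrix_apply]
    exact ((realBasis E).sum_repr _).symm
  ext a b
  rw [gram_apply, metr_comp w hA, hr a, hr b, Matrix.mul_apply]
  simp only [map_sum, map_smul, LinearMap.sum_apply, LinearMap.smul_apply, Matrix.mul_apply,
    Matrix.transpose_apply, gram_apply, smul_eq_mul, Finset.sum_mul, Finset.mul_sum]
  refine Finset.sum_congr rfl fun d _ => Finset.sum_congr rfl fun c _ => ?_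
  ring

theorem sqrt_det_gram_comp (w : Alt E 2) {A : E →L[ℝ] E}
    (hA : ∀ (z : ℂ) v, A (z • v) = z • A v) :
    √(gram (w.compContinuousLinearMap A)).det = |A.det| * √(gram w).det := by
  have h : (gram (w.compContinuousLinearMap A)).det = A.det ^ 2 * (gram w).det := by
    rw [gram_comp w hA, Matrix.det_mul, Matrix.det_mul, Matrix.det_transpose,
      LinearMap.det_toMatrix]
    change A.det * _ * A.det = _
    ring
  rw [h, Real.sqrt_mul (sq_nonneg _), Real.sqrt_sq_eq_abs]

end Determinant

/-! ### The volume measure -/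

section Volume

open MeasureTheory

variable {E : Type*} [NormedAddCommGroup E] [NormedSpace ℂ E] [FiniteDimensional ℂ E]
  {X : Type*} [TopologicalSpace X] [ChartedSpace E X] [IsManifold 𝓘(ℂ, E) ω X]
  (g : HermitianMetric E X)

namespace HermitianMetric

/-- The density of the volume in the chart `e`. -/
def density (e : OpenPartialHomeomorph X E) (y : E) : ℝ := √(gram (inChart e g.form 2 y)).det

variable {e : OpenPartialHomeomorph X E} (he : e ∈ atlas E X)
include he

theorem density_pos {y : E} (hy : y ∈ e.target) : 0 < g.density e y :=
  Real.sqrt_pos.2 (g.isHerm_inChart he hy).det_pos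

theorem continuousOn_density : ContinuousOn (g.density e) e.target :=
  (contDiffOn_sqrt_det (g.contDiffOn_form he)
    (fun _ hy => g.isHerm_inChart he hy)).continuousOn

theorem density_eq {f : OpenPartialHomeomorph X E} (hf : f ∈ atlas E X) {y : E}
    (hy : y ∈ e.target) (hyf : e.symm y ∈ f.source) :
    g.density e y = |(fderiv ℝ (f ∘ e.symm) y).det| * g.density f (f (e.symm y)) := by
  have h := congrFun (loc_eq_pull_transition he hf g.form hy hyf) 2
  rw [density, density, ← sqrt_det_gram_comp _ (isCIso_fderiv_transition he hf hy hyf).1]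
  congr 3

variable [MeasurableSpace E] [BorelSpace E] [MeasurableSpace X] [BorelSpace X]

omit [NormedSpace ℂ E] in
omit [FiniteDimensional ℂ E] [ChartedSpace E X] [IsManifold 𝓘(ℂ, E) ω X] he in
theorem measurableSet_target_inter (e : OpenPartialHomeomorph X E) {A : Set X}
    (hA : MeasurableSet A) : MeasurableSet (e.target ∩ e.symm ⁻¹' A) := by
  have h := (continuousOn_iff_continuous_domRestrict.1 e.continuousOn_symm).measurable hA
  have h1 := e.open_target.measurableSet.subtype_image h
  convert h1 using 1
  ext y
  simp [and_comm]

omit [MeasurableSpace X] [BorelSpace X] in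
theorem aemeasurable_density :
    AEMeasurable (fun y => ENNReal.ofReal (g.density e y))
      ((realBasis E).addHaar.restrict e.target) :=
  ((g.continuousOn_density he).aemeasurable e.open_target.measurableSet).ennreal_ofReal

omit [IsManifold 𝓘(ℂ, E) ω X] in
omit he in
theorem aemeasurable_symm (e : OpenPartialHomeomorph X E) : AEMeasurable e.symm
    (((realBasis E).addHaar.restrict e.target).withDensity fun y =>
      ENNReal.ofReal (g.density e y)) :=
  (e.continuousOn_symm.aemeasurable e.open_target.measurableSet).mono_ac
    (withDensity_absolutelyContinuous _ _)

omit [IsManifold 𝓘(ℂ, E) ω X] in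
omit he in
theorem chartVolume_apply (e : OpenPartialHomeomorph X E) {A : Set X} (hA : MeasurableSet A) :
    g.chartVolume e A =
      ∫⁻ y in e.target ∩ e.symm ⁻¹' A, ENNReal.ofReal (g.density e y) ∂(realBasis E).addHaar := by
  have h : g.chartVolume e A = (((realBasis E).addHaar.restrict e.target).withDensity fun y =>
      ENNReal.ofReal (g.density e y)) (e.symm ⁻¹' A) :=
    Measure.map_apply_of_aemeasurable (g.aemeasurable_symm e) hA
  rw [h, withDensity_apply', Measure.restrict_restrict₀', Set.inter_comm]
  exact e.open_target.measurableSet.nullMeasurableSet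

omit [IsManifold 𝓘(ℂ, E) ω X] in
omit he in
theorem chartVolume_inter_source (e : OpenPartialHomeomorph X E) {A : Set X}
    (hA : MeasurableSet A) : g.chartVolume e (A ∩ e.source) = g.chartVolume e A := by
  rw [g.chartVolume_apply e hA, g.chartVolume_apply e (hA.inter e.open_source.measurableSet)]
  congr 2
  ext y
  simp only [Set.mem_inter_iff, Set.mem_preimage]
  exact ⟨fun h => ⟨h.1, h.2.1⟩, fun h => ⟨h.1, h.2, e.map_target h.1⟩⟩

/-- Change of variables: by `density_eq` the Jacobian of the transition map is the ratio of the two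
densities. -/
theorem chartVolume_eq {f : OpenPartialHomeomorph X E} (hf : f ∈ atlas E X) {A : Set X}
    (hA : MeasurableSet A) (hAe : A ⊆ e.source) (hAf : A ⊆ f.source) :
    g.chartVolume e A = g.chartVolume f A := by
  rw [g.chartVolume_apply e hA, g.chartVolume_apply f hA]
  have hi : f.target ∩ f.symm ⁻¹' A = (f ∘ e.symm) '' (e.target ∩ e.symm ⁻¹' A) := by
    ext z
    simp only [Set.mem_inter_iff, Set.mem_preimage, Set.mem_image, Function.comp_apply]
    constructor
    · rintro ⟨hz, hzA⟩
      refine ⟨e (f.symm z), ⟨e.map_source (hAe hzA), ?_⟩, ?_⟩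
      · rwa [e.left_inv (hAe hzA)]
      · rw [e.left_inv (hAe hzA), f.right_inv hz]
    · rintro ⟨y, ⟨hy, hyA⟩, rfl⟩
      refine ⟨f.map_source (hAf hyA), ?_⟩
      rwa [f.left_inv (hAf hyA)]
  have hm := measurableSet_target_inter e hA
  rw [hi, lintegral_image_eq_lintegral_abs_det_fderiv_mul _ hm
    (f' := fun y => fderiv ℝ (f ∘ e.symm) y)]
  · refine setLIntegral_congr_fun hm fun y hy => ?_
    rw [g.density_eq he hf hy.1 (hAf hy.2), ENNReal.ofReal_mul (abs_nonneg _)]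
    rfl
  · intro y hy
    have h := (contDiffAt_transition he hf hy.1 (hAf hy.2)).restrict_scalars ℝ
    exact (h.differentiableAt (by simp)).hasFDerivAt.hasFDerivWithinAt
  · intro y hy z hz hyz
    have h := f.injOn (hAf hy.2) (hAf hz.2) hyz
    exact e.symm.injOn hy.1 hz.1 h

/-- A supremum of measures is not computed set by set, so the upper bound comes from a measure
dominating all chart volumes: `chartVolume e` inside the domain of `e` plus the largest measure
outside it. -/
theorem restrict_vol : g.vol.restrict e.source = g.chartVolume e := by
  have hle : g.chartVolume e ≤ g.vol := le_iSup (fun f : atlas E X => g.chartVolume f.1) ⟨e, he⟩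
  have hge : g.vol ≤ g.chartVolume e + (⊤ : Measure X).restrict e.sourceᶜ := by
    refine iSup_le fun f => Measure.le_iff.2 fun A hA => ?_
    have hs := e.open_source.measurableSet
    rw [← measure_inter_add_sdiff A hs, Measure.add_apply]
    refine add_le_add ?_ ?_
    · rw [← g.chartVolume_inter_source f.1 (hA.inter hs)]
      rw [← g.chartVolume_eq he f.2 ((hA.inter hs).inter f.1.open_source.measurableSet)
        (fun x hx => hx.1.2) (fun x hx => hx.2)]
      exact measure_mono fun x hx => hx.1.1
    · rw [Measure.restrict_apply hA, ← Set.sdiff_eq]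
      exact (le_top : g.chartVolume f.1 ≤ ⊤) _
  refine Measure.ext fun A hA => ?_
  have hs := e.open_source.measurableSet
  rw [Measure.restrict_apply hA, ← g.chartVolume_inter_source e hA]
  refine le_antisymm ?_ (hle _)
  refine (hge _).trans ?_
  rw [Measure.add_apply, Measure.restrict_apply (hA.inter hs)]
  have h : A ∩ e.source ∩ e.sourceᶜ = ∅ := by
    ext x
    simp
  rw [h, measure_empty, add_zero]

omit he

/-- The density is integrable on a compact neighbourhood in a chart. This makes continuous functions
with compact support integrable. -/
instance isLocallyFiniteMeasure_vol : IsLocallyFiniteMeasure g.vol := by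
  refine ⟨fun x => ?_⟩
  have he := chart_mem_atlas E x
  obtain ⟨K, hK, hxK, hKt⟩ := exists_compact_subset (chartAt E x).open_target
    (mem_chart_target E x)
  have ho : IsOpen ((chartAt E x).source ∩ chartAt E x ⁻¹' interior K) :=
    (chartAt E x).isOpen_inter_preimage isOpen_interior
  refine ⟨_, ho.mem_nhds ⟨mem_chart_source E x, hxK⟩, ?_⟩
  rw [← Measure.restrict_eq_self g.vol Set.inter_subset_left, g.restrict_vol he,
    g.chartVolume_apply _ ho.measurableSet]
  have hi : IntegrableOn (g.density (chartAt E x)) K (realBasis E).addHaar :=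
    ((g.continuousOn_density he).mono hKt).integrableOn_compact hK
  refine lt_of_le_of_lt (lintegral_mono_set fun y hy => ?_) hi.lintegral_lt_top
  have h := hy.2.2
  rw [Set.mem_preimage, (chartAt E x).right_inv hy.1] at h
  exact interior_subset h

/-- The density is positive in every chart. This is what makes formal adjoints unique: a continuous
function that vanishes almost everywhere vanishes. -/
instance isOpenPosMeasure_vol : Measure.IsOpenPosMeasure g.vol := by
  refine ⟨fun U hU hne h0 => ?_⟩
  obtain ⟨x, hx⟩ := hne
  have he := chart_mem_atlas E x
  have h1 : g.chartVolume (chartAt E x) U = 0 := by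
    rw [← g.restrict_vol he]
    exact le_antisymm ((Measure.restrict_apply_le _ _).trans h0.le) zero_le
  rw [g.chartVolume_apply _ hU.measurableSet] at h1
  have ho : IsOpen ((chartAt E x).target ∩ (chartAt E x).symm ⁻¹' U) :=
    (chartAt E x).isOpen_inter_preimage_symm hU
  have hm : AEMeasurable (fun y => ENNReal.ofReal (g.density (chartAt E x) y))
      ((realBasis E).addHaar.restrict ((chartAt E x).target ∩ (chartAt E x).symm ⁻¹' U)) :=
    (g.aemeasurable_density he).mono_measure (Measure.restrict_mono_set _ Set.inter_subset_left)
  rw [lintegral_eq_zero_iff' hm, Filter.EventuallyEq, ae_restrict_iff' ho.measurableSet] at h1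
  refine (ho.measure_pos (realBasis E).addHaar ⟨chartAt E x x, mem_chart_target E x, ?_⟩).ne' ?_
  · rwa [Set.mem_preimage, (chartAt E x).left_inv (mem_chart_source E x)]
  · rw [measure_eq_zero_iff_ae_notMem]
    filter_upwards [h1] with y hy hyU
    have h := ENNReal.ofReal_eq_zero.1 (hy hyU)
    exact absurd (g.density_pos he hyU.1) (not_lt.2 h)

include he in
theorem integral_vol {F : X → ℂ} (hF : ∀ x ∉ e.source, F x = 0)
    (hFm : AEStronglyMeasurable F g.vol) :
    ∫ x, F x ∂g.vol = ∫ y in e.target, (g.density e y : ℂ) * F (e.symm y) ∂(realBasis E).addHaar := by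
  rw [← setIntegral_eq_integral_of_forall_compl_eq_zero hF, g.restrict_vol he]
  have hFm' : AEStronglyMeasurable F (g.chartVolume e) := by
    rw [← g.restrict_vol he]
    exact hFm.restrict
  have h1 : ∫ x, F x ∂g.chartVolume e = ∫ y, F (e.symm y)
      ∂(((realBasis E).addHaar.restrict e.target).withDensity fun y =>
        ENNReal.ofReal (g.density e y)) := integral_map (g.aemeasurable_symm e) hFm'
  rw [h1, integral_withDensity_eq_integral_toReal_smul₀ (g.aemeasurable_density he)
    (Filter.Eventually.of_forall fun _ => ENNReal.ofReal_lt_top)]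
  refine integral_congr_ae (Filter.Eventually.of_forall fun y => ?_)
  dsimp only
  rw [ENNReal.toReal_ofReal (show 0 ≤ g.density e y from Real.sqrt_nonneg _), Complex.real_smul]

end HermitianMetric

end Volume

/-! ### The divergence theorem in a vector space -/

section Divergence

open MeasureTheory

variable {V : Type*} [NormedAddCommGroup V] [NormedSpace ℝ V] [FiniteDimensional ℝ V]
  [MeasurableSpace V] [BorelSpace V] (μ : Measure V) [μ.IsAddHaarMeasure]

/-- Integration by parts against the constant function 1. -/
theorem integral_fderiv_eq_zero {G : V → ℂ} (hG : ContDiff ℝ 1 G) (hc : HasCompactSupport G)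
    (v : V) : ∫ y, fderiv ℝ G y v ∂μ = 0 := by
  have hd : Differentiable ℝ G := hG.differentiable one_ne_zero
  have hi : Integrable (fun y => fderiv ℝ G y v) μ :=
    ((hG.continuous_fderiv one_ne_zero).clm_apply continuous_const).integrable_of_hasCompactSupport
      (hc.fderiv_apply ℝ v)
  have h := integral_mul_fderiv_eq_neg_fderiv_mul_of_integrable (μ := μ) (f := fun _ => (1 : ℂ))
    (g := G) (v := v) (by simp) (by simpa using hi)
    (by simpa using hG.continuous.integrable_of_hasCompactSupport hc)
    (fun _ _ => differentiableAt_const _) (fun x _ => hd x)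
  simpa using h

/-- The flux is controlled only on the target of a chart. Its extension by zero is C¹ on the whole
space, because it already vanishes off a compact subset of `U`. -/
theorem setIntegral_fderiv_eq_zero {G : V → ℂ} {U K : Set V} (hU : IsOpen U) (hK : IsCompact K)
    (hKU : K ⊆ U) (hG : ContDiffOn ℝ ∞ G U) (h0 : ∀ y ∈ U, y ∉ K → G y = 0) (v : V) :
    ∫ y in U, fderiv ℝ G y v ∂μ = 0 ∧ IntegrableOn (fun y => fderiv ℝ G y v) U μ := by
  have hin : ∀ y ∈ U, U.indicator G =ᶠ[nhds y] G := fun y hy => by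
    filter_upwards [hU.mem_nhds hy] with z hz using Set.indicator_of_mem hz G
  have hz : ∀ y ∉ K, U.indicator G y = 0 := fun y hy => by
    by_cases hyU : y ∈ U
    · rw [Set.indicator_of_mem hyU, h0 y hyU hy]
    · exact Set.indicator_of_notMem hyU G
  have hout : ∀ y ∉ K, U.indicator G =ᶠ[nhds y] fun _ => 0 := fun y hy => by
    filter_upwards [hK.isClosed.isOpen_compl.mem_nhds hy] with z hz' using hz z hz'
  have hs : ContDiff ℝ 1 (U.indicator G) := by
    rw [contDiff_iff_contDiffAt]
    intro y
    by_cases hy : y ∈ U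
    · exact ((hG.contDiffAt (hU.mem_nhds hy)).of_le (by simp)).congr_of_eventuallyEq (hin y hy)
    · exact contDiffAt_const.congr_of_eventuallyEq (hout y fun h => hy (hKU h))
  have hc : HasCompactSupport (U.indicator G) := HasCompactSupport.intro hK hz
  have he : ∀ y ∈ U, fderiv ℝ G y v = fderiv ℝ (U.indicator G) y v := fun y hy => by
    rw [(hin y hy).fderiv_eq]
  have hi : Integrable (fun y => fderiv ℝ (U.indicator G) y v) μ :=
    ((hs.continuous_fderiv one_ne_zero).clm_apply continuous_const).integrable_of_hasCompactSupport
      (hc.fderiv_apply ℝ v)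
  constructor
  · rw [setIntegral_congr_fun hU.measurableSet he,
      setIntegral_eq_integral_of_forall_compl_eq_zero, integral_fderiv_eq_zero μ hs hc v]
    intro y hy
    rw [(hout y fun h => hy (hKU h)).fderiv_eq]
    simp
  · exact (integrableOn_congr_fun he hU.measurableSet).2 hi.integrableOn

end Divergence

/-! ### Formal adjointness when one form is supported in a chart -/

section Green

open MeasureTheory

variable {E : Type*} [NormedAddCommGroup E] [NormedSpace ℂ E] [FiniteDimensional ℂ E]
  {X : Type*} [TopologicalSpace X] [ChartedSpace E X] [IsManifold 𝓘(ℂ, E) ω X]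
  (g : HermitianMetric E X)

omit [IsManifold 𝓘(ℂ, E) ω X] in
omit [FiniteDimensional ℂ E] in
theorem twistedDbar_eq_zero {u : Form E X} {x : X} (h : ∀ᶠ z in nhds x, u z = 0) (η : X → ℝ) :
    twistedDbar η u x = 0 := by
  have h1 : ∀ᶠ z in nhds x, conjForm u z = 0 := h.mono fun z hz => by
    rw [conjForm_apply, hz, conjF_zero]
  rw [twistedDbar, conjOp, conjForm_apply, twistedD_eq_zero h1, conjF_zero]

namespace HermitianMetric

theorem continuous_inner {u v : Form E X} (hu : IsSmooth u) (hv : IsSmooth v) :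
    Continuous (g.inner u v) := by
  refine continuous_iff_continuousAt.2 fun x => ?_
  have he := chart_mem_atlas E x
  have h1 : ContinuousOn (fun y => ip (inChart (chartAt E x) g.form 2 y)
      (loc X (chartAt E x) u y) (loc X (chartAt E x) v y)) (chartAt E x).target :=
    (contDiffOn_ip (g.contDiffOn_form he) (fun _ hy => g.isHerm_inChart he hy)
      (u := loc X (chartAt E x) u) (v := loc X (chartAt E x) v) (hu _ he) (hv _ he)).continuousOn
  have h2 := (h1.comp (chartAt E x).continuousOn (chartAt E x).mapsTo).continuousAt
    ((chartAt E x).open_source.mem_nhds (mem_chart_source E x))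
  refine h2.congr ?_
  filter_upwards [(chartAt E x).open_source.mem_nhds (mem_chart_source E x)] with z hz
  rw [Function.comp_apply, ← g.inner_symm he u v ((chartAt E x).map_source hz),
    (chartAt E x).left_inv hz]

variable {η : X → ℝ}

omit [IsManifold 𝓘(ℂ, E) ω X] in
theorem Lam_eq_zero {u : Form E X} {x : X} (h : u x = 0) : g.Lam u x = 0 := by
  rw [Lam, h, map_zero]

omit [IsManifold 𝓘(ℂ, E) ω X] in
theorem contrForm_eq_zero {u : Form E X} {x : X} (h : u x = 0) (p : ℕ) (ρ : Form E X) :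
    g.contrForm p ρ u x = 0 := by
  rw [contrForm, h, map_zero]

omit [TopologicalSpace X] [ChartedSpace E X] in
omit [FiniteDimensional ℂ E] [IsManifold 𝓘(ℂ, E) ω X] in
theorem _root_.TwistedForms.wedge_eq_zero {u : Form E X} {x : X} (h : u x = 0) {p : ℕ}
    {ρ : Form E X} (hρ : IsDeg p ρ) : wedge ρ u x = 0 := by
  rw [wedge_apply_of_isDeg hρ, h, map_zero]

omit [IsManifold 𝓘(ℂ, E) ω X] in
theorem dAdj_eq_zero {v : Form E X} {x : X} (h : ∀ᶠ z in nhds x, v z = 0) :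
    g.dAdj η v x = 0 := by
  have hx := h.self_of_nhds
  have hb : IsDeg 1 (twisteddbar (-η) (ofFun E η)) := isDeg_twisteddbar_ofFun (E := E) (-η) η
  have h1 : twistedDbar (-η) (g.Lam v) x = 0 :=
    twistedDbar_eq_zero (h.mono fun z hz => g.Lam_eq_zero hz) _
  have h2 : g.Lam (twistedDbar (-η) v) x = 0 := g.Lam_eq_zero (twistedDbar_eq_zero h _)
  have hI : IsDeg 1 (Complex.I • twisteddbar (-η) (ofFun E η)) := fun z k hk => by
    change Complex.I • twisteddbar (-η) (ofFun E η) z k = 0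
    rw [hb z k hk, alt_smul_zero]
  have h3 : wedge (Complex.I • twisteddbar (-η) (ofFun E η)) (g.Lam v) x = 0 :=
    wedge_eq_zero (g.Lam_eq_zero hx) hI
  have h4 : g.Lam (wedge (Complex.I • twisteddbar (-η) (ofFun E η)) v) x = 0 :=
    g.Lam_eq_zero (wedge_eq_zero hx hI)
  have h5 : g.contrForm 3 (twistedD η g.form) (g.lefschetz v) x = 0 :=
    g.contrForm_eq_zero (wedge_eq_zero hx g.isDeg_form) _ _
  have h6 : g.lefschetz (g.contrForm 3 (twistedD η g.form) v) x = 0 :=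
    wedge_eq_zero (g.contrForm_eq_zero hx _ _) g.isDeg_form
  funext k
  have h1 := congrFun h1 k
  have h2 := congrFun h2 k
  have h3 := congrFun h3 k
  have h4 := congrFun h4 k
  have h5 := congrFun h5 k
  have h6 := congrFun h6 k
  change -(Complex.I • (g.Lam (twistedDbar (-η) v) x k - twistedDbar (-η) (g.Lam v) x k)) +
    ((Module.finrank ℂ E : ℂ) / (η x : ℂ)) •
      (wedge (Complex.I • twisteddbar (-η) (ofFun E η)) (g.Lam v) x k -
        g.Lam (wedge (Complex.I • twisteddbar (-η) (ofFun E η)) v) x k) -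
    (g.contrForm 3 (twistedD η g.form) (g.lefschetz v) x k -
      g.lefschetz (g.contrForm 3 (twistedD η g.form) v) x k) = (0 : Alt E k)
  rw [h1, h2, h3, h4, h5, h6]
  change -(Complex.I • ((0 : Alt E k) - 0)) + _ • ((0 : Alt E k) - 0) - ((0 : Alt E k) - 0) = 0
  rw [sub_zero, alt_smul_zero, alt_smul_zero, neg_zero, add_zero, sub_zero]

variable [T2Space X] [MeasurableSpace E] [BorelSpace E] [MeasurableSpace X] [BorelSpace X]

theorem integrable_inner {u v : Form E X} (hu : IsSmooth u) (hv : IsSmooth v) {K : Set X}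
    (hK : IsCompact K) (h0 : ∀ x ∉ K, u x = 0 ∨ v x = 0) : Integrable (g.inner u v) g.vol := by
  refine (g.continuous_inner hu hv).integrable_of_hasCompactSupport
    (HasCompactSupport.intro hK fun x hx => ?_)
  rw [inner_eq]
  rcases h0 x hx with h | h
  · rw [h, ip_zero_left]
  · rw [h, ip_zero_right]

variable (hη : ContMDiff 𝓘(ℝ, E) 𝓘(ℝ, ℝ) ∞ η) (hη0 : ∀ x, η x ≠ 0)
include hη hη0

/-- The difference of the two integrands is supported in the chart, where it is the divergence of a
flux that vanishes off the image of `K`, whichever of the two forms is supported there. -/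
theorem l2Inner_twistedD_of_chart {e : OpenPartialHomeomorph X E} (he : e ∈ atlas E X)
    {u v : Form E X} (hu : IsSmooth u) (hv : IsSmooth v) {K : Set X} (hK : IsCompact K)
    (hKe : K ⊆ e.source) (h0 : (∀ x ∉ K, u x = 0) ∨ ∀ x ∉ K, v x = 0) :
    g.l2Inner (twistedD η u) v = g.l2Inner u (g.dAdj η v) := by
  have hnear {a : Form E X} (ha : ∀ x ∉ K, a x = 0) {x : X} (hx : x ∉ K) :
      ∀ᶠ z in nhds x, a z = 0 := by
    filter_upwards [hK.isClosed.isOpen_compl.mem_nhds hx] with z hz using ha z hz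
  have hD := IsSmooth.twistedD hη hη0 hu
  have hS := g.isSmooth_dAdj hη hη0 hv
  have h1 : ∀ x ∉ K, twistedD η u x = 0 ∨ v x = 0 := fun x hx =>
    h0.imp (fun h => twistedD_eq_zero (hnear h hx) η) fun h => h x hx
  have h2 : ∀ x ∉ K, u x = 0 ∨ g.dAdj η v x = 0 := fun x hx =>
    h0.imp (fun h => h x hx) fun h => g.dAdj_eq_zero (hnear h hx)
  have i1 := g.integrable_inner hD hv hK h1
  have i2 := g.integrable_inner hu hS hK h2
  rw [l2Inner, l2Inner, ← sub_eq_zero, ← integral_sub i1 i2]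
  have hF : ∀ x ∉ e.source, g.inner (twistedD η u) v x - g.inner u (g.dAdj η v) x = 0 := by
    intro x hx
    have hxK : x ∉ K := fun h => hx (hKe h)
    rw [inner_eq, inner_eq]
    have a1 : ip (g.toAlt x) (twistedD η u x) (v x) = 0 := by
      rcases h1 x hxK with h | h <;> rw [h]
      exacts [ip_zero_left _ _, ip_zero_right _ _]
    have a2 : ip (g.toAlt x) (u x) (g.dAdj η v x) = 0 := by
      rcases h2 x hxK with h | h <;> rw [h]
      exacts [ip_zero_left _ _, ip_zero_right _ _]
    rw [a1, a2, sub_zero]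
  rw [g.integral_vol he hF (i1.sub i2).aestronglyMeasurable]
  refine (setIntegral_congr_fun e.open_target.measurableSet
      fun y hy => (g.sum_fderiv_flux hη hη0 he hu hv hy).symm).trans ?_
  have hKc : IsCompact (e '' K) := hK.image_of_continuousOn (e.continuousOn.mono hKe)
  have hKt : e '' K ⊆ e.target := by
    rintro _ ⟨x, hx, rfl⟩
    exact e.map_source (hKe hx)
  have hfl (j) : ∀ y ∈ e.target, y ∉ e '' K → g.flux η e u v j y = 0 := by
    intro y hy hyK
    have hx : e.symm y ∉ K := fun h => hyK ⟨_, h, e.right_inv hy⟩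
    rw [flux]
    rcases h0 with h | h
    · rw [loc_eq_pull he u hy, h _ hx, map_zero, map_zero, ip_zero_left, mul_zero]
    · rw [loc_eq_pull he v hy, h _ hx, map_zero, ip_zero_right, mul_zero]
  have hj (j) := setIntegral_fderiv_eq_zero (realBasis E).addHaar e.open_target hKc hKt
    (g.contDiffOn_flux hη he hu hv j) (hfl j) (realBasis E j)
  rw [integral_finsetSum _ fun j _ => (hj j).2]
  exact Finset.sum_eq_zero fun j _ => (hj j).1

end HermitianMetric

end Green

/-! ### From one chart to the manifold by a partition of unity -/

section Globalization

open MeasureTheory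

variable {E : Type*} [NormedAddCommGroup E] [NormedSpace ℂ E]
  {X : Type*} [TopologicalSpace X] [ChartedSpace E X]

omit [TopologicalSpace X] [ChartedSpace E X] in
theorem wedge_add {p : ℕ} {ρ : Form E X} (h : IsDeg p ρ) (u v : Form E X) :
    wedge ρ (u + v) = wedge ρ u + wedge ρ v := by
  funext x
  have h1 : (wedge ρ u + wedge ρ v) x = wedge ρ u x + wedge ρ v x := rfl
  rw [h1, wedge_apply_of_isDeg h, wedge_apply_of_isDeg h, wedge_apply_of_isDeg h]
  exact map_add (wd p (ρ x p)) (u x) (v x)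

omit [TopologicalSpace X] [ChartedSpace E X] in
theorem conjForm_add (u v : Form E X) : conjForm (u + v) = conjForm u + conjForm v :=
  funext fun x => conjF_add (u x) (v x)

omit [ChartedSpace E X] in
theorem hasCompactSupport_of {u : Form E X} {T : Form E X → Form E X}
    (hT : ∀ x, (∀ᶠ z in nhds x, u z = 0) → T u x = 0) (hu : HasCompactSupport u) :
    HasCompactSupport (T u) := by
  refine hu.mono' fun x hx => ?_
  by_contra h
  exact hx (hT x (notMem_tsupport_iff_eventuallyEq.1 h))

variable [FiniteDimensional ℂ E]

namespace HermitianMetric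

variable (g : HermitianMetric E X)

theorem Lam_add (u v : Form E X) : g.Lam (u + v) = g.Lam u + g.Lam v :=
  funext fun x => map_add (lam (g.toAlt x)) (u x) (v x)

theorem contrForm_add (p : ℕ) (ρ u v : Form E X) :
    g.contrForm p ρ (u + v) = g.contrForm p ρ u + g.contrForm p ρ v :=
  funext fun x => map_add (contr (g.toAlt x) p (ρ x p)) (u x) (v x)

variable [IsManifold 𝓘(ℂ, E) ω X] {η : X → ℝ}
  (hη : ContMDiff 𝓘(ℝ, E) 𝓘(ℝ, ℝ) ∞ η) (hη0 : ∀ x, η x ≠ 0)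
include hη hη0

omit g in
theorem _root_.TwistedForms.twistedDbar_add {u v : Form E X} (hu : IsSmooth u) (hv : IsSmooth v) :
    twistedDbar (-η) (u + v) = twistedDbar (-η) u + twistedDbar (-η) v := by
  rw [twistedDbar, conjOp, conjOp, conjOp, conjForm_add,
    twistedD_add (η := -η) hη.neg (fun x => neg_ne_zero.2 (hη0 x)) hu.conjForm hv.conjForm,
    conjForm_add]

theorem dAdj_add {u v : Form E X} (hu : IsSmooth u) (hv : IsSmooth v) :
    g.dAdj η (u + v) = g.dAdj η u + g.dAdj η v := by
  have hb : IsDeg 1 (twisteddbar (-η) (ofFun E η)) := isDeg_twisteddbar_ofFun (E := E) (-η) η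
  rw [dAdj, dAdj, dAdj, torsAdj, torsAdj, torsAdj, wedge_const_smul hb, wedge_const_smul hb,
    wedge_const_smul hb, wedge_const_smul hb, wedge_const_smul hb, wedge_const_smul hb,
    twistedDbar_add hη hη0 hu hv, Lam_add, Lam_add,
    twistedDbar_add hη hη0 (g.isSmooth_Lam hu) (g.isSmooth_Lam hv), wedge_add hb, wedge_add hb,
    lefschetz, wedge_add g.isDeg_form, contrForm_add, contrForm_add, wedge_add g.isDeg_form]
  have h1 (a b : Form E X) : g.Lam (Complex.I • (a + b)) =
      g.Lam (Complex.I • a) + g.Lam (Complex.I • b) := by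
    rw [← Lam_add]
    congr 1
    funext x k
    ext w
    exact mul_add _ (a x k w) (b x k w)
  rw [h1]
  funext x k
  ext w
  simp only [mulForm, Pi.add_apply, Pi.sub_apply, Pi.neg_apply, Pi.smul_apply,
    ContinuousAlternatingMap.add_apply, ContinuousAlternatingMap.sub_apply,
    ContinuousAlternatingMap.neg_apply, ContinuousAlternatingMap.smul_apply, smul_eq_mul]
  ring

end HermitianMetric

section Partition

variable [IsManifold 𝓘(ℂ, E) ω X] [T2Space X] [SecondCountableTopology X]

/-- A property of the compactly supported smooth forms follows from the case of the forms with
support in the domain of a chart. -/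
theorem compact_induction {P : Form E X → Prop} (zero : P 0)
    (add : ∀ u v, IsSmooth u → IsSmooth v → HasCompactSupport u → HasCompactSupport v →
      P u → P v → P (u + v))
    (chart : ∀ e ∈ atlas E X, ∀ K ⊆ e.source, IsCompact K → ∀ u, IsSmooth u →
      (∀ x ∉ K, u x = 0) → P u) {u : Form E X} (hu : IsSmooth u) (hc : HasCompactSupport u) :
    P u := by
  have : LocallyCompactSpace X := ChartedSpace.locallyCompactSpace E X
  obtain ⟨f, hf⟩ := SmoothPartitionOfUnity.exists_isSubordinate_chartAt_source_of_isClosed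
    (I := 𝓘(ℝ, E)) (isClosed_tsupport u)
  have hfin : {i | (Function.support (f i) ∩ tsupport u).Nonempty}.Finite :=
    f.locallyFinite.finite_nonempty_inter_compact hc
  have hsum : u = ∑ i ∈ hfin.toFinset, mulForm (fun x => ((f i x : ℝ) : ℂ)) u := by
    funext x
    rw [Finset.sum_apply]
    by_cases hx : x ∈ tsupport u
    · have h1 := f.sum_eq_one hx
      have hsub : (Function.support fun i => f i x) ⊆ hfin.toFinset := by
        intro i hi
        rw [Finset.mem_coe, Set.Finite.mem_toFinset]
        exact ⟨x, hi, hx⟩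
      rw [finsum_eq_sum_of_support_subset _ hsub] at h1
      funext k
      rw [Finset.sum_apply]
      change u x k = ∑ i ∈ hfin.toFinset, ((f i x : ℝ) : ℂ) • u x k
      rw [← Finset.sum_smul, ← Complex.ofReal_sum, h1, Complex.ofReal_one, one_smul]
    · have h0 : u x = 0 := image_eq_zero_of_notMem_tsupport hx
      rw [h0]
      symm
      refine Finset.sum_eq_zero fun i _ => ?_
      funext k
      change ((f i x : ℝ) : ℂ) • u x k = 0
      rw [h0]
      exact alt_smul_zero _
  have hs (i) : IsSmooth (mulForm (fun x => ((f i x : ℝ) : ℂ)) u) :=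
    hu.mulForm (isSmoothFun_ofReal (f i).contMDiff)
  have hz (i) : ∀ x ∉ tsupport (f i) ∩ tsupport u, mulForm (fun x => ((f i x : ℝ) : ℂ)) u x = 0 := by
    intro x hx
    funext k
    change ((f i x : ℝ) : ℂ) • u x k = 0
    by_cases h1 : x ∈ tsupport u
    · have h2 : f i x = 0 := image_eq_zero_of_notMem_tsupport fun h => hx ⟨h, h1⟩
      rw [h2, Complex.ofReal_zero]
      exact alt_zero_smul _
    · rw [image_eq_zero_of_notMem_tsupport h1]
      exact alt_smul_zero _
  have hK (i) : IsCompact (tsupport (f i) ∩ tsupport u) :=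
    IsCompact.inter_left hc (isClosed_tsupport _)
  rw [hsum]
  refine (Finset.sum_induction _ (fun w => P w ∧ IsSmooth w ∧ HasCompactSupport w)
    (fun a b ha hb => ⟨add a b ha.2.1 hb.2.1 ha.2.2 hb.2.2 ha.1 hb.1, ha.2.1.add hb.2.1,
      ha.2.2.add hb.2.2⟩) ⟨zero, isSmooth_zero, HasCompactSupport.zero⟩ fun i _ => ?_).1
  exact ⟨chart _ (chart_mem_atlas E _) _ (Set.inter_subset_left.trans (hf i)) (hK i) _ (hs i)
    (hz i), hs i, HasCompactSupport.intro (hK i) (hz i)⟩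

end Partition

namespace HermitianMetric

variable (g : HermitianMetric E X) [IsManifold 𝓘(ℂ, E) ω X] [T2Space X]
  [MeasurableSpace E] [BorelSpace E] [MeasurableSpace X] [BorelSpace X]

theorem integrable_inner' {u v : Form E X} (hu : IsSmooth u) (hv : IsSmooth v)
    (h : HasCompactSupport u ∨ HasCompactSupport v) : Integrable (g.inner u v) g.vol := by
  rcases h with h | h
  · exact g.integrable_inner hu hv h fun x hx => Or.inl (image_eq_zero_of_notMem_tsupport hx)
  · exact g.integrable_inner hu hv h fun x hx => Or.inr (image_eq_zero_of_notMem_tsupport hx)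

theorem l2Inner_add_left {u u' v : Form E X} (hu : IsSmooth u) (hu' : IsSmooth u')
    (hv : IsSmooth v) (h : HasCompactSupport u ∨ HasCompactSupport v)
    (h' : HasCompactSupport u' ∨ HasCompactSupport v) :
    g.l2Inner (u + u') v = g.l2Inner u v + g.l2Inner u' v := by
  rw [l2Inner, l2Inner, l2Inner, ← integral_add (g.integrable_inner' hu hv h)
    (g.integrable_inner' hu' hv h')]
  refine integral_congr_ae (Filter.Eventually.of_forall fun x => ?_)
  exact ip_add_left _ _ _ _

theorem l2Inner_add_right {u v v' : Form E X} (hu : IsSmooth u) (hv : IsSmooth v)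
    (hv' : IsSmooth v') (h : HasCompactSupport u ∨ HasCompactSupport v)
    (h' : HasCompactSupport u ∨ HasCompactSupport v') :
    g.l2Inner u (v + v') = g.l2Inner u v + g.l2Inner u v' := by
  rw [l2Inner, l2Inner, l2Inner, ← integral_add (g.integrable_inner' hu hv h)
    (g.integrable_inner' hu hv' h')]
  refine integral_congr_ae (Filter.Eventually.of_forall fun x => ?_)
  exact ip_add_right _ _ _ _

omit [BorelSpace X] in
omit [IsManifold 𝓘(ℂ, E) ω X] [T2Space X] in
theorem l2Inner_zero_left (v : Form E X) : g.l2Inner 0 v = 0 := by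
  have h : g.inner 0 v = fun _ => 0 := funext fun x => ip_zero_left _ _
  rw [l2Inner, h, integral_zero]

omit [BorelSpace X] in
omit [IsManifold 𝓘(ℂ, E) ω X] [T2Space X] in
theorem l2Inner_zero_right (v : Form E X) : g.l2Inner v 0 = 0 := by
  have h : g.inner v 0 = fun _ => 0 := funext fun x => ip_zero_right _ _
  rw [l2Inner, h, integral_zero]

variable [SecondCountableTopology X] {η : X → ℝ}
  (hη : ContMDiff 𝓘(ℝ, E) 𝓘(ℝ, ℝ) ∞ η) (hη0 : ∀ x, η x ≠ 0)
include hη hη0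

/-- The operator `D_η` and its formal adjoint. -/
theorem l2Inner_twistedD {u v : Form E X} (hu : IsSmooth u) (hv : IsSmooth v)
    (hc : HasCompactSupport u ∨ HasCompactSupport v) :
    g.l2Inner (twistedD η u) v = g.l2Inner u (g.dAdj η v) := by
  have hD {a : Form E X} (ha : HasCompactSupport a) : HasCompactSupport (twistedD η a) :=
    hasCompactSupport_of (fun _ h => twistedD_eq_zero h η) ha
  have hS {a : Form E X} (ha : HasCompactSupport a) : HasCompactSupport (g.dAdj η a) :=
    hasCompactSupport_of (fun _ h => g.dAdj_eq_zero h) ha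
  -- Only the compactly supported one of the two forms is decomposed; the other may have arbitrary
  -- support.
  rcases hc with hc | hc
  · refine compact_induction (P := fun u => g.l2Inner (twistedD η u) v = g.l2Inner u (g.dAdj η v))
      ?_ ?_ ?_ hu hc
    · have h : twistedD η (0 : Form E X) = 0 :=
        funext fun x => twistedD_eq_zero (Filter.Eventually.of_forall fun _ => rfl) η
      rw [h, l2Inner_zero_left, l2Inner_zero_left]
    · intro a b ha hb hca hcb h1 h2
      rw [twistedD_add hη hη0 ha hb, g.l2Inner_add_left (IsSmooth.twistedD hη hη0 ha)
        (IsSmooth.twistedD hη hη0 hb) hv (Or.inl (hD hca)) (Or.inl (hD hcb)),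
        g.l2Inner_add_left ha hb (g.isSmooth_dAdj hη hη0 hv) (Or.inl hca) (Or.inl hcb), h1, h2]
    · intro e he K hK hKc a ha hz
      exact g.l2Inner_twistedD_of_chart hη hη0 he ha hv hKc hK (Or.inl hz)
  · refine compact_induction (P := fun v => g.l2Inner (twistedD η u) v = g.l2Inner u (g.dAdj η v))
      ?_ ?_ ?_ hv hc
    · have h : g.dAdj η (0 : Form E X) = 0 :=
        funext fun x => g.dAdj_eq_zero (Filter.Eventually.of_forall fun _ => rfl)
      rw [h, l2Inner_zero_right, l2Inner_zero_right]
    · intro a b ha hb hca hcb h1 h2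
      rw [g.dAdj_add hη hη0 ha hb, g.l2Inner_add_right (IsSmooth.twistedD hη hη0 hu) ha hb
        (Or.inr hca) (Or.inr hcb), g.l2Inner_add_right hu (g.isSmooth_dAdj hη hη0 ha)
        (g.isSmooth_dAdj hη hη0 hb) (Or.inr (hS hca)) (Or.inr (hS hcb)), h1, h2]
    · intro e he K hK hKc a ha hz
      exact g.l2Inner_twistedD_of_chart hη hη0 he hu ha hKc hK (Or.inr hz)

end HermitianMetric

end Globalization

/-! ### Calculus of formally adjoint pairs, and uniqueness of formal adjoints -/

section Adjoints

open MeasureTheory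

variable {E : Type*} [NormedAddCommGroup E] [NormedSpace ℂ E] [FiniteDimensional ℂ E]

theorem conjF_lam (w : Alt E 2) (α : Fib E) : conjF (lam w α) = lam w (conjF α) := by
  rw [lam, Op.smul_apply, Op.smul_apply, Op.sum_apply, Op.sum_apply, conjF_smul, conjF_sum]
  rw [map_inv₀, map_ofNat]
  refine congrArg ((2 : ℂ)⁻¹ • ·) (Finset.sum_congr rfl fun a _ => ?_)
  rw [Op.mul_apply, Op.mul_apply, conjF_ins, conjF_ins]

variable {X : Type*} [TopologicalSpace X] [ChartedSpace E X]
  [MeasurableSpace E] [BorelSpace E] [MeasurableSpace X]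
  (g : HermitianMetric E X)

/-- The operators `T` and `S` act on the smooth forms, do not increase supports, and are formal
adjoints of each other. -/
structure IsPair (T S : Form E X → Form E X) : Prop where
  smooth_left : ∀ {u : Form E X}, IsSmooth u → IsSmooth (T u)
  smooth_right : ∀ {u : Form E X}, IsSmooth u → IsSmooth (S u)
  local_left : ∀ {u : Form E X} {x : X}, IsSmooth u → (∀ᶠ z in nhds x, u z = 0) → T u x = 0
  local_right : ∀ {u : Form E X} {x : X}, IsSmooth u → (∀ᶠ z in nhds x, u z = 0) → S u x = 0
  adjoint : ∀ {u v : Form E X}, IsSmooth u → IsSmooth v →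
    HasCompactSupport u ∨ HasCompactSupport v → g.l2Inner (T u) v = g.l2Inner u (S v)

variable {g} {T S T' S' : Form E X → Form E X}

theorem l2Inner_conj (u v : Form E X) : conj (g.l2Inner u v) = g.l2Inner v u := by
  rw [HermitianMetric.l2Inner, HermitianMetric.l2Inner, ← integral_conj]
  refine integral_congr_ae (Filter.Eventually.of_forall fun x => ?_)
  exact (g.isHerm x).ip_conj _ _

theorem l2Inner_conjForm (u v : Form E X) :
    g.l2Inner (conjForm u) (conjForm v) = conj (g.l2Inner u v) := by
  rw [HermitianMetric.l2Inner, HermitianMetric.l2Inner, ← integral_conj]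
  refine integral_congr_ae (Filter.Eventually.of_forall fun x => ?_)
  exact ip_conjF _ _ _

theorem l2Inner_smul_left (c : ℂ) (u v : Form E X) :
    g.l2Inner (c • u) v = c * g.l2Inner u v := by
  rw [HermitianMetric.l2Inner, HermitianMetric.l2Inner, ← integral_const_mul]
  refine integral_congr_ae (Filter.Eventually.of_forall fun x => ?_)
  exact ip_smul_left _ _ _ _

theorem l2Inner_smul_right (c : ℂ) (u v : Form E X) :
    g.l2Inner u (c • v) = conj c * g.l2Inner u v := by
  rw [HermitianMetric.l2Inner, HermitianMetric.l2Inner, ← integral_const_mul]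
  refine integral_congr_ae (Filter.Eventually.of_forall fun x => ?_)
  exact ip_smul_right _ _ _ _

namespace IsPair

theorem compact_left (h : IsPair g T S) {u : Form E X} (hu : IsSmooth u)
    (hc : HasCompactSupport u) : HasCompactSupport (T u) :=
  hasCompactSupport_of (fun _ hx => h.local_left hu hx) hc

theorem compact_right (h : IsPair g T S) {u : Form E X} (hu : IsSmooth u)
    (hc : HasCompactSupport u) : HasCompactSupport (S u) :=
  hasCompactSupport_of (fun _ hx => h.local_right hu hx) hc

theorem symm (h : IsPair g T S) : IsPair g S T where
  smooth_left := h.smooth_right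
  smooth_right := h.smooth_left
  local_left := h.local_right
  local_right := h.local_left
  adjoint hu hv hc := by
    rw [← l2Inner_conj, ← h.adjoint hv hu hc.symm, l2Inner_conj]

/-- Locality keeps the intermediate form compactly supported, so that the adjunctions can be applied
one after the other. -/
theorem comp (h : IsPair g T S) (h' : IsPair g T' S') :
    IsPair g (fun u => T (T' u)) (fun v => S' (S v)) where
  smooth_left hu := h.smooth_left (h'.smooth_left hu)
  smooth_right hu := h'.smooth_right (h.smooth_right hu)
  local_left hu hx := h.local_left (h'.smooth_left hu)
    (hx.eventually_nhds.mono fun _ hz => h'.local_left hu hz)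
  local_right hu hx := h'.local_right (h.smooth_right hu)
    (hx.eventually_nhds.mono fun _ hz => h.local_right hu hz)
  adjoint hu hv hc := by
    rw [h.adjoint (h'.smooth_left hu) hv (hc.imp_left (h'.compact_left hu)),
      h'.adjoint hu (h.smooth_right hv) (hc.imp_right (h.compact_right hv))]

theorem const_smul (c : ℂ) (h : IsPair g T S) :
    IsPair g (fun u => c • T u) (fun v => conj c • S v) where
  smooth_left hu := (h.smooth_left hu).const_smul c
  smooth_right hu := (h.smooth_right hu).const_smul _
  local_left {u x} hu hx := by
    have h1 := h.local_left hu hx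
    funext k
    change c • T u x k = 0
    rw [congrFun h1 k]
    exact alt_smul_zero c
  local_right {u x} hu hx := by
    have h1 := h.local_right hu hx
    funext k
    change conj c • S u x k = 0
    rw [congrFun h1 k]
    exact alt_smul_zero _
  adjoint hu hv hc := by
    rw [l2Inner_smul_left, l2Inner_smul_right, h.adjoint hu hv hc, Complex.conj_conj]

theorem congr (h : IsPair g T S) (hT : ∀ u, IsSmooth u → T' u = T u)
    (hS : ∀ u, IsSmooth u → S' u = S u) : IsPair g T' S' where
  smooth_left hu := hT _ hu ▸ h.smooth_left hu
  smooth_right hu := hS _ hu ▸ h.smooth_right hu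
  local_left hu hx := hT _ hu ▸ h.local_left hu hx
  local_right hu hx := hS _ hu ▸ h.local_right hu hx
  adjoint hu hv hc := by rw [hT _ hu, hS _ hv, h.adjoint hu hv hc]

theorem of_inner (hT : ∀ u, IsSmooth u → IsSmooth (T u)) (hS : ∀ u, IsSmooth u → IsSmooth (S u))
    (hT0 : ∀ (u : Form E X) x, u x = 0 → T u x = 0) (hS0 : ∀ (u : Form E X) x, u x = 0 → S u x = 0)
    (h : ∀ u v x, g.inner (T u) v x = g.inner u (S v) x) : IsPair g T S where
  smooth_left hu := hT _ hu
  smooth_right hu := hS _ hu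
  local_left _ hx := hT0 _ _ hx.self_of_nhds
  local_right _ hx := hS0 _ _ hx.self_of_nhds
  adjoint _ _ _ := integral_congr_ae (Filter.Eventually.of_forall (h _ _))

omit [MeasurableSpace E] [BorelSpace E] [MeasurableSpace X] [FiniteDimensional ℂ E] [ChartedSpace E X] in
theorem _root_.TwistedForms.conjForm_eventually {u : Form E X} {x : X}
    (h : ∀ᶠ z in nhds x, u z = 0) : ∀ᶠ z in nhds x, conjForm u z = 0 := h.mono fun z hz => by
  rw [conjForm_apply, hz, conjF_zero]

omit [MeasurableSpace E] [BorelSpace E] [MeasurableSpace X] [FiniteDimensional ℂ E] [ChartedSpace E X] in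
theorem _root_.TwistedForms.hasCompactSupport_conjForm {u : Form E X}
    (h : HasCompactSupport u) : HasCompactSupport (conjForm u) :=
  hasCompactSupport_of (fun _ hx => (conjForm_eventually hx).self_of_nhds) h

theorem conjOp (h : IsPair g T S) : IsPair g (conjOp T) (conjOp S) where
  smooth_left hu := (h.smooth_left hu.conjForm).conjForm
  smooth_right hu := (h.smooth_right hu.conjForm).conjForm
  local_left hu hx := by
    rw [TwistedForms.conjOp, conjForm_apply, h.local_left hu.conjForm (conjForm_eventually hx),
      conjF_zero]
  local_right hu hx := by
    rw [TwistedForms.conjOp, conjForm_apply, h.local_right hu.conjForm (conjForm_eventually hx),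
      conjF_zero]
  adjoint {u v} hu hv hc := by
    have h1 := h.adjoint hu.conjForm hv.conjForm
      (hc.imp hasCompactSupport_conjForm hasCompactSupport_conjForm)
    have h2 := l2Inner_conjForm (g := g) (T (conjForm u)) (conjForm v)
    have h3 := l2Inner_conjForm (g := g) (conjForm u) (S (conjForm v))
    rw [conjForm_conjForm] at h2 h3
    exact h2.trans ((congrArg conj h1).trans h3.symm)

variable [BorelSpace X] [T2Space X] [IsManifold 𝓘(ℂ, E) ω X]

theorem add (h : IsPair g T S) (h' : IsPair g T' S') :
    IsPair g (fun u => T u + T' u) (fun v => S v + S' v) where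
  smooth_left hu := (h.smooth_left hu).add (h'.smooth_left hu)
  smooth_right hu := (h.smooth_right hu).add (h'.smooth_right hu)
  local_left hu hx := by
    rw [Pi.add_apply, h.local_left hu hx, h'.local_left hu hx, add_zero]
  local_right hu hx := by
    rw [Pi.add_apply, h.local_right hu hx, h'.local_right hu hx, add_zero]
  adjoint hu hv hc := by
    rw [g.l2Inner_add_left (h.smooth_left hu) (h'.smooth_left hu) hv
      (hc.imp_left (h.compact_left hu)) (hc.imp_left (h'.compact_left hu)),
      g.l2Inner_add_right hu (h.smooth_right hv) (h'.smooth_right hv)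
      (hc.imp_right (h.compact_right hv)) (hc.imp_right (h'.compact_right hv)),
      h.adjoint hu hv hc, h'.adjoint hu hv hc]

theorem sub (h : IsPair g T S) (h' : IsPair g T' S') :
    IsPair g (fun u => T u - T' u) (fun v => S v - S' v) := by
  have h1 (a : Form E X) : (-1 : ℂ) • a = -a := by
    funext x k
    ext w
    exact neg_one_mul _
  refine (h.add (h'.const_smul (-1))).congr (fun u _ => ?_) fun u _ => ?_
  · rw [h1, sub_eq_add_neg]
  · rw [map_neg, map_one, h1, sub_eq_add_neg]

end IsPair

variable [BorelSpace X] [T2Space X] [IsManifold 𝓘(ℂ, E) ω X]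

/-- A smooth form that is orthogonal to the compactly supported smooth forms vanishes. -/
theorem eq_zero_of_l2Inner {d : Form E X} (hd : IsSmooth d)
    (h : ∀ u : Form E X, IsSmooth u → HasCompactSupport u → g.l2Inner u d = 0) : d = 0 := by
  funext x
  -- Testing against χ d for a bump function χ with χ(x) = 1 gives ∫ χ |d|² = 0. The integrand is
  -- continuous and nonnegative, hence zero, and in particular d vanishes at x.
  obtain ⟨χ⟩ : Nonempty (SmoothBumpFunction 𝓘(ℝ, E) x) := inferInstance
  have hu : IsSmooth (mulForm (fun z => ((χ z : ℝ) : ℂ)) d) :=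
    hd.mulForm (isSmoothFun_ofReal χ.contMDiff)
  have hc : HasCompactSupport (mulForm (fun z => ((χ z : ℝ) : ℂ)) d) := by
    refine χ.hasCompactSupport.mono fun z hz => ?_
    by_contra h1
    rw [Function.notMem_support] at h1
    refine hz ?_
    funext k
    change ((χ z : ℝ) : ℂ) • d z k = 0
    rw [h1, Complex.ofReal_zero]
    exact alt_zero_smul _
  have hin (z : X) : g.inner (mulForm (fun z => ((χ z : ℝ) : ℂ)) d) d z =
      (χ z : ℂ) * ip (g.toAlt z) (d z) (d z) := ip_smul_left _ _ _ _
  have hi := g.integrable_inner' hu hd (Or.inl hc)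
  have h0 := h _ hu hc
  have hre : ∫ z, (g.inner (mulForm (fun z => ((χ z : ℝ) : ℂ)) d) d z).re ∂g.vol = 0 := by
    have h1 := integral_re hi
    rw [HermitianMetric.l2Inner] at h0
    rw [h0] at h1
    exact h1
  have hcont : Continuous fun z => (g.inner (mulForm (fun z => ((χ z : ℝ) : ℂ)) d) d z).re :=
    Complex.continuous_re.comp (g.continuous_inner hu hd)
  have hpos : ∀ z, 0 ≤ (g.inner (mulForm (fun z => ((χ z : ℝ) : ℂ)) d) d z).re := fun z => by
    rw [hin, Complex.re_ofReal_mul]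
    exact mul_nonneg χ.nonneg ((g.isHerm z).ip_self_nonneg _)
  have h2 := (integral_eq_zero_iff_of_nonneg hpos hi.re).1 hre
  have h3 := (hcont.ae_eq_iff_eq g.vol continuous_const).1 h2
  have h4 : (g.inner (mulForm (fun z => ((χ z : ℝ) : ℂ)) d) d x).re = 0 := congrFun h3 x
  rw [hin, Complex.re_ofReal_mul, χ.eq_one, one_mul] at h4
  refine (g.isHerm x).eq_zero_of_ip_self (Complex.ext h4 ?_)
  exact Complex.conj_eq_iff_im.1 ((g.isHerm x).ip_conj _ _)

theorem eq_of_l2Inner {a b : Form E X} (ha : IsSmooth a) (hb : IsSmooth b)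
    (h : ∀ u : Form E X, IsSmooth u → HasCompactSupport u → g.l2Inner u a = g.l2Inner u b) :
    a = b := by
  refine sub_eq_zero.1 (eq_zero_of_l2Inner (g := g) (ha.sub hb) fun u hu hc => ?_)
  have h1 := g.l2Inner_add_right hu (ha.sub hb) hb (Or.inl hc) (Or.inl hc)
  rw [sub_add_cancel, h u hu hc] at h1
  exact left_eq_add.1 (h1.trans (add_comm _ _))

namespace IsPair

theorem unique (h : IsPair g T S) (h' : IsPair g T S') {v : Form E X} (hv : IsSmooth v) :
    S v = S' v :=
  eq_of_l2Inner (g := g) (h.smooth_right hv) (h'.smooth_right hv) fun u hu hc => by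
    rw [← h.adjoint hu hv (Or.inl hc), h'.adjoint hu hv (Or.inl hc)]

theorem existsUnique (h : IsPair g T S) {v : Form E X} (hv : IsSmooth v) :
    g.IsAdjointAt T v (S v) ∧ ∀ w, g.IsAdjointAt T v w → w = S v :=
  ⟨⟨h.smooth_right hv, fun _ hu hc => h.adjoint hu hv hc⟩, fun _ hw =>
    eq_of_l2Inner (g := g) hw.1 (h.smooth_right hv) fun u hu hc => by
      rw [← hw.2 u hu (Or.inl hc), h.adjoint hu hv (Or.inl hc)]⟩

theorem hasFormalAdjoint (h : IsPair g T S) : g.HasFormalAdjoint T := fun v hv =>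
  ⟨S v, h.existsUnique hv⟩

/-- The operator `formalAdjoint` is a choice; on smooth forms existence and uniqueness determine its
value, so it may be replaced by an explicit partner. -/
theorem formalAdjoint_eq (h : IsPair g T S) {v : Form E X} (hv : IsSmooth v) :
    g.formalAdjoint T v = S v :=
  (h.existsUnique hv).2 _ (Classical.epsilon_spec (p := fun w => g.IsAdjointAt T v w)
    ⟨S v, (h.existsUnique hv).1⟩)

end IsPair

end Adjoints

/-! ### The adjoint pairs of L, D_η and τ_η, and identity (a) -/

section Identities

variable {E : Type*} [NormedAddCommGroup E] [NormedSpace ℂ E] [FiniteDimensional ℂ E]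
  {X : Type*} [TopologicalSpace X] [ChartedSpace E X]
  [MeasurableSpace E] [BorelSpace E] [MeasurableSpace X] [BorelSpace X]
  [IsManifold 𝓘(ℂ, E) ω X] (g : HermitianMetric E X)

omit [BorelSpace X] in
theorem isPair_wedge {p : ℕ} {ρ : Form E X} (hρ : IsSmooth ρ) (h : IsDeg p ρ) :
    IsPair g (wedge ρ) (g.contrForm p ρ) := by
  refine IsPair.of_inner (fun u hu => hρ.wedge h hu) (fun u hu => g.isSmooth_contrForm hρ hu)
    (fun u x hx => wedge_eq_zero hx h) (fun u x hx => g.contrForm_eq_zero hx p ρ) fun u v x => ?_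
  rw [g.inner_eq, g.inner_eq, wedge_apply_of_isDeg h]
  exact isAdj_wd (g.toAlt x) p (ρ x p) (u x) (v x)

omit [BorelSpace X] in
theorem isPair_lefschetz : IsPair g g.lefschetz g.Lam := by
  refine (isPair_wedge g g.smooth g.isDeg_form).congr (fun _ _ => rfl) fun u _ => ?_
  funext x
  change lam (g.toAlt x) (u x) = contr (g.toAlt x) 2 (g.form x 2) (u x)
  rw [g.form_two, (g.isHerm x).contr_self]

omit [BorelSpace X] [IsManifold 𝓘(ℂ, E) ω X] in
theorem isPair_mulForm {f : X → ℝ} (hf : IsSmoothFun (E := E) (fun x => (f x : ℂ))) :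
    IsPair g (mulForm fun x => (f x : ℂ)) (mulForm fun x => (f x : ℂ)) := by
  have h0 (u : Form E X) (x : X) (hx : u x = 0) : mulForm (fun x => (f x : ℂ)) u x = 0 := by
    funext k
    change (f x : ℂ) • u x k = 0
    rw [hx]
    exact alt_smul_zero _
  refine IsPair.of_inner (fun u hu => hu.mulForm hf) (fun u hu => hu.mulForm hf) h0 h0
    fun u v x => ?_
  refine (ip_smul_left _ _ _ _).trans (Eq.trans ?_ (ip_smul_right _ _ _ _).symm)
  rw [Complex.conj_ofReal]

variable [T2Space X]

/-- The adjoint of `c [Λ, P] - (c f) [α ∧ ·, Λ]`. -/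
theorem isPair_commutators {P Q : Form E X → Form E X} (hP : IsPair g P Q) {α : Form E X}
    (hα : IsSmooth α) (hd : IsDeg 1 α) {f : X → ℝ}
    (hf : IsSmoothFun (E := E) (fun x => (f x : ℂ))) (c : ℂ) :
    IsPair g
      (fun u => c • (g.Lam (P u) - P (g.Lam u)) -
        c • mulForm (fun x => (f x : ℂ)) (wedge α (g.Lam u) - g.Lam (wedge α u)))
      (fun u => conj c • (Q (g.lefschetz u) - g.lefschetz (Q u)) -
        conj c • (g.lefschetz (g.contrForm 1 α (mulForm (fun x => (f x : ℂ)) u)) -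
          g.contrForm 1 α (g.lefschetz (mulForm (fun x => (f x : ℂ)) u)))) := by
  have hL := (isPair_lefschetz g).symm
  have hw := isPair_wedge g hα hd
  exact (((hL.comp hP).sub (hP.comp hL)).const_smul c).sub
    (((isPair_mulForm g hf).comp ((hw.comp hL).sub (hL.comp hw))).const_smul c)

theorem lambda_eq {u : Form E X} (hu : IsSmooth u) : g.lambda u = g.Lam u :=
  (isPair_lefschetz g).formalAdjoint_eq hu

variable {η : X → ℝ} (hη : ContMDiff 𝓘(ℝ, E) 𝓘(ℝ, ℝ) ∞ η) (hη0 : ∀ x, η x ≠ 0)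
include hη hη0

/-- The torsion is defined with the chosen adjoint `lambda`, which is known to equal the contraction
`Lam` on smooth forms. The rest is pointwise algebra, without integration by parts. -/
theorem isPair_torsion : IsPair g (g.torsion η) (g.torsAdj η) := by
  have hw := isPair_wedge g (g.isSmooth_twistedD_form hη hη0) (g.isDeg_form.twistedD η)
  have hL := (isPair_lefschetz g).symm
  refine ((hL.comp hw).sub (hw.comp hL)).congr (fun u hu => ?_) fun u hu => rfl
  rw [HermitianMetric.torsion, comm, lambda_eq g (hw.smooth_left hu), lambda_eq g hu]

theorem isPair_twistedD [SecondCountableTopology X] : IsPair g (twistedD η) (g.dAdj η) where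
  smooth_left hu := IsSmooth.twistedD hη hη0 hu
  smooth_right hu := g.isSmooth_dAdj hη hη0 hu
  local_left _ hx := twistedD_eq_zero hx η
  local_right _ hx := g.dAdj_eq_zero hx
  adjoint hu hv hc := g.l2Inner_twistedD hη hη0 hu hv hc

/-- Identity (a) is built into the definition of `dAdj`; the content is in `isPair_twistedD`, which
says that `dAdj` is the formal adjoint. -/
theorem dAdj_add_torsAdj (u : Form E X) (hu : IsSmooth u) :
    g.dAdj η u + g.torsAdj η u =
      -(Complex.I • comm g.lambda (twistedDbar (-η)) u) +
        mulForm (fun x => (Module.finrank ℂ E : ℂ) / (η x : ℂ))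
          (comm (wedge (Complex.I • twisteddbar (-η) (ofFun E η))) g.lambda u) := by
  have hb : IsDeg 1 (twisteddbar (-η) (ofFun E η)) := isDeg_twisteddbar_ofFun (E := E) (-η) η
  have hbs : IsSmooth (twisteddbar (-η) (ofFun E η)) :=
    isSmooth_twisteddbar_ofFun (s := -η) hη.neg hη
  have hw : IsSmooth (wedge (Complex.I • twisteddbar (-η) (ofFun E η)) u) := by
    rw [wedge_const_smul hb]
    exact (hbs.wedge hb hu).const_smul _
  rw [HermitianMetric.dAdj, sub_add_cancel, comm, comm, lambda_eq g hu,
    lambda_eq g (IsSmooth.twistedDbar hη hη0 hu), lambda_eq g hw]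

omit hη hη0 [IsManifold 𝓘(ℂ, E) ω X] [T2Space X] [MeasurableSpace E] [BorelSpace E]
  [MeasurableSpace X] [BorelSpace X] in
theorem conjForm_Lam (u : Form E X) : conjForm (g.Lam u) = g.Lam (conjForm u) :=
  funext fun x => conjF_lam (g.toAlt x) (u x)

end Identities

/-! ### Scalars, signs and conjugation; identity (b) -/

section Algebra

variable {E : Type*} [NormedAddCommGroup E] [NormedSpace ℂ E] {X : Type*}

theorem wedge_mulForm {p : ℕ} {ρ : Form E X} (h : IsDeg p ρ) (f : X → ℂ) (u : Form E X) :
    wedge ρ (mulForm f u) = mulForm f (wedge ρ u) := by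
  funext x
  have h1 : mulForm f (wedge ρ u) x = f x • wedge ρ u x := rfl
  rw [h1, wedge_apply_of_isDeg h, wedge_apply_of_isDeg h]
  exact map_smul (wd p (ρ x p)) (f x) (u x)

theorem wedge_neg_left {p : ℕ} {ρ : Form E X} (h : IsDeg p ρ) (u : Form E X) :
    wedge (-ρ) u = -wedge ρ u := by
  have h1 (a : Form E X) : -a = (-1 : ℂ) • a := by
    funext x k
    ext w
    exact (neg_one_mul _).symm
  rw [h1, h1, wedge_const_smul h]

theorem conjForm_wedge {p : ℕ} {ρ : Form E X} (h : IsDeg p ρ) (u : Form E X) :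
    conjForm (wedge ρ u) = wedge (conjForm ρ) (conjForm u) := by
  funext x
  rw [conjForm_apply, wedge_apply_of_isDeg h, wedge_apply_of_isDeg h.conjForm, conjF_wd]
  rfl

theorem conjForm_sub (u v : Form E X) : conjForm (u - v) = conjForm u - conjForm v :=
  funext fun x => conjF_sub (u x) (v x)

theorem conjForm_mulForm (f : X → ℂ) (u : Form E X) :
    conjForm (mulForm f u) = mulForm (fun x => conj (f x)) (conjForm u) :=
  funext fun x => conjF_smul (f x) (u x)

theorem conjForm_const_smul (c : ℂ) (u : Form E X) : conjForm (c • u) = conj c • conjForm u :=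
  conjForm_mulForm (fun _ => c) u

theorem ofFun_neg (f : X → ℝ) : ofFun E (-f) = -ofFun E f := by
  funext x k
  rcases eq_or_ne k 0 with rfl | hk
  · ext v
    change ((-f x : ℝ) : ℂ) = -(f x : ℂ)
    rw [Complex.ofReal_neg]
  · change ofFun E (-f) x k = -ofFun E f x k
    rw [isDeg_ofFun (-f) x k hk, isDeg_ofFun f x k hk, neg_zero]

variable [TopologicalSpace X] [ChartedSpace E X]

theorem extd_neg {u : Form E X} (hu : IsSmooth u) : extd (-u) = -extd u := by
  have h := extd_add hu.neg hu
  have h0 : extd (0 : Form E X) = 0 :=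
    funext fun x => extd_eq_zero (Filter.Eventually.of_forall fun _ => rfl)
  rw [neg_add_cancel, h0] at h
  exact eq_neg_of_add_eq_zero_left h.symm

variable [FiniteDimensional ℂ E]

omit [FiniteDimensional ℂ E] in
theorem twistedd_ofFun_neg [IsManifold 𝓘(ℂ, E) ω X] (s : X → ℝ) {f : X → ℝ}
    (hf : ContMDiff 𝓘(ℝ, E) 𝓘(ℝ, ℝ) ∞ f) :
    twistedd s (ofFun E (-f)) = -twistedd s (ofFun E f) := by
  rw [twistedd_ofFun, twistedd_ofFun, ofFun_neg, extd_neg (isSmooth_ofFun hf)]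
  exact funext fun x => map_neg (thetaOp (s x : ℂ)) (extd (ofFun E f) x)

variable (g : HermitianMetric E X)

theorem Lam_mulForm (f : X → ℂ) (u : Form E X) : g.Lam (mulForm f u) = mulForm f (g.Lam u) :=
  funext fun x => map_smul (lam (g.toAlt x)) (f x) (u x)

theorem contrForm_mulForm (p : ℕ) (ρ : Form E X) (f : X → ℂ) (u : Form E X) :
    g.contrForm p ρ (mulForm f u) = mulForm f (g.contrForm p ρ u) :=
  funext fun x => map_smul (contr (g.toAlt x) p (ρ x p)) (f x) (u x)

/-- The right-hand side of (a) is put in the shape c [Λ, A] - c f [α ∧ ·, Λ] with c = -i and f = n/η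
real. The conjugate identity (b) has the same shape with c = i, and `adjoint_commutators` applies to
it. -/
theorem dAdj_add_torsAdj_eq (η : X → ℝ) (u : Form E X) :
    g.dAdj η u + g.torsAdj η u =
      (-Complex.I) • (g.Lam (twistedDbar (-η) u) - twistedDbar (-η) (g.Lam u)) -
        (-Complex.I) • mulForm (fun x => ((Module.finrank ℂ E / η x : ℝ) : ℂ))
          (wedge (twisteddbar (-η) (ofFun E η)) (g.Lam u) -
            g.Lam (wedge (twisteddbar (-η) (ofFun E η)) u)) := by
  have hb : IsDeg 1 (twisteddbar (-η) (ofFun E η)) := isDeg_twisteddbar_ofFun (E := E) (-η) η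
  rw [HermitianMetric.dAdj, sub_add_cancel, wedge_const_smul hb, wedge_const_smul hb]
  have h1 (a : Form E X) : g.Lam (Complex.I • a) = Complex.I • g.Lam a :=
    Lam_mulForm g (fun _ => Complex.I) a
  rw [h1]
  funext x k
  ext w
  simp only [mulForm, Pi.add_apply, Pi.sub_apply, Pi.neg_apply, Pi.smul_apply,
    ContinuousAlternatingMap.add_apply, ContinuousAlternatingMap.sub_apply,
    ContinuousAlternatingMap.neg_apply, ContinuousAlternatingMap.smul_apply, smul_eq_mul,
    Complex.ofReal_div, Complex.ofReal_natCast]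
  ring

/-- This is the conjugate of the identity for -η. The conjugate of d̄_η(-η) is -d_η η, and its sign
cancels that of n/(-η). -/
theorem conjOp_dAdj_add_torsAdj [IsManifold 𝓘(ℂ, E) ω X] {η : X → ℝ}
    (hη : ContMDiff 𝓘(ℝ, E) 𝓘(ℝ, ℝ) ∞ η) (u : Form E X) :
    conjOp (g.dAdj (-η)) u + conjOp (g.torsAdj (-η)) u =
      Complex.I • (g.Lam (twistedD η u) - twistedD η (g.Lam u)) -
        Complex.I • mulForm (fun x => ((Module.finrank ℂ E / η x : ℝ) : ℂ))
          (wedge (twistedd η (ofFun E η)) (g.Lam u) - g.Lam (wedge (twistedd η (ofFun E η)) u)) := by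
  have ha : IsDeg 1 (twistedd η (ofFun E η)) := isDeg_twistedd_ofFun (E := E) η η
  have hb : IsDeg 1 (twisteddbar η (ofFun E (-η))) := isDeg_twisteddbar_ofFun (E := E) η (-η)
  have hc : conjForm (twisteddbar η (ofFun E (-η))) = -twistedd η (ofFun E η) := by
    rw [twisteddbar_ofFun, conjForm_conjForm, twistedd_ofFun_neg η hη]
  have hD (v : Form E X) : conjForm (twistedDbar η v) = twistedD η (conjForm v) := by
    rw [twistedDbar, conjOp, conjForm_conjForm]
  rw [conjOp, conjOp, ← conjForm_add, dAdj_add_torsAdj_eq, neg_neg, conjForm_sub,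
    conjForm_const_smul, conjForm_const_smul, conjForm_sub, conjForm_mulForm, conjForm_sub,
    conjForm_Lam, conjForm_Lam, hD, hD, conjForm_Lam, conjForm_wedge hb, conjForm_wedge hb,
    conjForm_Lam, conjForm_conjForm, hc, wedge_neg_left ha, wedge_neg_left ha]
  have h1 (a : Form E X) : g.Lam (-a) = -g.Lam a :=
    funext fun x => map_neg (lam (g.toAlt x)) (a x)
  rw [h1]
  funext x k
  ext w
  simp only [mulForm, Pi.sub_apply, Pi.neg_apply, Pi.smul_apply,
    ContinuousAlternatingMap.sub_apply,
    ContinuousAlternatingMap.neg_apply, ContinuousAlternatingMap.smul_apply, smul_eq_mul,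
    Complex.conj_ofReal, map_neg, Complex.conj_I, Complex.ofReal_neg, div_neg]
  ring

end Algebra

/-! ### Adjoints of commutator identities, for (c) and (d) -/

section Final

variable {E : Type*} [NormedAddCommGroup E] [NormedSpace ℂ E] [FiniteDimensional ℂ E]
  {X : Type*} [TopologicalSpace X] [ChartedSpace E X]
  [MeasurableSpace E] [BorelSpace E] [MeasurableSpace X] [BorelSpace X]
  [IsManifold 𝓘(ℂ, E) ω X] [T2Space X] (g : HermitianMetric E X)

/-- If `A = c [Λ, P] - (c f) [α ∧ ·, Λ]` has the adjoint `B`, then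
`B = c̄ [P^⋆, L] - f [L, c̄ (α ∧ ·)^⋆]`. -/
theorem adjoint_commutators {A B P Q : Form E X → Form E X} (hA : IsPair g A B)
    (hP : IsPair g P Q) {α : Form E X} (hα : IsSmooth α) (hd : IsDeg 1 α) {f : X → ℝ}
    (hf : IsSmoothFun (E := E) (fun x => (f x : ℂ))) {c : ℂ}
    (h : ∀ u, A u = c • (g.Lam (P u) - P (g.Lam u)) -
        c • mulForm (fun x => (f x : ℂ)) (wedge α (g.Lam u) - g.Lam (wedge α u)))
    {u : Form E X} (hu : IsSmooth u) :
    B u = conj c • comm (g.formalAdjoint P) g.lefschetz u -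
      conj c • mulForm (fun x => (f x : ℂ))
        (comm g.lefschetz (g.formalAdjoint (wedge α)) u) := by
  have hL := isPair_lefschetz g
  -- The form of `A` given by `h` has an explicit adjoint, computed term by term; uniqueness
  -- identifies it with `B`.
  rw [hA.unique ((isPair_commutators g hP hα hd hf c).congr (fun u _ => h u) fun _ _ => rfl) hu]
  rw [comm, comm, hP.formalAdjoint_eq hu, hP.formalAdjoint_eq (hL.smooth_left hu),
    (isPair_wedge g hα hd).formalAdjoint_eq hu,
    (isPair_wedge g hα hd).formalAdjoint_eq (hL.smooth_left hu), contrForm_mulForm]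
  simp only [HermitianMetric.lefschetz]
  rw [wedge_mulForm g.isDeg_form, wedge_mulForm g.isDeg_form, contrForm_mulForm]
  congr 2
  funext x k
  ext w
  exact (mul_sub _ _ _).symm

omit [FiniteDimensional ℂ E] [TopologicalSpace X] [ChartedSpace E X] [MeasurableSpace E]
  [BorelSpace E] [MeasurableSpace X] [BorelSpace X] [IsManifold 𝓘(ℂ, E) ω X] [T2Space X] in
theorem comm_const_smul {p : ℕ} {ρ : Form E X} (h : IsDeg p ρ) (c : ℂ)
    (T : Form E X → Form E X) (u : Form E X) :
    comm (wedge ρ) (fun v => c • T v) u = c • comm (wedge ρ) T u := by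
  rw [comm, comm]
  have h1 := wedge_mulForm h (fun _ => c) (T u)
  rw [mulForm_const, mulForm_const] at h1
  rw [h1]
  funext x k
  ext w
  exact (mul_sub _ _ _).symm

end Final

end TwistedForms

end

theorem proposition3p5
    {E : Type*} [NormedAddCommGroup E] [NormedSpace ℂ E] [FiniteDimensional ℂ E]
    [MeasurableSpace E] [BorelSpace E]
    {X : Type*} [TopologicalSpace X] [T2Space X] [SecondCountableTopology X]
    [ChartedSpace E X] [IsManifold 𝓘(ℂ, E) ω X] [MeasurableSpace X] [BorelSpace X]
    (n : ℕ) (hn : 2 ≤ n) (hdim : Module.finrank ℂ E = n)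
    (g : TwistedForms.HermitianMetric E X)
    (η : X → ℝ) (hη : ContMDiff 𝓘(ℝ, E) 𝓘(ℝ, ℝ) ∞ η)
    (hsign : (∀ x, 0 < η x) ∨ (∀ x, η x < 0)) :
    -- the formal adjoints that occur below exist and are unique
    (g.HasFormalAdjoint g.lefschetz ∧
      g.HasFormalAdjoint (TwistedForms.twistedD η) ∧
      g.HasFormalAdjoint (TwistedForms.twistedDbar (-η)) ∧
      g.HasFormalAdjoint (g.torsion η) ∧
      g.HasFormalAdjoint (g.torsionBar (-η)) ∧
      g.HasFormalAdjoint
        (TwistedForms.wedge (TwistedForms.twistedd η (TwistedForms.ofFun E η))) ∧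
      g.HasFormalAdjoint
        (TwistedForms.wedge (TwistedForms.twisteddbar (-η) (TwistedForms.ofFun E η)))) ∧
    -- (a)
    (∀ u : TwistedForms.Form E X, TwistedForms.IsSmooth u →
      g.formalAdjoint (TwistedForms.twistedD η) u + g.formalAdjoint (g.torsion η) u =
        -(Complex.I • TwistedForms.comm g.lambda (TwistedForms.twistedDbar (-η)) u) +
          TwistedForms.mulForm (fun x => (n : ℂ) / (η x : ℂ))
            (TwistedForms.comm
              (TwistedForms.wedge
                (Complex.I • TwistedForms.twisteddbar (-η) (TwistedForms.ofFun E η)))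
              g.lambda u)) ∧
    -- (b)
    (∀ u : TwistedForms.Form E X, TwistedForms.IsSmooth u →
      g.formalAdjoint (TwistedForms.twistedDbar (-η)) u + g.formalAdjoint (g.torsionBar (-η)) u =
        Complex.I • TwistedForms.comm g.lambda (TwistedForms.twistedD η) u -
          TwistedForms.mulForm (fun x => (n : ℂ) / (η x : ℂ))
            (TwistedForms.comm
              (TwistedForms.wedge
                (Complex.I • TwistedForms.twistedd η (TwistedForms.ofFun E η)))
              g.lambda u)) ∧
    -- (c)
    (∀ u : TwistedForms.Form E X, TwistedForms.IsSmooth u →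
      TwistedForms.twistedD η u + g.torsion η u =
        Complex.I •
            TwistedForms.comm (g.formalAdjoint (TwistedForms.twistedDbar (-η))) g.lefschetz u -
          TwistedForms.mulForm (fun x => (n : ℂ) / (η x : ℂ))
            (TwistedForms.comm g.lefschetz
              (fun v => Complex.I • g.formalAdjoint
                (TwistedForms.wedge (TwistedForms.twisteddbar (-η) (TwistedForms.ofFun E η))) v)
              u)) ∧
    -- (d)
    (∀ u : TwistedForms.Form E X, TwistedForms.IsSmooth u →
      TwistedForms.twistedDbar (-η) u + g.torsionBar (-η) u =
        -(Complex.I •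
            TwistedForms.comm (g.formalAdjoint (TwistedForms.twistedD η)) g.lefschetz u) +
          TwistedForms.mulForm (fun x => (n : ℂ) / (η x : ℂ))
            (TwistedForms.comm g.lefschetz
              (fun v => Complex.I • g.formalAdjoint
                (TwistedForms.wedge (TwistedForms.twistedd η (TwistedForms.ofFun E η))) v)
              u)) := by
  subst hdim
  have hη0 : ∀ x, η x ≠ 0 := fun x => hsign.elim (fun h => (h x).ne') fun h => (h x).ne
  have hη' : ContMDiff 𝓘(ℝ, E) 𝓘(ℝ, ℝ) ∞ (-η) := hη.neg
  have hη0' : ∀ x, (-η) x ≠ 0 := fun x => neg_ne_zero.2 (hη0 x)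
  have pL := TwistedForms.isPair_lefschetz g
  have pD := TwistedForms.isPair_twistedD g hη hη0
  have pT := TwistedForms.isPair_torsion g hη hη0
  -- The operators D̄_{-η} and τ̄_{-η} are by definition the conjugates of D_{-η} and τ_{-η}, so
  -- conjugating the pairs for -η provides their adjoints.
  have pD' := (TwistedForms.isPair_twistedD g hη' hη0').conjOp
  have pT' := (TwistedForms.isPair_torsion g hη' hη0').conjOp
  have hα := TwistedForms.isSmooth_twistedd_ofFun (E := E) hη hη
  have hαd := TwistedForms.isDeg_twistedd_ofFun (E := E) η η
  have hβ := TwistedForms.isSmooth_twisteddbar_ofFun (E := E) hη' hη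
  have hβd := TwistedForms.isDeg_twisteddbar_ofFun (E := E) (-η) η
  have hf : TwistedForms.IsSmoothFun (E := E)
      (fun x => ((Module.finrank ℂ E / η x : ℝ) : ℂ)) := by
    simpa only [Complex.ofReal_div, Complex.ofReal_natCast] using
      TwistedForms.HermitianMetric.isSmoothFun_div hη hη0 (Module.finrank ℂ E : ℂ)
  have hfe : (fun x => (Module.finrank ℂ E : ℂ) / (η x : ℂ)) =
      fun x => ((Module.finrank ℂ E / η x : ℝ) : ℂ) := by
    funext x
    rw [Complex.ofReal_div, Complex.ofReal_natCast]
  refine ⟨⟨pL.hasFormalAdjoint, pD.hasFormalAdjoint, pD'.hasFormalAdjoint, pT.hasFormalAdjoint,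
    pT'.hasFormalAdjoint, (TwistedForms.isPair_wedge g hα hαd).hasFormalAdjoint,
    (TwistedForms.isPair_wedge g hβ hβd).hasFormalAdjoint⟩, fun u hu => ?_, fun u hu => ?_,
    fun u hu => ?_, fun u hu => ?_⟩
  · rw [pD.formalAdjoint_eq hu, pT.formalAdjoint_eq hu,
      TwistedForms.dAdj_add_torsAdj g hη hη0 u hu]
  -- Identity (b) is the conjugate of (a) for -η; what remains is to replace `lambda` by `Lam` on
  -- smooth forms and to move the scalars.
  · have h1 : g.formalAdjoint (TwistedForms.twistedDbar (-η)) u =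
        TwistedForms.conjOp (g.dAdj (-η)) u := pD'.formalAdjoint_eq hu
    have h2 : g.formalAdjoint (g.torsionBar (-η)) u =
        TwistedForms.conjOp (g.torsAdj (-η)) u := pT'.formalAdjoint_eq hu
    rw [h1, h2, TwistedForms.conjOp_dAdj_add_torsAdj g hη, hfe, TwistedForms.comm,
      TwistedForms.comm, TwistedForms.wedge_const_smul hαd, TwistedForms.wedge_const_smul hαd,
      TwistedForms.lambda_eq g hu, TwistedForms.lambda_eq g (pD.smooth_left hu),
      TwistedForms.lambda_eq g ((hα.wedge hαd hu).const_smul _)]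
    have h3 := TwistedForms.Lam_mulForm g (fun _ => Complex.I)
      (TwistedForms.wedge (TwistedForms.twistedd η (TwistedForms.ofFun E η)) u)
    rw [TwistedForms.mulForm_const, TwistedForms.mulForm_const] at h3
    rw [h3]
    congr 1
    funext x k
    ext w
    simp only [TwistedForms.mulForm, Pi.sub_apply, Pi.smul_apply,
      ContinuousAlternatingMap.sub_apply, ContinuousAlternatingMap.smul_apply, smul_eq_mul]
    ring
  -- Identity (c) is the adjoint of (a): the adjoint of D_η^⋆ + τ_η^⋆ is D_η + τ_η, and c = -i
  -- becomes i.
  · refine (TwistedForms.adjoint_commutators g (pD.symm.add pT.symm) pD' hβ hβd hf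
      (c := -Complex.I) (fun v => TwistedForms.dAdj_add_torsAdj_eq g η v) hu).trans ?_
    rw [map_neg, Complex.conj_I, neg_neg, hfe]
    congr 1
    refine Eq.trans ?_ (congrArg _ (TwistedForms.comm_const_smul g.isDeg_form Complex.I
      (g.formalAdjoint (TwistedForms.wedge
        (TwistedForms.twisteddbar (-η) (TwistedForms.ofFun E η)))) u).symm)
    funext x k
    ext w
    exact mul_left_comm _ _ _
  -- Identity (d) is the adjoint of (b) in the same way, with c = i becoming -i.
  · refine (TwistedForms.adjoint_commutators g (pD'.symm.add pT'.symm) pD hα hαd hf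
      (c := Complex.I) (fun v => TwistedForms.conjOp_dAdj_add_torsAdj g hη v) hu).trans ?_
    rw [Complex.conj_I, hfe]
    have h4 : TwistedForms.comm g.lefschetz _ u = Complex.I • TwistedForms.comm g.lefschetz _ u :=
      TwistedForms.comm_const_smul g.isDeg_form Complex.I (g.formalAdjoint
        (TwistedForms.wedge (TwistedForms.twistedd η (TwistedForms.ofFun E η)))) u
    refine Eq.trans ?_ (congrArg (fun a => _ + TwistedForms.mulForm _ a) h4.symm)
    funext x k
    ext w
    simp only [TwistedForms.mulForm, Pi.sub_apply, Pi.smul_apply, Pi.add_apply, Pi.neg_apply,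
      ContinuousAlternatingMap.sub_apply, ContinuousAlternatingMap.smul_apply,
      ContinuousAlternatingMap.add_apply, ContinuousAlternatingMap.neg_apply, smul_eq_mul]
    ring
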